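/- Let $M$ be a smooth (oriented) $n$-manifold, $H_0$ a closed 3-form on $M$, and let $E_{H_0}=TM\oplus T^*M$ be the exact Courant algebroid with anchor $\pi(X+\xi)=X$, pairing $\langle X+\xi,Y+\eta\rangle=\tfrac12(\eta(X)+\xi(Y))$ and Dorfman bracket $[X+\xi,Y+\eta]=[X,Y]+\mathcal L_X\eta-\iota_Yd\xi+\iota_Y\iota_XH_0$ (any exact Courant algebroid becomes one of these after the choice of an isotropic splitting). For a Riemannian metric $g$, a 3-form $H$ and 1-forms $\theta$ write: $\mathrm{Rc}_g$ for the Ricci tensor; $(H\circ H)(u,v)=g(\iota_uH,\iota_vH)=\sum_{i,j}H(u,e_i,e_j)H(v,e_i,e_j)$ for a $g$-orthonormal basis $(e_i)$; $d^*_gH=-\sum_i(\nabla_{e_i}H)(e_i,\cdot,\cdot)$ for the codifferential; $\nabla^+_XY=\nabla_XY+\tfrac12g^{-1}H(X,Y,\cdot)$ for the Bismut connection and $(\nabla^+\theta)(u,v)=(\nabla^+_u\theta)(v)$; and $\mathrm{div}_{g,\theta}(X+\xi)=\mathrm{tr}(\nabla X)-\langle\theta,X+\xi\rangle$. A generalized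 metric $\mathcal G$ has eigenbundles $E_\pm$ for the eigenvalues $\pm1$. A generalized connection is a linear map $D:\Gamma(E)\to\Gamma(E^*\otimes E)$ with $D_a(fz)=fD_az+(\pi(a)f)z$ and $\pi(a)\langle z,w\rangle=\langle D_az,w\rangle+\langle z,D_aw\rangle$; its torsion is $T_D(z,w)=D_zw-D_wz-[z,w]+(Dz)^*w$, its divergence is $z\mapsto\mathrm{tr}(Dz)$, and, if $D\mathcal G=0$, for $a\in E_-$ and $b\in E_+$ it has $\mathrm{Rc}^+_D(a,b)=\mathrm{tr}\big(c\in E_+\mapsto D_cD_ab-D_aD_cb-D_{[c,a]}b\big)$. A family $(\mathcal G(t),\mathrm{div}(t))_{t\in I}$ solves the generalized Ricci flow if $\langle\dot{\mathcal G}(t)a,b\rangle=-2\,\mathrm{Rc}^+_{\mathcal G(t),\mathrm{div}(t)}(a,b)$ for all $t$ in the interior of $I$ and all $a\in E_-|_t$, $b\in E_+|_t$, where $\mathrm{Rc}^+_{\mathcal G,\mathrm{div}}=\mathrm{Rc}^+_D$ for a torsion-free $D$ with $D\mathcal G=0$ and divergence $\mathrm{div}$ (the existence of such a $D$ is part of the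 definition; the choice of $D$ does not matter). Let $g_0$ be a Riemannian metric on $M$, and let $I\subset\mathbb R$ be an interval with non-empty interior and $0\in I$. Let $c:I\to(0,\infty)$ be smooth with $c(0)=1$; let $(\varphi_t)_{t\in I}$ be a smooth family of diffeomorphisms of $M$ with $\varphi_0=\mathrm{id}$ and $\tfrac{d}{dt}\varphi_t(x)=Y_t(\varphi_t(x))$; let $(B(t))_{t\in I}$ be a smooth family of 2-forms with $B(0)=0$ and $(\theta(t))_{t\in I}$ a smooth family of 1-forms with $\theta(0)=\theta_0$. Put $g(t)=c(t)\varphi_t^*g_0$, $$\mathcal G(t)=e^{B(t)}\begin{pmatrix}0&g(t)^{-1}\\ g(t)&0\end{pmatrix}e^{-B(t)},\qquad \mathrm{div}(t)=\mathrm{div}_{g(t),\theta(t)},$$ where $e^B(X+\xi)=X+\xi+\iota_XB$, and define $\lambda\in\mathbb R$, $X$, $\omega$ by $-2\lambda=\dot c(0)$, $-2X=Y_0$, $\omega=\dot B(0)$. (1) If $(\mathcal G(t),\mathrm{div}(t))_{t\in I}$ solves the generalized Ricci flow, then $X$ is a smooth vector field, $\omega$ is a smooth 2-form, and $$\mathrm{Rc}_{g_0}=\lambda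 g_0+\mathcal L_Xg_0+\tfrac14H_0\circ H_0-\tfrac12\nabla^+\theta_0+\tfrac12d^*_{g_0}H_0+\tfrac12\omega, \qquad (*)$$ as well as $$\mathrm{Rc}_{g_0}=\lambda g_0+\mathcal L_Xg_0+\tfrac14H_0\circ H_0-\tfrac14\mathcal L_{g_0^{-1}\theta_0}g_0,\qquad \omega=-d^*_{g_0}H_0+\tfrac12d\theta_0-\tfrac12\iota_{g_0^{-1}\theta_0}H_0. \qquad (**)$$ (2) For all $\lambda\in\mathbb R$, all smooth vector fields $X$, smooth 1-forms $\theta_0$ and smooth 2-forms $\omega$ on $M$, the equation $(*)$ is equivalent to the system $(**)$. -/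

import Mathlib

open scoped Manifold ContDiff

noncomputable section

namespace GenRicci

/-! ### Tensor fields on a smooth manifold

Tensor fields are functions on `M` with values in the tangent spaces and the spaces of multilinear
forms on them. A covariant tensor field is smooth if its values on smooth vector fields are smooth
functions. -/

section Fields

variable (n : ℕ) (M : Type*) [TopologicalSpace M] [ChartedSpace (EuclideanSpace ℝ (Fin n)) M]

/-- Vector fields on `M`. -/
abbrev VectorField := (x : M) → TangentSpace (𝓡 n) x

/-- Fields of covectors on `M`. -/
abbrev Tensor1 := (x : M) → TangentSpace (𝓡 n) x →L[ℝ] ℝ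

/-- Fields of bilinear forms on the tangent spaces of `M`. -/
abbrev Tensor2 := (x : M) → TangentSpace (𝓡 n) x →L[ℝ] TangentSpace (𝓡 n) x →L[ℝ] ℝ

/-- Fields of trilinear forms on the tangent spaces of `M`. -/
abbrev Tensor3 := (x : M) →
  TangentSpace (𝓡 n) x →L[ℝ] TangentSpace (𝓡 n) x →L[ℝ] TangentSpace (𝓡 n) x →L[ℝ] ℝ

/-- The fibre `T_x M ⊕ T_x^* M` of the generalized tangent bundle. -/
abbrev GFiber {n : ℕ} {M : Type*} [TopologicalSpace M]
    [ChartedSpace (EuclideanSpace ℝ (Fin n)) M] (x : M) :=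
  TangentSpace (𝓡 n) x × (TangentSpace (𝓡 n) x →L[ℝ] ℝ)

/-- Sections `X + ξ` of `TM ⊕ T^*M`. -/
abbrev GSection := (x : M) → GFiber (n := n) x

/-- Fields of endomorphisms of `TM ⊕ T^*M`. -/
abbrev GEnd := (x : M) → GFiber (n := n) x →L[ℝ] GFiber (n := n) x

end Fields

variable {n : ℕ} {M : Type*} [TopologicalSpace M] [ChartedSpace (EuclideanSpace ℝ (Fin n)) M]

/-- The vector `e_i` of the standard basis of `T_x M`, a copy of `ℝⁿ` through the preferred chart
at `x`. -/
def stdVec (x : M) (i : Fin n) : TangentSpace (𝓡 n) x :=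
  (EuclideanSpace.single i 1 : EuclideanSpace ℝ (Fin n))

/-- The covector `e^i` of the basis dual to `stdVec`. -/
def stdCov (x : M) (i : Fin n) : TangentSpace (𝓡 n) x →L[ℝ] ℝ :=
  (EuclideanSpace.proj i : EuclideanSpace ℝ (Fin n) →L[ℝ] ℝ)

/-- The covector that takes the same values as `F` on the standard basis; this is `F` itself when
`F` is linear. -/
def toCovector (x : M) (F : TangentSpace (𝓡 n) x → ℝ) : TangentSpace (𝓡 n) x →L[ℝ] ℝ :=
  ∑ i, F (stdVec x i) • stdCov x i

/-- The trace of a (linear) map `T_x M → T_x M`. -/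
def traceT (x : M) (f : TangentSpace (𝓡 n) x → TangentSpace (𝓡 n) x) : ℝ :=
  ∑ i, stdCov x i (f (stdVec x i))

/-- The trace of a (linear) map `T_x M ⊕ T_x^* M → T_x M ⊕ T_x^* M`. -/
def traceG (x : M) (f : GFiber (n := n) x → GFiber (n := n) x) : ℝ :=
  (∑ i, stdCov x i (f (stdVec x i, 0)).1) + ∑ i, (f (0, stdCov x i)).2 (stdVec x i)

/-- The derivative of the function `f` along the vector `v`. -/
def dirDeriv (f : M → ℝ) {x : M} (v : TangentSpace (𝓡 n) x) : ℝ := mvfderiv (𝓡 n) f x v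

/-- `B` is alternating, that is, a field of 2-forms. -/
def IsAlternating2 (B : Tensor2 n M) : Prop := ∀ x u, B x u u = 0

/-- `H` is alternating, that is, a field of 3-forms. -/
def IsAlternating3 (H : Tensor3 n M) : Prop := ∀ x u v, H x u u v = 0 ∧ H x u v v = 0

section Smooth

variable [IsManifold (𝓡 n) ∞ M]

def SmoothVF (X : VectorField n M) : Prop :=
  ContMDiff (𝓡 n) (𝓡 n).tangent ∞ (fun x => (⟨x, X x⟩ : TangentBundle (𝓡 n) M))

def Smooth1 (ξ : Tensor1 n M) : Prop :=
  ∀ X : VectorField n M, SmoothVF X → ContMDiff (𝓡 n) 𝓘(ℝ, ℝ) ∞ (fun x => ξ x (X x))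

def Smooth2 (B : Tensor2 n M) : Prop :=
  ∀ X Y : VectorField n M, SmoothVF X → SmoothVF Y →
    ContMDiff (𝓡 n) 𝓘(ℝ, ℝ) ∞ (fun x => B x (X x) (Y x))

def Smooth3 (H : Tensor3 n M) : Prop :=
  ∀ X Y Z : VectorField n M, SmoothVF X → SmoothVF Y → SmoothVF Z →
    ContMDiff (𝓡 n) 𝓘(ℝ, ℝ) ∞ (fun x => H x (X x) (Y x) (Z x))

/-- A family of 1-forms that is smooth in `(t, x) ∈ J × M`. -/
def SmoothFamily1 (J : Set ℝ) (θ : ℝ → Tensor1 n M) : Prop :=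
  ∀ X : VectorField n M, SmoothVF X →
    ContMDiffOn (𝓘(ℝ, ℝ).prod (𝓡 n)) 𝓘(ℝ, ℝ) ∞
      (fun p : ℝ × M => θ p.1 p.2 (X p.2)) (J ×ˢ Set.univ)

/-- A family of bilinear forms that is smooth in `(t, x) ∈ J × M`. -/
def SmoothFamily2 (J : Set ℝ) (B : ℝ → Tensor2 n M) : Prop :=
  ∀ X Y : VectorField n M, SmoothVF X → SmoothVF Y →
    ContMDiffOn (𝓘(ℝ, ℝ).prod (𝓡 n)) 𝓘(ℝ, ℝ) ∞
      (fun p : ℝ × M => B p.1 p.2 (X p.2) (Y p.2)) (J ×ˢ Set.univ)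

/-- A smooth section of `TM ⊕ T^*M`. -/
def SmoothSec (z : GSection n M) : Prop :=
  SmoothVF (fun x => (z x).1) ∧ Smooth1 (fun x => (z x).2)

/-- The Lie bracket of vector fields. -/
abbrev bracket (X Y : VectorField n M) : VectorField n M := VectorField.mlieBracket (𝓡 n) X Y

/-- A smooth bump function supported in the preferred chart at `x`, equal to 1 near `x`. -/
def bump (x : M) : SmoothBumpFunction (𝓡 n) x := Classical.choice inferInstance

/-- An extension of the vector `v` at `x` to a vector field on `M`, smooth when `M` is Hausdorff.
It serves to evaluate tensors that are defined through vector fields; the choice of the extension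
does not matter. -/
def extVec {x : M} (v : TangentSpace (𝓡 n) x) : VectorField n M := fun y =>
  bump (n := n) x y •
    FiberBundle.extend (E := TangentSpace (𝓡 n)) (EuclideanSpace ℝ (Fin n)) v y

/-- An extension of the covector `ξ` at `x` to a field of covectors on `M`, smooth when `M` is
Hausdorff. -/
def extCov {x : M} (ξ : TangentSpace (𝓡 n) x →L[ℝ] ℝ) : Tensor1 n M := fun y =>
  bump (n := n) x y •
    ξ.comp (((trivializationAt (EuclideanSpace ℝ (Fin n)) (TangentSpace (𝓡 n)) x).symmL ℝ x).comp
      ((trivializationAt (EuclideanSpace ℝ (Fin n))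
        (TangentSpace (𝓡 n)) x).continuousLinearMapAt ℝ y))

/-- An extension of an element of `T_x M ⊕ T_x^* M` to a section. -/
def extG {x : M} (a : GFiber (n := n) x) : GSection n M := fun y => (extVec a.1 y, extCov a.2 y)

/-- `dξ(u, v) = u(ξ(V)) - v(ξ(U)) - ξ([U, V])` for a 1-form `ξ`. -/
def extDeriv1 (ξ : Tensor1 n M) (x : M) (u v : TangentSpace (𝓡 n) x) : ℝ :=
  dirDeriv (fun y => ξ y (extVec v y)) u - dirDeriv (fun y => ξ y (extVec u y)) v
    - ξ x (bracket (extVec u) (extVec v) x)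

/-- `dH = 0` for a 3-form `H`. -/
def IsClosed3 (H : Tensor3 n M) : Prop :=
  ∀ X₀ X₁ X₂ X₃ : VectorField n M, SmoothVF X₀ → SmoothVF X₁ → SmoothVF X₂ → SmoothVF X₃ →
    ∀ x : M,
      dirDeriv (fun y => H y (X₁ y) (X₂ y) (X₃ y)) (X₀ x)
      - dirDeriv (fun y => H y (X₀ y) (X₂ y) (X₃ y)) (X₁ x)
      + dirDeriv (fun y => H y (X₀ y) (X₁ y) (X₃ y)) (X₂ x)
      - dirDeriv (fun y => H y (X₀ y) (X₁ y) (X₂ y)) (X₃ x)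
      - H x (bracket X₀ X₁ x) (X₂ x) (X₃ x)
      + H x (bracket X₀ X₂ x) (X₁ x) (X₃ x)
      - H x (bracket X₀ X₃ x) (X₁ x) (X₂ x)
      - H x (bracket X₁ X₂ x) (X₀ x) (X₃ x)
      + H x (bracket X₁ X₃ x) (X₀ x) (X₂ x)
      - H x (bracket X₂ X₃ x) (X₀ x) (X₁ x) = 0

/-! ### Riemannian geometry -/

/-- The isomorphism `g⁻¹ : T_x^* M → T_x M` of a metric `g`. -/
def sharp (g : Tensor2 n M) (x : M) : (TangentSpace (𝓡 n) x →L[ℝ] ℝ) →L[ℝ] TangentSpace (𝓡 n) x :=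
  (g x).inverse

/-- `g(∇_X Y, Z)` by the Koszul formula. -/
def koszul (g : Tensor2 n M) (X Y Z : VectorField n M) (x : M) : ℝ :=
  (1 / 2) * (dirDeriv (fun y => g y (Y y) (Z y)) (X x)
    + dirDeriv (fun y => g y (X y) (Z y)) (Y x)
    - dirDeriv (fun y => g y (X y) (Y y)) (Z x)
    + g x (bracket X Y x) (Z x) - g x (bracket X Z x) (Y x) - g x (bracket Y Z x) (X x))

/-- `∇_X Y` for the Levi-Civita connection of `g`. -/
def leviCivita (g : Tensor2 n M) (X Y : VectorField n M) : VectorField n M := fun x =>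
  sharp g x (toCovector x fun v => koszul g X Y (extVec v) x)

/-- `R(X, Y)Z = ∇_X ∇_Y Z - ∇_Y ∇_X Z - ∇_{[X, Y]} Z`. -/
def riemann (g : Tensor2 n M) (X Y Z : VectorField n M) : VectorField n M := fun x =>
  leviCivita g X (leviCivita g Y Z) x - leviCivita g Y (leviCivita g X Z) x
    - leviCivita g (bracket X Y) Z x

/-- The Ricci tensor `Rc(u, v) = tr (w ↦ R(w, u)v)`. -/
def ricci (g : Tensor2 n M) (x : M) (u v : TangentSpace (𝓡 n) x) : ℝ :=
  traceT x fun w => riemann g (extVec w) (extVec u) (extVec v) x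

/-- The Riemannian divergence `tr (v ↦ ∇_v X)`, that is, `dV_g⁻¹ L_X dV_g`. -/
def divergence (g : Tensor2 n M) (X : VectorField n M) (x : M) : ℝ :=
  traceT x fun v => leviCivita g (extVec v) X x

/-- The Lie derivative of `g` along `X`. -/
def lieDeriv (X : VectorField n M) (g : Tensor2 n M) (x : M) (u v : TangentSpace (𝓡 n) x) : ℝ :=
  dirDeriv (fun y => g y (extVec u y) (extVec v y)) (X x)
    - g x (bracket X (extVec u) x) v - g x u (bracket X (extVec v) x)

/-- The trace of a bilinear form `F` on `T_x M` with respect to `g`: the sum of `F(e_i, g⁻¹ e^i)`,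
which is the sum of `F(ε_i, ε_i)` over a `g`-orthonormal basis. -/
def traceMetric (g : Tensor2 n M) (x : M)
    (F : TangentSpace (𝓡 n) x → TangentSpace (𝓡 n) x → ℝ) : ℝ :=
  ∑ i, F (stdVec x i) (sharp g x (stdCov x i))

/-- `(H ∘ H)(u, v) = g(ι_u H, ι_v H)`: the sum of `H(u, ε_i, ε_j) H(v, ε_i, ε_j)` over all `i, j`,
for a `g`-orthonormal basis. -/
def circ (g : Tensor2 n M) (H : Tensor3 n M) (x : M) (u v : TangentSpace (𝓡 n) x) : ℝ :=
  traceMetric g x fun a a' => traceMetric g x fun b b' => H x u a b * H x v a' b'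

/-- `(∇_W H)(A, B, C)` for the Levi-Civita connection of `g`. -/
def covDeriv3 (g : Tensor2 n M) (H : Tensor3 n M) (W A B C : VectorField n M) (x : M) : ℝ :=
  dirDeriv (fun y => H y (A y) (B y) (C y)) (W x) - H x (leviCivita g W A x) (B x) (C x)
    - H x (A x) (leviCivita g W B x) (C x) - H x (A x) (B x) (leviCivita g W C x)

/-- The codifferential of a 3-form, `(d^* H)(u, v) = - ∑ (∇_{ε_i} H)(ε_i, u, v)` for a
`g`-orthonormal basis. -/
def codiff (g : Tensor2 n M) (H : Tensor3 n M) (x : M) (u v : TangentSpace (𝓡 n) x) : ℝ :=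
  - traceMetric g x fun a a' =>
      covDeriv3 g H (extVec a) (extVec a') (extVec u) (extVec v) x

/-- The Bismut connection `∇⁺_X Y = ∇_X Y + (1/2) g⁻¹ H(X, Y, ·)`. -/
def bismut (g : Tensor2 n M) (H : Tensor3 n M) (X Y : VectorField n M) : VectorField n M :=
  fun x => leviCivita g X Y x + (1 / 2 : ℝ) • sharp g x (H x (X x) (Y x))

/-- `(∇⁺ θ)(u, v) = (∇⁺_u θ)(v)`. -/
def bismutDeriv (g : Tensor2 n M) (H : Tensor3 n M) (θ : Tensor1 n M) (x : M)
    (u v : TangentSpace (𝓡 n) x) : ℝ :=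
  dirDeriv (fun y => θ y (extVec v y)) u - θ x (bismut g H (extVec u) (extVec v) x)

/-! ### The exact Courant algebroid `E_H = TM ⊕ T^*M` -/

/-- `⟨X + ξ, Y + η⟩ = (η(X) + ξ(Y)) / 2`. -/
def pairing {x : M} (a b : GFiber (n := n) x) : ℝ := (1 / 2) * (b.2 a.1 + a.2 b.1)

/-- The twisted Dorfman bracket
`[X + ξ, Y + η] = [X, Y] + L_X η - ι_Y dξ + ι_Y ι_X H`. -/
def dorfman (H : Tensor3 n M) (z w : GSection n M) : GSection n M := fun x =>
  (bracket (fun y => (z y).1) (fun y => (w y).1) x,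
    toCovector x (fun v =>
      (dirDeriv (fun y => (w y).2 (extVec v y)) (z x).1
        - (w x).2 (bracket (fun y => (z y).1) (extVec v) x))
      - (dirDeriv (fun y => (z y).2 (extVec v y)) (w x).1
        - dirDeriv (fun y => (z y).2 (w y).1) v
        - (z x).2 (bracket (fun y => (w y).1) (extVec v) x)))
    + H x (z x).1 (w x).1)

/-- The `B`-field transformation `e^B : X + ξ ↦ X + ξ + ι_X B`. -/
def expB (B : Tensor2 n M) : GEnd n M := fun x =>
  (ContinuousLinearMap.fst ℝ _ _).prod
    (ContinuousLinearMap.snd ℝ _ _ + (B x).comp (ContinuousLinearMap.fst ℝ _ _))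

/-- The generalized metric `e^B (0 g⁻¹; g 0) e^{-B}`. -/
def genMetric (g B : Tensor2 n M) : GEnd n M := fun x =>
  (expB B x).comp
    ((((sharp g x).comp (ContinuousLinearMap.snd ℝ _ _)).prod
      ((g x).comp (ContinuousLinearMap.fst ℝ _ _))).comp (expB (fun y => - B y) x))

/-- The divergence operator `div_{g,e}(X + ξ) = dV_g⁻¹ L_X dV_g - ⟨e, X + ξ⟩`. -/
def divOp (g : Tensor2 n M) (e : GSection n M) (z : GSection n M) (x : M) : ℝ :=
  divergence g (fun y => (z y).1) x - pairing (e x) (z x)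

variable (n M) in
/-- A generalized connection on `TM ⊕ T^*M`; `D z x a` is `D_a z` for `a` in the fibre at `x`.
Only its values on smooth sections matter. -/
structure GenConnection where
  toFun : GSection n M → (x : M) → GFiber (n := n) x →ₗ[ℝ] GFiber (n := n) x
  smooth : ∀ z w, SmoothSec z → SmoothSec w → SmoothSec (fun x => toFun z x (w x))
  add : ∀ z w, SmoothSec z → SmoothSec w → ∀ x a,
    toFun (fun y => z y + w y) x a = toFun z x a + toFun w x a
  leibniz : ∀ (f : M → ℝ) (z : GSection n M), ContMDiff (𝓡 n) 𝓘(ℝ, ℝ) ∞ f → SmoothSec z →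
    ∀ (x : M) (a : GFiber (n := n) x),
      toFun (fun y => f y • z y) x a = f x • toFun z x a + dirDeriv f a.1 • z x
  metric : ∀ z w, SmoothSec z → SmoothSec w → ∀ (x : M) (a : GFiber (n := n) x),
    dirDeriv (fun y => pairing (z y) (w y)) a.1
      = pairing (toFun z x a) (w x) + pairing (z x) (toFun w x a)

namespace GenConnection

/-- `T_D(z, w) = D_z w - D_w z - [z, w] + (Dz)^* w` vanishes, where the adjoint is taken with
respect to the pairing, so that `⟨(Dz)^* w, a⟩ = ⟨w, D_a z⟩`. -/
def TorsionFree (D : GenConnection n M) (H : Tensor3 n M) : Prop :=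
  ∀ z w, SmoothSec z → SmoothSec w → ∀ (x : M) (a : GFiber (n := n) x),
    pairing (D.toFun w x (z x) - D.toFun z x (w x) - dorfman H z w x) a
      + pairing (w x) (D.toFun z x a) = 0

/-- `D𝒢 = 0`. -/
def Compatible (D : GenConnection n M) (G : GEnd n M) : Prop :=
  ∀ z, SmoothSec z → ∀ (x : M) (a : GFiber (n := n) x),
    D.toFun (fun y => G y (z y)) x a = G x (D.toFun z x a)

/-- The divergence operator `z ↦ tr (Dz)` of `D` is `d`. -/
def HasDivergence (D : GenConnection n M) (d : GSection n M → M → ℝ) : Prop :=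
  ∀ z, SmoothSec z → ∀ x, traceG x (D.toFun z x) = d z x

/-- `R_D(z₁, z₂) z₃ = D_{z₁} D_{z₂} z₃ - D_{z₂} D_{z₁} z₃ - D_{[z₁, z₂]} z₃`. -/
def curvature (D : GenConnection n M) (H : Tensor3 n M) (z₁ z₂ z₃ : GSection n M) :
    GSection n M := fun x =>
  D.toFun (fun y => D.toFun z₃ y (z₂ y)) x (z₁ x) - D.toFun (fun y => D.toFun z₃ y (z₁ y)) x (z₂ x)
    - D.toFun z₃ x (dorfman H z₁ z₂ x)

end GenConnection

/-- The projection of a section to the `+1`-eigenbundle `E_+` of `G`. -/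
def plusPart (G : GEnd n M) (z : GSection n M) : GSection n M :=
  fun y => (1 / 2 : ℝ) • (z y + G y (z y))

/-- The projection of a section to the `-1`-eigenbundle `E_-` of `G`. -/
def minusPart (G : GEnd n M) (z : GSection n M) : GSection n M :=
  fun y => (1 / 2 : ℝ) • (z y - G y (z y))

/-- `Rc⁺_D(a, b) = tr (c ∈ E_+ ↦ R_D(c, a) b)` for `a ∈ E_-` and `b ∈ E_+` in the fibre at `x`.
The trace over `E_+` is computed as the trace over the whole fibre after the projection to
`E_+`. -/
def ricciPlus (D : GenConnection n M) (H : Tensor3 n M) (G : GEnd n M) {x : M}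
    (a b : GFiber (n := n) x) : ℝ :=
  traceG x fun c =>
    D.curvature H (plusPart G (extG c)) (minusPart G (extG a)) (plusPart G (extG b)) x

/-- The families `𝒢(t)`, `div(t)`, `t ∈ J`, solve the generalized Ricci flow
`𝒢̇⁺ = -2 Ric⁺_{𝒢, div}` on `E_H` for `t` in the interior of `J`. Here `Ric⁺_{𝒢, div}` is `Ric⁺_D`
for a torsion-free generalized connection `D` that is compatible with `𝒢(t)` and has the
divergence operator `div(t)` (it does not depend on the choice of `D`), `𝒢̇⁺` is the restriction of
`𝒢̇` to a map `E_- → E_+`, and `⟨Ric⁺ a, b⟩ = Rc⁺(a, b)` for `a ∈ E_-`, `b ∈ E_+`. -/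
def SolvesGenRicciFlow (H : Tensor3 n M) (J : Set ℝ) (G : ℝ → GEnd n M)
    (d : ℝ → GSection n M → M → ℝ) : Prop :=
  ∀ t ∈ interior J, ∃ D : GenConnection n M,
    D.TorsionFree H ∧ D.Compatible (G t) ∧ D.HasDivergence (d t) ∧
    ∀ (x : M) (a b : GFiber (n := n) x), G t x a = -a → G t x b = b →
      HasDerivAt (fun s => pairing (G s x a) b) (-2 * ricciPlus D H (G t) a b) t

/-- The pull-back `f^* g`. -/
def pullback (f : M → M) (g : Tensor2 n M) : Tensor2 n M := fun x =>
  (ContinuousLinearMap.precomp ℝ (mfderiv (𝓡 n) (𝓡 n) f x)).comp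
    ((g (f x)).comp (mfderiv (𝓡 n) (𝓡 n) f x))

/-! ### The soliton equations -/

/-- `Rc = λ g + L_X g + ¼ H∘H - ½ ∇⁺θ + ½ d^*H + ½ β`. -/
def SolitonEq (g : Tensor2 n M) (lam : ℝ) (X : VectorField n M) (H : Tensor3 n M)
    (θ : Tensor1 n M) (β : Tensor2 n M) : Prop :=
  ∀ (x : M) (u v : TangentSpace (𝓡 n) x),
    ricci g x u v = lam * g x u v + lieDeriv X g x u v + (1 / 4) * circ g H x u v
      - (1 / 2) * bismutDeriv g H θ x u v + (1 / 2) * codiff g H x u v + (1 / 2) * β x u v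

/-- `Rc = λ g + L_X g + ¼ H∘H - ¼ L_{g⁻¹θ} g` and `β = -d^*H + ½ dθ - ½ ι_{g⁻¹θ} H`. -/
def SplitSolitonEq (g : Tensor2 n M) (lam : ℝ) (X : VectorField n M) (H : Tensor3 n M)
    (θ : Tensor1 n M) (β : Tensor2 n M) : Prop :=
  (∀ (x : M) (u v : TangentSpace (𝓡 n) x),
    ricci g x u v = lam * g x u v + lieDeriv X g x u v + (1 / 4) * circ g H x u v
      - (1 / 4) * lieDeriv (fun y => sharp g y (θ y)) g x u v) ∧
  (∀ (x : M) (u v : TangentSpace (𝓡 n) x),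
    β x u v = - codiff g H x u v + (1 / 2) * extDeriv1 θ x u v
      - (1 / 2) * H x (sharp g x (θ x)) u v)

end Smooth

end GenRicci

end

/-!
Part (2) compares symmetric and skew-symmetric parts. `Rc`, `H ∘ H` and the Lie derivatives of
`g` are symmetric, `d^*H` and `β` are skew-symmetric, and
`∇⁺θ = ½ L_{g⁻¹θ} g + ½ dθ - ½ ι_{g⁻¹θ} H`, so the soliton equation splits into the two equations of
the system (`IsRiemannian.solitonEq_iff`). Symmetry of the Ricci tensor comes from the first Bianchi
identity (`IsRiemannian.ricci_symm`).

Part (1) rests on a formula for the Ricci curvature of a generalized metric `(g, B)`. The bundles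
`E_±` are isomorphic to `TM` through `v ↦ v ± g(v) + ι_v B`. For a torsion-free connection `D` that
preserves the generalized metric, the operators `D_a b` with `a` and `b` in different eigenbundles
are determined by the Dorfman bracket (`proj_dorfman_eq`), and on `TM` they are the connections
`∇ ± ½ g⁻¹H'` with `H' = H + dB` (`proj_dorfman`). In the trace that defines `Rc⁺_D(a, b)` the
remaining freedom of `D` enters only through the traces of `D b`, that is, through the divergence.
This gives (`ricciPlus_eq`)

  `Rc⁺(u - g(u) + ι_u B, v + g(v) + ι_v B) = (Rc - ½ d^*H' - ¼ H' ∘ H' + ½ ∇⁺θ)(u, v)`.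

On the same pairs of vectors, `⟨𝒢̇ a, b⟩` is the time derivative of `g - B`
(`hasDerivWithinAt_pairing_genMetric`). So the flow equation is a formula for `∂_t (g - B)` in the
interior of the time interval, which extends by continuity to the whole interval and in particular
to time zero, even if zero is an end point (`SolvesGenRicciFlow.derivWithin_eq`). For
`g = c(t) φ_t^* g₀` the time derivative at zero is `-2λ g₀ - 2 L_X g₀` (`hasDerivWithinAt_pullback`), which turns the
formula into the soliton equation (`solitonEq_of_flow`).

Smoothness is handled by testing: a vector field is smooth if it maps smooth functions to smooth
functions (`smoothVF_iff`), and operators on vector fields that are linear over smooth functions are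
evaluated in a coordinate frame (`tensorial_apply`).
-/

open scoped Manifold ContDiff

noncomputable section

namespace GenRicci

variable {n : ℕ} {M : Type*} [TopologicalSpace M] [ChartedSpace (EuclideanSpace ℝ (Fin n)) M]

open Filter Topology

set_option linter.unusedSectionVars false

/-! ### Derivatives of functions along vectors -/

section Derivations

lemma dirDeriv_add_vec (f : M → ℝ) {x : M} (v w : TangentSpace (𝓡 n) x) :
    dirDeriv f (v + w) = dirDeriv f v + dirDeriv f w := map_add _ _ _

lemma dirDeriv_smul_vec (f : M → ℝ) {x : M} (c : ℝ) (v : TangentSpace (𝓡 n) x) :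
    dirDeriv f (c • v) = c * dirDeriv f v := by
  simp [dirDeriv]

lemma dirDeriv_sub_vec (f : M → ℝ) {x : M} (v w : TangentSpace (𝓡 n) x) :
    dirDeriv f (v - w) = dirDeriv f v - dirDeriv f w := map_sub _ _ _

lemma dirDeriv_zero_vec (f : M → ℝ) {x : M} :
    dirDeriv f (0 : TangentSpace (𝓡 n) x) = 0 := map_zero _

lemma dirDeriv_sum_vec {ι : Type*} (s : Finset ι) (f : M → ℝ) {x : M}
    (v : ι → TangentSpace (𝓡 n) x) :
    dirDeriv f (∑ i ∈ s, v i) = ∑ i ∈ s, dirDeriv f (v i) := map_sum _ _ _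

/-- Smooth real functions on `M`. -/
abbrev SmoothFn (f : M → ℝ) : Prop := ContMDiff (𝓡 n) 𝓘(ℝ, ℝ) ∞ f

lemma _root_.ContMDiff.mdiffAt {f : M → ℝ} (hf : ContMDiff (𝓡 n) 𝓘(ℝ, ℝ) ∞ f) (x : M) :
    MDifferentiableAt (𝓡 n) 𝓘(ℝ, ℝ) f x :=
  hf.mdifferentiableAt (by simp)

lemma dirDeriv_add {f g : M → ℝ} (hf : SmoothFn (n := n) f) (hg : SmoothFn (n := n) g) {x : M}
    (v : TangentSpace (𝓡 n) x) :
    dirDeriv (fun y => f y + g y) v = dirDeriv f v + dirDeriv g v := by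
  have := mvfderiv_add (hf.mdiffAt x) (hg.mdiffAt x)
  exact congrArg (fun L => L v) this

lemma dirDeriv_sub {f g : M → ℝ} (hf : SmoothFn (n := n) f) (hg : SmoothFn (n := n) g) {x : M}
    (v : TangentSpace (𝓡 n) x) :
    dirDeriv (fun y => f y - g y) v = dirDeriv f v - dirDeriv g v := by
  have := mvfderiv_sub (hf.mdiffAt x) (hg.mdiffAt x)
  exact congrArg (fun L => L v) this

lemma dirDeriv_mul {f g : M → ℝ} (hf : SmoothFn (n := n) f) (hg : SmoothFn (n := n) g) {x : M}
    (v : TangentSpace (𝓡 n) x) :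
    dirDeriv (fun y => f y * g y) v = f x * dirDeriv g v + g x * dirDeriv f v := by
  have := mvfderiv_mul (hf.mdiffAt x) (hg.mdiffAt x)
  have h2 := congrArg (fun L => L v) this
  simpa [dirDeriv] using! h2

lemma dirDeriv_const (c : ℝ) {x : M} (v : TangentSpace (𝓡 n) x) :
    dirDeriv (fun _ : M => c) v = 0 := by
  simp [dirDeriv, mvfderiv_const]

lemma dirDeriv_neg (f : M → ℝ) {x : M} (v : TangentSpace (𝓡 n) x) :
    dirDeriv (fun y => -f y) v = -dirDeriv f v := by
  have := mvfderiv_neg (I := 𝓡 n) (g := f) (x := x)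
  exact congrArg (fun L => L v) this

lemma dirDeriv_const_mul (c : ℝ) {f : M → ℝ} (hf : SmoothFn (n := n) f) {x : M}
    (v : TangentSpace (𝓡 n) x) :
    dirDeriv (fun y => c * f y) v = c * dirDeriv f v := by
  rw [dirDeriv_mul contMDiff_const hf, dirDeriv_const]; ring

lemma smoothFn_sum {ι : Type*} (s : Finset ι) {f : ι → M → ℝ}
    (hf : ∀ i ∈ s, SmoothFn (n := n) (f i)) : SmoothFn (n := n) fun y => ∑ i ∈ s, f i y :=
  contMDiff_finsetSum hf

lemma dirDeriv_sum {ι : Type*} (s : Finset ι) {f : ι → M → ℝ}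
    (hf : ∀ i ∈ s, SmoothFn (n := n) (f i)) {x : M} (v : TangentSpace (𝓡 n) x) :
    dirDeriv (fun y => ∑ i ∈ s, f i y) v = ∑ i ∈ s, dirDeriv (f i) v := by
  classical
  induction s using Finset.induction_on with
  | empty => simp [dirDeriv_const]
  | insert a s ha ih =>
    simp only [Finset.sum_insert ha]
    rw [dirDeriv_add (hf a (by simp)) (smoothFn_sum s fun i hi => hf i (by simp [hi])),
      ih fun i hi => hf i (by simp [hi])]

lemma dirDeriv_congr {f g : M → ℝ} {x : M} (h : f =ᶠ[𝓝 x] g) (v : TangentSpace (𝓡 n) x) :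
    dirDeriv f v = dirDeriv g v := by
  have : mfderiv (𝓡 n) 𝓘(ℝ, ℝ) f x = mfderiv (𝓡 n) 𝓘(ℝ, ℝ) g x := h.mfderiv_eq
  simp only [dirDeriv, mvfderiv, ContinuousLinearMap.comp_apply]
  rw [this]
  rfl

lemma SmoothFn.sub {f g : M → ℝ} (hf : SmoothFn (n := n) f) (hg : SmoothFn (n := n) g) :
    SmoothFn (n := n) fun y => f y - g y := ContMDiff.sub hf hg

lemma SmoothFn.mul {f g : M → ℝ} (hf : SmoothFn (n := n) f) (hg : SmoothFn (n := n) g) :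
    SmoothFn (n := n) fun y => f y * g y := ContMDiff.mul hf hg

lemma smoothFn_const (c : ℝ) : SmoothFn (n := n) fun _ : M => c := contMDiff_const

lemma SmoothFn.congr {f g : M → ℝ} (hf : SmoothFn (n := n) f) (h : ∀ y, g y = f y) :
    SmoothFn (n := n) g := by
  rwa [funext h]

/-- A family of functions that is smooth on `J × M`. -/
abbrev SmoothFamily0 (n : ℕ) {M : Type*} [TopologicalSpace M]
    [ChartedSpace (EuclideanSpace ℝ (Fin n)) M] (J : Set ℝ) (F : ℝ → M → ℝ) : Prop :=
  ContMDiffOn (𝓘(ℝ, ℝ).prod (𝓡 n)) 𝓘(ℝ, ℝ) ∞ (fun p : ℝ × M => F p.1 p.2) (J ×ˢ Set.univ)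

lemma SmoothFamily0.add {J : Set ℝ} {F G : ℝ → M → ℝ} (hF : SmoothFamily0 n J F)
    (hG : SmoothFamily0 n J G) : SmoothFamily0 n J fun t y => F t y + G t y :=
  ContMDiffOn.add hF hG

lemma SmoothFamily0.sub {J : Set ℝ} {F G : ℝ → M → ℝ} (hF : SmoothFamily0 n J F)
    (hG : SmoothFamily0 n J G) : SmoothFamily0 n J fun t y => F t y - G t y :=
  ContMDiffOn.sub hF hG

lemma SmoothFamily0.mul {J : Set ℝ} {F G : ℝ → M → ℝ} (hF : SmoothFamily0 n J F)
    (hG : SmoothFamily0 n J G) : SmoothFamily0 n J fun t y => F t y * G t y :=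
  ContMDiffOn.mul hF hG

lemma smoothFamily0_const {J : Set ℝ} (c : ℝ) : SmoothFamily0 n J fun _ (_ : M) => c :=
  contMDiffOn_const

lemma smoothFamily0_sum {J : Set ℝ} {ι : Type*} (s : Finset ι) {F : ι → ℝ → M → ℝ}
    (hF : ∀ i ∈ s, SmoothFamily0 n J (F i)) : SmoothFamily0 n J fun t y => ∑ i ∈ s, F i t y :=
  contMDiffOn_finsetSum hF

lemma SmoothFamily0.congr {J : Set ℝ} {F G : ℝ → M → ℝ} (hF : SmoothFamily0 n J F)
    (h : ∀ t ∈ J, ∀ y, G t y = F t y) : SmoothFamily0 n J G :=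
  ContMDiffOn.congr hF fun p hp => h p.1 hp.1 p.2

end Derivations

variable [IsManifold (𝓡 n) ∞ M]

/-! ### Derivatives of functions in charts -/

section Chart

/-- The value of `dirDeriv` in terms of the derivative in a chart. -/
lemma fderiv_comp_extChartAt_symm {f : M → ℝ} (hf : SmoothFn (n := n) f) (x : M)
    {z : EuclideanSpace ℝ (Fin n)} (hz : z ∈ (extChartAt (𝓡 n) x).target)
    (w : TangentSpace (𝓡 n) ((extChartAt (𝓡 n) x).symm z)) :
    fderiv ℝ (f ∘ (extChartAt (𝓡 n) x).symm) z
      ((mfderiv 𝓘(ℝ, EuclideanSpace ℝ (Fin n)) (𝓡 n) (extChartAt (𝓡 n) x).symm z).inverse w)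
      = dirDeriv f w := by
  have hs : MDifferentiableAt 𝓘(ℝ, EuclideanSpace ℝ (Fin n)) (𝓡 n) (extChartAt (𝓡 n) x).symm z := by
    have := mdifferentiableWithinAt_extChartAt_symm (I := 𝓡 n) hz
    simpa [mdifferentiableWithinAt_univ] using this
  have hinv : (mfderiv 𝓘(ℝ, EuclideanSpace ℝ (Fin n)) (𝓡 n)
      (extChartAt (𝓡 n) x).symm z).IsInvertible := by
    have := isInvertible_mfderivWithin_extChartAt_symm (I := 𝓡 n) hz
    simpa [mfderivWithin_univ] using this
  have h1 : mfderiv 𝓘(ℝ, EuclideanSpace ℝ (Fin n)) 𝓘(ℝ, ℝ) (f ∘ (extChartAt (𝓡 n) x).symm) z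
      = (mfderiv (𝓡 n) 𝓘(ℝ, ℝ) f ((extChartAt (𝓡 n) x).symm z)).comp
        (mfderiv 𝓘(ℝ, EuclideanSpace ℝ (Fin n)) (𝓡 n) (extChartAt (𝓡 n) x).symm z) :=
    mfderiv_comp z (hf.mdiffAt _) hs
  rw [mfderiv_eq_fderiv] at h1
  rw [h1]
  exact congrArg (mfderiv (𝓡 n) 𝓘(ℝ, ℝ) f ((extChartAt (𝓡 n) x).symm z))
    (hinv.self_apply_inverse w)

/-- The value of `dirDeriv` at the centre of a chart, read in the chart. -/
lemma dirDeriv_eq_fderiv_mfderiv {f : M → ℝ} (hf : SmoothFn (n := n) f) (x : M)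
    (v : TangentSpace (𝓡 n) x) :
    dirDeriv f v = fderiv ℝ (f ∘ (extChartAt (𝓡 n) x).symm) (extChartAt (𝓡 n) x x)
      (mfderiv (𝓡 n) 𝓘(ℝ, EuclideanSpace ℝ (Fin n)) (extChartAt (𝓡 n) x) x v) := by
  have hs : MDifferentiableAt 𝓘(ℝ, EuclideanSpace ℝ (Fin n)) (𝓡 n) (extChartAt (𝓡 n) x).symm
      (extChartAt (𝓡 n) x x) := by
    have := mdifferentiableWithinAt_extChartAt_symm (I := 𝓡 n) (mem_extChartAt_target x)
    simpa [mdifferentiableWithinAt_univ] using this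
  have hφ : MDifferentiableAt (𝓡 n) 𝓘(ℝ, EuclideanSpace ℝ (Fin n)) (extChartAt (𝓡 n) x) x :=
    mdifferentiableAt_extChartAt (mem_chart_source _ x)
  have hfs : MDifferentiableAt 𝓘(ℝ, EuclideanSpace ℝ (Fin n)) 𝓘(ℝ, ℝ)
      (f ∘ (extChartAt (𝓡 n) x).symm) (extChartAt (𝓡 n) x x) :=
    (hf.mdiffAt _).comp _ hs
  have h1 := mfderiv_comp x hfs hφ
  rw [mfderiv_eq_fderiv] at h1
  have h2 : (f ∘ (extChartAt (𝓡 n) x).symm) ∘ (extChartAt (𝓡 n) x) =ᶠ[𝓝 x] f := by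
    filter_upwards [extChartAt_source_mem_nhds (I := 𝓡 n) x] with y hy
    exact congrArg f ((extChartAt (𝓡 n) x).left_inv hy)
  have h3 := h2.mfderiv_eq (I := 𝓡 n) (I' := 𝓘(ℝ, ℝ))
  rw [h1] at h3
  exact (congrArg (fun L => L v) h3).symm

end Chart

/-! ### Smooth families of functions and vector fields -/

section Families

variable {J : Set ℝ}

/-- A family of vector fields that is smooth on `J × M`. -/
def SmoothFamilyVF (J : Set ℝ) (Z : ℝ → VectorField n M) : Prop :=
  ContMDiffOn (𝓘(ℝ, ℝ).prod (𝓡 n)) (𝓡 n).tangent ∞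
    (fun p : ℝ × M => (⟨p.2, Z p.1 p.2⟩ : TangentBundle (𝓡 n) M)) (J ×ˢ Set.univ)

lemma SmoothFamily0.dirDeriv {F : ℝ → M → ℝ} {Z : ℝ → VectorField n M}
    (hF : SmoothFamily0 n J F) (hZ : SmoothFamilyVF J Z) :
    SmoothFamily0 n J fun t y => GenRicci.dirDeriv (F t) (Z t y) := by
  intro p hp
  have h1 : ContMDiffWithinAt (𝓘(ℝ, ℝ).prod (𝓡 n)) 𝓘(ℝ, EuclideanSpace ℝ (Fin n) →L[ℝ] ℝ) ∞
      (inTangentCoordinates (𝓡 n) 𝓘(ℝ, ℝ) (fun q : ℝ × M => q.2) (fun q : ℝ × M => F q.1 q.2)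
        (fun q => mfderivWithin (𝓡 n) 𝓘(ℝ, ℝ) (F q.1) Set.univ q.2) p) (J ×ˢ Set.univ) p := by
    refine ContMDiffWithinAt.mfderivWithin (n := ∞) (f := fun (q : ℝ × M) (z : M) => F q.1 z)
      (u := Set.univ) (g := fun q : ℝ × M => q.2) ?_ contMDiffWithinAt_snd hp
      (Set.mapsTo_univ _ _) (by simp) uniqueMDiffOn_univ
    have h0 := hF (p.1, p.2) hp
    exact h0.comp (t := J ×ˢ Set.univ) (x := (p, p.2))
      (f := fun q : (ℝ × M) × M => ((q.1.1, q.2) : ℝ × M))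
      ((contMDiffWithinAt_fst.comp (t := Set.univ) _ contMDiffWithinAt_fst
        (Set.mapsTo_univ _ _)).prodMk contMDiffWithinAt_snd)
      (fun q hq => ⟨hq.1.1, trivial⟩)
  have h2 := ContMDiffWithinAt.clm_apply_of_inCoordinates (b₂ := fun q : ℝ × M => F q.1 q.2)
    (E₂ := TangentSpace 𝓘(ℝ, ℝ)) h1 (hZ p hp) (hF p hp)
  rw [Bundle.contMDiffWithinAt_totalSpace] at h2
  refine h2.2.congr_of_eventuallyEq ?_ ?_
  · filter_upwards with q
    simp [GenRicci.dirDeriv, mvfderiv]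
    rfl
  · simp [GenRicci.dirDeriv, mvfderiv]
    rfl

omit [IsManifold (𝓡 n) ∞ M] in
lemma SmoothFn.family {f : M → ℝ} (hf : SmoothFn (n := n) f) (J : Set ℝ) :
    SmoothFamily0 n J fun _ => f :=
  (hf.comp contMDiff_snd).contMDiffOn

lemma SmoothVF.family {X : VectorField n M} (hX : SmoothVF X) (J : Set ℝ) :
    SmoothFamilyVF J fun _ => X :=
  (ContMDiff.comp hX contMDiff_snd).contMDiffOn

omit [IsManifold (𝓡 n) ∞ M] in
lemma SmoothFamily0.slice {F : ℝ → M → ℝ} (hF : SmoothFamily0 n J F) {t : ℝ} (ht : t ∈ J) :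
    SmoothFn (n := n) (F t) := by
  rw [SmoothFn, ← contMDiffOn_univ]
  exact ContMDiffOn.comp (t := J ×ˢ Set.univ) (f := fun y : M => ((t, y) : ℝ × M)) hF
    (contMDiff_const.prodMk contMDiff_id).contMDiffOn fun y _ => ⟨ht, trivial⟩

lemma SmoothFamilyVF.slice {Z : ℝ → VectorField n M} (hZ : SmoothFamilyVF J Z) {t : ℝ}
    (ht : t ∈ J) : SmoothVF (Z t) := by
  rw [SmoothVF, ← contMDiffOn_univ]
  exact ContMDiffOn.comp (t := J ×ˢ Set.univ) (f := fun y : M => ((t, y) : ℝ × M)) hZ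
    (contMDiff_const.prodMk contMDiff_id).contMDiffOn fun y _ => ⟨ht, trivial⟩

lemma SmoothFn.dirDeriv {f : M → ℝ} (hf : SmoothFn (n := n) f) {X : VectorField n M}
    (hX : SmoothVF X) : SmoothFn (n := n) fun y => GenRicci.dirDeriv f (X y) :=
  ((SmoothFn.family hf Set.univ).dirDeriv (hX.family Set.univ)).slice (t := 0) trivial

end Families

/-! ### The Lie bracket as a commutator -/

section Bracket

lemma SmoothVF.mdiffAt {X : VectorField n M} (hX : SmoothVF X) (x : M) :
    MDifferentiableAt (𝓡 n) (𝓡 n).tangent (fun y => (⟨y, X y⟩ : TangentBundle (𝓡 n) M)) x :=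
  ContMDiff.mdifferentiableAt hX (by simp)

lemma fderiv_apply_lieBracketWithin_univ {E : Type*} [NormedAddCommGroup E] [NormedSpace ℝ E]
    {f : E → ℝ} {V W : E → E} {x : E} (hf : ContDiffAt ℝ ∞ f x)
    (hV : DifferentiableAt ℝ V x) (hW : DifferentiableAt ℝ W x) :
    fderiv ℝ f x (VectorField.lieBracketWithin ℝ V W Set.univ x)
      = fderiv ℝ (fun y => fderiv ℝ f y (W y)) x (V x)
        - fderiv ℝ (fun y => fderiv ℝ f y (V y)) x (W x) := by
  rw [VectorField.lieBracketWithin_univ]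
  refine VectorField.fderiv_apply_lieBracket hf ?_ hW hV
  rw [minSmoothness_of_isRCLikeNormedField]
  exact WithTop.coe_le_coe.2 le_top

/-- The Lie bracket acts on functions as the commutator of derivations. -/
lemma dirDeriv_bracket {f : M → ℝ} (hf : SmoothFn (n := n) f) {X Y : VectorField n M}
    (hX : SmoothVF X) (hY : SmoothVF Y) (x : M) :
    dirDeriv f (bracket X Y x)
      = dirDeriv (fun y => dirDeriv f (Y y)) (X x) - dirDeriv (fun y => dirDeriv f (X y)) (Y x) := by
  have key : ∀ {h : M → ℝ}, SmoothFn (n := n) h → ∀ W : VectorField n M,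
      (fun z => fderiv ℝ (h ∘ (extChartAt (𝓡 n) x).symm) z
        (VectorField.mpullbackWithin 𝓘(ℝ, EuclideanSpace ℝ (Fin n)) (𝓡 n)
          (extChartAt (𝓡 n) x).symm W (Set.range (𝓡 n)) z))
      =ᶠ[𝓝 (extChartAt (𝓡 n) x x)] (fun y => dirDeriv h (W y)) ∘ (extChartAt (𝓡 n) x).symm := by
    intro h hh W
    filter_upwards [extChartAt_target_mem_nhds (I := 𝓡 n) x] with z hz
    have := fderiv_comp_extChartAt_symm hh x hz (W _)
    rw [VectorField.mpullbackWithin_apply]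
    simpa [mfderivWithin_univ] using! this
  have hdiff : ∀ {W : VectorField n M}, SmoothVF W → DifferentiableAt ℝ
      (VectorField.mpullbackWithin 𝓘(ℝ, EuclideanSpace ℝ (Fin n)) (𝓡 n)
          (extChartAt (𝓡 n) x).symm W (Set.range (𝓡 n))) (extChartAt (𝓡 n) x x) := by
    intro W hW
    have h0 := ((hW.mdiffAt x).mdifferentiableWithinAt (s := Set.univ)
      ).differentiableWithinAt_mpullbackWithin_vectorField
    have e : ((extChartAt (𝓡 n) x).symm ⁻¹' Set.univ ∩ Set.range (𝓡 n)) = Set.univ := by simp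
    rw [e] at h0
    exact differentiableWithinAt_univ.1 h0
  have hfs : ContDiffAt ℝ ∞ (f ∘ (extChartAt (𝓡 n) x).symm) (extChartAt (𝓡 n) x x) := by
    rw [← contMDiffAt_iff_contDiffAt]
    have h0 := (contMDiffOn_extChartAt_symm (I := 𝓡 n) (n := ∞) x).contMDiffAt
      (extChartAt_target_mem_nhds (I := 𝓡 n) x)
    exact hf.contMDiffAt.comp _ h0
  rw [dirDeriv_eq_fderiv_mfderiv hf, bracket, VectorField.mlieBracket,
    VectorField.mlieBracketWithin_apply]
  have e1 : ∀ w, mfderiv (𝓡 n) 𝓘(ℝ, EuclideanSpace ℝ (Fin n)) (extChartAt (𝓡 n) x) x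
      ((mfderiv (𝓡 n) 𝓘(ℝ, EuclideanSpace ℝ (Fin n)) (extChartAt (𝓡 n) x) x).inverse w) = w :=
    fun w => (isInvertible_mfderiv_extChartAt (mem_extChartAt_source x)).self_apply_inverse w
  refine (congrArg (fderiv ℝ (f ∘ (extChartAt (𝓡 n) x).symm) (extChartAt (𝓡 n) x x))
    (e1 _)).trans ?_
  have e2 : ((extChartAt (𝓡 n) x).symm ⁻¹' Set.univ ∩ Set.range (𝓡 n)) = Set.univ := by simp
  rw [e2]
  refine Eq.trans (fderiv_apply_lieBracketWithin_univ hfs (hdiff hX) (hdiff hY)) ?_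
  have e3 : ∀ h : M → ℝ, ∀ W : VectorField n M,
      ((fun y => dirDeriv h (W y)) ∘ (extChartAt (𝓡 n) x).symm) (extChartAt (𝓡 n) x x)
        = dirDeriv h (W x) :=
    fun h W => congrArg (fun y => dirDeriv h (W y)) (extChartAt_to_inv x)
  refine congrArg₂ (· - ·) ?_ ?_
  · refine (DFunLike.congr_fun (key hf Y).fderiv_eq _).trans ?_
    exact ((key (SmoothFn.dirDeriv hf hY) X).self_of_nhds).trans (e3 _ _)
  · refine (DFunLike.congr_fun (key hf X).fderiv_eq _).trans ?_
    exact ((key (SmoothFn.dirDeriv hf hX) Y).self_of_nhds).trans (e3 _ _)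

end Bracket

/-! ### Coordinate functions and coordinate frames -/

section CoordFn

/-- The `k`-th coordinate of the preferred chart at `x`, cut off to a function on `M`. -/
def coordFn (x : M) (k : Fin n) : M → ℝ := fun y =>
  bump (n := n) x y • (extChartAt (𝓡 n) x y : EuclideanSpace ℝ (Fin n)) k

variable (n) in
/-- A neighbourhood of `x` in the chart domain on which the bump function at `x` equals 1. -/
def coordNhd (x : M) : Set M :=
  (chartAt (EuclideanSpace ℝ (Fin n)) x).source ∩ interior {y | bump (n := n) x y = 1}

omit [IsManifold (𝓡 n) ∞ M] in
lemma isOpen_coordNhd (x : M) : IsOpen (coordNhd n x) :=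
  (chartAt (EuclideanSpace ℝ (Fin n)) x).open_source.inter isOpen_interior

omit [IsManifold (𝓡 n) ∞ M] in
lemma mem_coordNhd (x : M) : x ∈ coordNhd n x :=
  ⟨mem_chart_source _ x, mem_interior_iff_mem_nhds.2 (bump (n := n) x).eventuallyEq_one⟩

omit [IsManifold (𝓡 n) ∞ M] in
lemma coordNhd_mem_nhds (x : M) : coordNhd n x ∈ 𝓝 x :=
  (isOpen_coordNhd x).mem_nhds (mem_coordNhd x)

omit [IsManifold (𝓡 n) ∞ M] in
lemma bump_eq_one {x y : M} (hy : y ∈ coordNhd n x) : bump (n := n) x y = 1 :=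
  interior_subset (s := {y | bump (n := n) x y = 1}) hy.2

lemma smoothFn_coordFn [T2Space M] (x : M) (k : Fin n) : SmoothFn (n := n) (coordFn x k) := by
  refine (bump (n := n) x).contMDiff_smul ?_
  have h := contMDiffOn_extChartAt (I := 𝓡 n) (n := ∞) (x := x)
  have h2 : ContMDiff 𝓘(ℝ, EuclideanSpace ℝ (Fin n)) 𝓘(ℝ, ℝ) ∞
      (EuclideanSpace.proj k : EuclideanSpace ℝ (Fin n) →L[ℝ] ℝ) :=
    ContinuousLinearMap.contMDiff _
  exact h2.comp_contMDiffOn h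

/-- Near `x`, the derivatives of the coordinate functions at `x` are the components of a vector in
the trivialization of the tangent bundle. -/
lemma dirDeriv_coordFn {x y : M} (hy : y ∈ coordNhd n x) (k : Fin n) (v : TangentSpace (𝓡 n) y) :
    dirDeriv (coordFn x k) v = (EuclideanSpace.proj k : EuclideanSpace ℝ (Fin n) →L[ℝ] ℝ)
      ((trivializationAt (EuclideanSpace ℝ (Fin n)) (TangentSpace (𝓡 n)) x).continuousLinearMapAt
        ℝ y v) := by
  rw [TangentBundle.continuousLinearMapAt_trivializationAt hy.1]
  have h1 : coordFn (n := n) x k =ᶠ[𝓝 y]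
      (EuclideanSpace.proj k : EuclideanSpace ℝ (Fin n) →L[ℝ] ℝ) ∘ (extChartAt (𝓡 n) x) := by
    filter_upwards [(isOpen_coordNhd x).mem_nhds hy] with z hz
    simp [coordFn, bump_eq_one hz]
  have hφ : MDifferentiableAt (𝓡 n) 𝓘(ℝ, EuclideanSpace ℝ (Fin n)) (extChartAt (𝓡 n) x) y :=
    mdifferentiableAt_extChartAt hy.1
  have h2 : MDifferentiableAt 𝓘(ℝ, EuclideanSpace ℝ (Fin n)) 𝓘(ℝ, ℝ)
      (EuclideanSpace.proj k : EuclideanSpace ℝ (Fin n) →L[ℝ] ℝ) (extChartAt (𝓡 n) x y) :=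
    (EuclideanSpace.proj k : EuclideanSpace ℝ (Fin n) →L[ℝ] ℝ).mdifferentiableAt
  have h3 := mfderiv_comp y h2 hφ
  rw [dirDeriv_congr h1, dirDeriv, mvfderiv]
  refine (DFunLike.congr_fun h3 v).trans ?_
  rw [ContinuousLinearMap.mfderiv_eq]
  rfl

omit [IsManifold (𝓡 n) ∞ M] in
lemma stdCov_stdVec (x : M) (i j : Fin n) :
    stdCov x i (stdVec x j) = if i = j then 1 else 0 := by
  exact PiLp.single_apply 2 _ j (1 : ℝ) i

omit [IsManifold (𝓡 n) ∞ M] in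
lemma sum_stdCov_smul (x : M) (v : TangentSpace (𝓡 n) x) :
    ∑ i, stdCov x i v • stdVec x i = v := by
  have := (EuclideanSpace.basisFun (Fin n) ℝ).sum_repr (v : EuclideanSpace ℝ (Fin n))
  simpa [stdCov, stdVec] using! this

lemma continuousLinearMapAt_self (x : M) (v : TangentSpace (𝓡 n) x) :
    (trivializationAt (EuclideanSpace ℝ (Fin n)) (TangentSpace (𝓡 n)) x).continuousLinearMapAt
        ℝ x v = (v : EuclideanSpace ℝ (Fin n)) := by
  rw [TangentBundle.continuousLinearMapAt_trivializationAt_eq_core (mem_chart_source _ x)]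
  exact (tangentBundleCore (𝓡 n) M).coordChange_self _ _ (mem_chart_source _ x) _

lemma dirDeriv_coordFn_self (x : M) (k : Fin n) (v : TangentSpace (𝓡 n) x) :
    dirDeriv (coordFn x k) v = stdCov x k v := by
  rw [dirDeriv_coordFn (mem_coordNhd x)]
  exact congrArg _ (continuousLinearMapAt_self x v)

lemma mem_baseSet {x y : M} (hy : y ∈ coordNhd n x) :
    y ∈ (trivializationAt (EuclideanSpace ℝ (Fin n)) (TangentSpace (𝓡 n) (M := M)) x).baseSet := by
  rw [TangentBundle.trivializationAt_baseSet]; exact hy.1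

lemma extVec_eq_smul_symmL {x : M} (v : TangentSpace (𝓡 n) x) (y : M) :
    extVec v y = bump (n := n) x y •
      (trivializationAt (EuclideanSpace ℝ (Fin n)) (TangentSpace (𝓡 n)) x).symmL ℝ y
      ((trivializationAt (EuclideanSpace ℝ (Fin n))
        (TangentSpace (𝓡 n)) x).continuousLinearMapAt ℝ x v) := by
  by_cases hy : y ∈ (trivializationAt (EuclideanSpace ℝ (Fin n))
      (TangentSpace (𝓡 n) (M := M)) x).baseSet
  · rw [extVec, FiberBundle.extend, Bundle.Trivialization.symmL_apply _ hy,
      Bundle.Trivialization.continuousLinearMapAt_apply,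
      Bundle.Trivialization.linearMapAt_apply, if_pos (mem_baseSet (mem_coordNhd x))]
  · have h0 : bump (n := n) x y = 0 := by
      by_contra h
      rw [TangentBundle.trivializationAt_baseSet] at hy
      exact hy ((bump (n := n) x).support_subset_source h)
    rw [extVec, h0, zero_smul, zero_smul]

lemma extVec_eq_symmL {x y : M} (hy : y ∈ coordNhd n x) (v : TangentSpace (𝓡 n) x) :
    extVec v y = (trivializationAt (EuclideanSpace ℝ (Fin n)) (TangentSpace (𝓡 n)) x).symmL ℝ y
      ((trivializationAt (EuclideanSpace ℝ (Fin n))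
        (TangentSpace (𝓡 n)) x).continuousLinearMapAt ℝ x v) := by
  rw [extVec_eq_smul_symmL, bump_eq_one hy, one_smul]

/-- The coordinate components of `extVec v` are constant near `x`. -/
lemma dirDeriv_coordFn_extVec {x y : M} (hy : y ∈ coordNhd n x) (k : Fin n)
    (v : TangentSpace (𝓡 n) x) : dirDeriv (coordFn x k) (extVec v y) = stdCov x k v := by
  rw [dirDeriv_coordFn hy, extVec_eq_symmL hy,
    Bundle.Trivialization.continuousLinearMapAt_symmL _ (mem_baseSet hy)]
  exact congrArg _ (continuousLinearMapAt_self x v)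

/-- Near `x`, vectors are determined by the derivatives of the coordinate functions. -/
lemma eq_of_dirDeriv_coordFn {x y : M} (hy : y ∈ coordNhd n x) {v w : TangentSpace (𝓡 n) y}
    (h : ∀ k, dirDeriv (coordFn (n := n) x k) v = dirDeriv (coordFn (n := n) x k) w) : v = w := by
  simp only [dirDeriv_coordFn hy] at h
  have h2 : (trivializationAt (EuclideanSpace ℝ (Fin n))
      (TangentSpace (𝓡 n) (M := M)) x).continuousLinearMapAt ℝ y v =
      (trivializationAt (EuclideanSpace ℝ (Fin n))
        (TangentSpace (𝓡 n)) x).continuousLinearMapAt ℝ y w :=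
    PiLp.ext h
  rw [← Bundle.Trivialization.symmL_continuousLinearMapAt (R := ℝ)
      (trivializationAt (EuclideanSpace ℝ (Fin n)) (TangentSpace (𝓡 n)) x) (mem_baseSet hy) v,
    h2, Bundle.Trivialization.symmL_continuousLinearMapAt _ (mem_baseSet hy)]

lemma sum_dirDeriv_coordFn_smul {x y : M} (hy : y ∈ coordNhd n x) (v : TangentSpace (𝓡 n) y) :
    ∑ k, dirDeriv (coordFn x k) v • extVec (stdVec x k) y = v := by
  refine eq_of_dirDeriv_coordFn hy fun j => ?_
  rw [dirDeriv_sum_vec]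
  simp [dirDeriv_smul_vec, dirDeriv_coordFn_extVec hy, stdCov_stdVec]

lemma eq_of_dirDeriv [T2Space M] {x : M} {v w : TangentSpace (𝓡 n) x}
    (h : ∀ f : M → ℝ, SmoothFn (n := n) f → dirDeriv f v = dirDeriv f w) : v = w :=
  eq_of_dirDeriv_coordFn (mem_coordNhd x) fun k => h _ (smoothFn_coordFn x k)

lemma extVec_self {x : M} (v : TangentSpace (𝓡 n) x) : extVec v x = v := by
  refine eq_of_dirDeriv_coordFn (mem_coordNhd x) fun k => ?_
  rw [dirDeriv_coordFn_extVec (mem_coordNhd x), dirDeriv_coordFn_self]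

lemma extVec_add {x : M} (v w : TangentSpace (𝓡 n) x) (y : M) :
    extVec (v + w) y = extVec v y + extVec w y := by
  simp only [extVec_eq_smul_symmL, map_add, smul_add]

lemma extVec_smul {x : M} (c : ℝ) (v : TangentSpace (𝓡 n) x) (y : M) :
    extVec (c • v) y = c • extVec v y := by
  simp only [extVec_eq_smul_symmL, map_smul, smul_comm c]

lemma smoothVF_extVec [T2Space M] {x : M} (v : TangentSpace (𝓡 n) x) : SmoothVF (extVec v) := by
  have hs : ContMDiffOn (𝓡 n) (𝓡 n).tangent ∞ (fun y => (⟨y, FiberBundle.extend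
      (E := TangentSpace (𝓡 n)) (EuclideanSpace ℝ (Fin n)) v y⟩ : TangentBundle (𝓡 n) M))
      (chartAt (EuclideanSpace ℝ (Fin n)) x).source := by
    have := (Bundle.Trivialization.contMDiffOn_section_baseSet_iff
      (trivializationAt (EuclideanSpace ℝ (Fin n)) (TangentSpace (𝓡 n) (M := M)) x)
      (IB := 𝓡 n) (n := ∞) (s := FiberBundle.extend
      (E := TangentSpace (𝓡 n)) (EuclideanSpace ℝ (Fin n)) v)).2 ?_
    · rwa [TangentBundle.trivializationAt_baseSet] at this
    refine (contMDiffOn_const (c := ((trivializationAt (EuclideanSpace ℝ (Fin n))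
      (TangentSpace (𝓡 n)) x) ⟨x, v⟩).2)).congr fun y hy => ?_
    rw [FiberBundle.extend, Bundle.Trivialization.apply_mk_symm _ hy]
  exact ContMDiffOn.smul_section_of_tsupport (bump (n := n) x).contMDiff.contMDiffOn
    (chartAt (EuclideanSpace ℝ (Fin n)) x).open_source
    (bump (n := n) x).tsupport_subset_chartAt_source hs

end CoordFn

/-! ### Smooth vector fields as derivations -/

section SmoothFields

variable {J : Set ℝ}

/-- A family of vector fields is smooth if and only if it maps smooth functions to smooth families
of functions. -/
lemma smoothFamilyVF_iff [T2Space M] {Z : ℝ → VectorField n M} :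
    SmoothFamilyVF J Z ↔ ∀ f : M → ℝ, SmoothFn (n := n) f →
      SmoothFamily0 n J fun t y => dirDeriv f (Z t y) := by
  refine ⟨fun hZ f hf => (SmoothFn.family hf J).dirDeriv hZ, fun h p hp => ?_⟩
  rw [Bundle.contMDiffWithinAt_totalSpace]
  refine ⟨contMDiffWithinAt_snd, ?_⟩
  have h1 : ContMDiffWithinAt (𝓘(ℝ, ℝ).prod (𝓡 n)) 𝓘(ℝ, EuclideanSpace ℝ (Fin n)) ∞
      (fun q : ℝ × M => ∑ k, dirDeriv (coordFn p.2 k) (Z q.1 q.2) •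
        (EuclideanSpace.single k 1 : EuclideanSpace ℝ (Fin n))) (J ×ˢ Set.univ) p :=
    contMDiffWithinAt_finsetSum fun k _ =>
      (h _ (smoothFn_coordFn p.2 k) p hp).smul contMDiffWithinAt_const
  have key : ∀ q : ℝ × M, q.2 ∈ coordNhd n p.2 →
      ((trivializationAt (EuclideanSpace ℝ (Fin n)) (TangentSpace (𝓡 n)) p.2)
        ⟨q.2, Z q.1 q.2⟩).2 = ∑ k, dirDeriv (coordFn p.2 k) (Z q.1 q.2) •
        (EuclideanSpace.single k 1 : EuclideanSpace ℝ (Fin n)) := by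
    intro q hq
    simp only [dirDeriv_coordFn hq]
    have e1 : ((trivializationAt (EuclideanSpace ℝ (Fin n)) (TangentSpace (𝓡 n)) p.2)
        ⟨q.2, Z q.1 q.2⟩).2 = (trivializationAt (EuclideanSpace ℝ (Fin n))
          (TangentSpace (𝓡 n)) p.2).continuousLinearMapAt ℝ q.2 (Z q.1 q.2) := by
      rw [Bundle.Trivialization.continuousLinearMapAt_apply,
        Bundle.Trivialization.linearMapAt_apply, if_pos (mem_baseSet hq)]
    rw [e1]
    have := (EuclideanSpace.basisFun (Fin n) ℝ).sum_repr ((trivializationAt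
      (EuclideanSpace ℝ (Fin n)) (TangentSpace (𝓡 n)) p.2).continuousLinearMapAt ℝ q.2 (Z q.1 q.2))
    simpa using! this.symm
  refine h1.congr_of_eventuallyEq ?_ (key p (mem_coordNhd p.2))
  refine Filter.Eventually.filter_mono nhdsWithin_le_nhds ?_
  filter_upwards [continuous_snd.continuousAt.preimage_mem_nhds
    (coordNhd_mem_nhds (n := n) p.2)] with q hq
  exact key q hq

lemma smoothVF_iff [T2Space M] {X : VectorField n M} :
    SmoothVF X ↔ ∀ f : M → ℝ, SmoothFn (n := n) f → SmoothFn (n := n) fun y => dirDeriv f (X y) :=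
  ⟨fun hX _ hf => SmoothFn.dirDeriv hf hX, fun h =>
    (smoothFamilyVF_iff.2 fun f hf => SmoothFn.family (n := n) (h f hf) Set.univ).slice
      (t := 0) trivial⟩

lemma SmoothFamilyVF.add [T2Space M] {Z W : ℝ → VectorField n M} (hZ : SmoothFamilyVF J Z)
    (hW : SmoothFamilyVF J W) : SmoothFamilyVF J fun t y => Z t y + W t y := by
  rw [smoothFamilyVF_iff] at *
  intro f hf
  simpa only [dirDeriv_add_vec] using (hZ f hf).add (hW f hf)

lemma SmoothFamilyVF.sub [T2Space M] {Z W : ℝ → VectorField n M} (hZ : SmoothFamilyVF J Z)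
    (hW : SmoothFamilyVF J W) : SmoothFamilyVF J fun t y => Z t y - W t y := by
  rw [smoothFamilyVF_iff] at *
  intro f hf
  simpa only [dirDeriv_sub_vec] using (hZ f hf).sub (hW f hf)

lemma SmoothFamilyVF.smul [T2Space M] {F : ℝ → M → ℝ} {Z : ℝ → VectorField n M}
    (hF : SmoothFamily0 n J F) (hZ : SmoothFamilyVF J Z) :
    SmoothFamilyVF J fun t y => F t y • Z t y := by
  rw [smoothFamilyVF_iff] at *
  intro f hf
  simpa only [dirDeriv_smul_vec] using hF.mul (hZ f hf)

lemma SmoothFamilyVF.bracket [T2Space M] {Z W : ℝ → VectorField n M}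
    (hZ : SmoothFamilyVF J Z) (hW : SmoothFamilyVF J W) :
    SmoothFamilyVF J fun t => GenRicci.bracket (Z t) (W t) := by
  rw [smoothFamilyVF_iff]
  intro f hf
  refine ContMDiffOn.congr (ContMDiffOn.sub
    (((SmoothFn.family hf J).dirDeriv hW).dirDeriv hZ)
    (((SmoothFn.family hf J).dirDeriv hZ).dirDeriv hW)) fun p hp => ?_
  exact dirDeriv_bracket hf (hZ.slice hp.1) (hW.slice hp.1) p.2

lemma SmoothVF.add [T2Space M] {X Y : VectorField n M} (hX : SmoothVF X) (hY : SmoothVF Y) :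
    SmoothVF fun y => X y + Y y :=
  ((hX.family Set.univ).add (hY.family Set.univ)).slice (t := 0) trivial

lemma SmoothVF.sub [T2Space M] {X Y : VectorField n M} (hX : SmoothVF X) (hY : SmoothVF Y) :
    SmoothVF fun y => X y - Y y :=
  ((hX.family Set.univ).sub (hY.family Set.univ)).slice (t := 0) trivial

lemma SmoothVF.smul [T2Space M] {f : M → ℝ} {X : VectorField n M} (hf : SmoothFn (n := n) f)
    (hX : SmoothVF X) : SmoothVF fun y => f y • X y :=
  ((SmoothFamilyVF.smul (SmoothFn.family hf Set.univ) (hX.family Set.univ))).slice (t := 0) trivial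

lemma SmoothVF.const_smul [T2Space M] (c : ℝ) {X : VectorField n M} (hX : SmoothVF X) :
    SmoothVF fun y => c • X y :=
  SmoothVF.smul (smoothFn_const c) hX

lemma SmoothVF.bracket [T2Space M] {X Y : VectorField n M} (hX : SmoothVF X) (hY : SmoothVF Y) :
    SmoothVF (GenRicci.bracket X Y) :=
  ((hX.family Set.univ).bracket (hY.family Set.univ)).slice (t := 0) trivial

lemma smoothVF_zero [T2Space M] : SmoothVF (fun _ => 0 : VectorField n M) := by
  rw [smoothVF_iff]
  intro f _
  simpa only [dirDeriv_zero_vec] using smoothFn_const 0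

lemma smoothVF_sum [T2Space M] {ι : Type*} (s : Finset ι) {X : ι → VectorField n M}
    (hX : ∀ i ∈ s, SmoothVF (X i)) : SmoothVF fun y => ∑ i ∈ s, X i y := by
  rw [smoothVF_iff]
  intro f hf
  simpa only [dirDeriv_sum_vec] using smoothFn_sum s fun i hi => SmoothFn.dirDeriv hf (hX i hi)

/-! ### Tensoriality -/

/-- An operator on smooth vector fields that is additive and linear over smooth functions at `x`
depends only on the value of the vector field at `x`. -/
theorem tensorial_apply [T2Space M] {A : Type*} [AddCommGroup A] [Module ℝ A] {x : M}
    {Φ : VectorField n M → A}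
    (hadd : ∀ X Y, SmoothVF X → SmoothVF Y → Φ (fun y => X y + Y y) = Φ X + Φ Y)
    (hsmul : ∀ (f : M → ℝ) X, SmoothFn (n := n) f → SmoothVF X →
      Φ (fun y => f y • X y) = f x • Φ X)
    {X : VectorField n M} (hX : SmoothVF X) :
    Φ X = ∑ k, stdCov x k (X x) • Φ (extVec (stdVec x k)) := by
  have hzero : Φ (fun y => 0) = 0 := by
    have := hsmul (fun _ => 0) (fun y => 0) (smoothFn_const 0) smoothVF_zero
    simpa using this
  have hsum : ∀ (s : Finset (Fin n)) (Z : Fin n → VectorField n M), (∀ i, SmoothVF (Z i)) →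
      Φ (fun y => ∑ i ∈ s, Z i y) = ∑ i ∈ s, Φ (Z i) := by
    classical
    intro s Z hZ
    induction s using Finset.induction_on with
    | empty => simpa using hzero
    | insert a s ha ih =>
      simp only [Finset.sum_insert ha]
      rw [hadd _ _ (hZ a) (smoothVF_sum s fun i _ => hZ i), ih]
  -- A cut-off function supported where the coordinate fields form a frame.
  obtain ⟨ψ, -, hψ⟩ := (SmoothBumpFunction.nhds_basis_support (I := 𝓡 n)
    (coordNhd_mem_nhds (n := n) x)).mem_iff.1 (coordNhd_mem_nhds (n := n) x)
  have hψs : SmoothFn (n := n) ψ := ψ.contMDiff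
  have hdecomp : X = fun y => (1 - ψ y) • X y +
      ∑ k, (ψ y * dirDeriv (coordFn x k) (X y)) • extVec (stdVec x k) y := by
    funext y
    by_cases hy : y ∈ coordNhd n x
    · simp only [mul_smul]
      rw [← Finset.smul_sum, sum_dirDeriv_coordFn_smul hy, ← add_smul]
      simp
    · have : ψ y = 0 := by
        by_contra h
        exact hy (hψ h)
      simp [this]
  have hk : ∀ k, SmoothFn (n := n) fun y => ψ y * dirDeriv (coordFn x k) (X y) := fun k =>
    hψs.mul (SmoothFn.dirDeriv (smoothFn_coordFn x k) hX)
  conv_lhs => rw [hdecomp]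
  rw [hadd _ _ (SmoothVF.smul ((smoothFn_const 1).sub hψs) hX)
    (smoothVF_sum _ fun k _ => SmoothVF.smul (hk k) (smoothVF_extVec _)),
    hsmul _ _ ((smoothFn_const 1).sub hψs) hX,
    hsum _ _ fun k => SmoothVF.smul (hk k) (smoothVF_extVec _)]
  simp only [ψ.eq_one, sub_self, zero_smul, zero_add]
  refine Finset.sum_congr rfl fun k _ => ?_
  rw [hsmul _ _ (hk k) (smoothVF_extVec _), ψ.eq_one, one_mul, dirDeriv_coordFn_self]

theorem tensorial_eq [T2Space M] {A : Type*} [AddCommGroup A] [Module ℝ A] {x : M}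
    {Φ : VectorField n M → A}
    (hadd : ∀ X Y, SmoothVF X → SmoothVF Y → Φ (fun y => X y + Y y) = Φ X + Φ Y)
    (hsmul : ∀ (f : M → ℝ) X, SmoothFn (n := n) f → SmoothVF X →
      Φ (fun y => f y • X y) = f x • Φ X)
    {X Y : VectorField n M} (hX : SmoothVF X) (hY : SmoothVF Y) (h : X x = Y x) : Φ X = Φ Y := by
  rw [tensorial_apply hadd hsmul hX, tensorial_apply hadd hsmul hY, h]

end SmoothFields

/-! ### Calculus of the Lie bracket -/

section BracketRules

omit [IsManifold (𝓡 n) ∞ M] in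
lemma bracket_swap (X Y : VectorField n M) (x : M) : bracket X Y x = -bracket Y X x :=
  VectorField.mlieBracket_swap_apply

lemma bracket_add_right {X Y Z : VectorField n M} (hY : SmoothVF Y) (hZ : SmoothVF Z) (x : M) :
    bracket X (fun y => Y y + Z y) x = bracket X Y x + bracket X Z x :=
  VectorField.mlieBracket_add_right (hY.mdiffAt x) (hZ.mdiffAt x)

lemma bracket_add_left {X Y Z : VectorField n M} (hX : SmoothVF X) (hY : SmoothVF Y) (x : M) :
    bracket (fun y => X y + Y y) Z x = bracket X Z x + bracket Y Z x :=
  VectorField.mlieBracket_add_left (hX.mdiffAt x) (hY.mdiffAt x)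

lemma bracket_smul_right {f : M → ℝ} {X Y : VectorField n M} (hf : SmoothFn (n := n) f)
    (hY : SmoothVF Y) (x : M) :
    bracket X (fun y => f y • Y y) x = dirDeriv f (X x) • Y x + f x • bracket X Y x :=
  VectorField.mlieBracket_smul_right (hf.mdiffAt x) (hY.mdiffAt x)

lemma bracket_smul_left {f : M → ℝ} {X Y : VectorField n M} (hf : SmoothFn (n := n) f)
    (hX : SmoothVF X) (x : M) :
    bracket (fun y => f y • X y) Y x = -dirDeriv f (Y x) • X x + f x • bracket X Y x :=
  VectorField.mlieBracket_smul_left (hf.mdiffAt x) (hX.mdiffAt x)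

end BracketRules

/-! ### Riemannian metrics -/

section Metric

/-- A smooth Riemannian metric, as a field of bilinear forms. -/
structure IsRiemannian (g : Tensor2 n M) : Prop where
  smooth : Smooth2 g
  symm : ∀ x u v, g x u v = g x v u
  pos : ∀ x u, u ≠ 0 → 0 < g x u u

lemma isInvertible_of_pos {E : Type*} [NormedAddCommGroup E] [NormedSpace ℝ E]
    [FiniteDimensional ℝ E] (G : E →L[ℝ] E →L[ℝ] ℝ) (h : ∀ u, u ≠ 0 → 0 < G u u) :
    G.IsInvertible := by
  have hinj : Function.Injective G.toLinearMap := by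
    rw [← LinearMap.ker_eq_bot, LinearMap.ker_eq_bot']
    intro u hu
    by_contra h0
    have h1 := h u h0
    have h2 : G u = 0 := hu
    simp [h2] at h1
  have hdim : Module.finrank ℝ E = Module.finrank ℝ (E →L[ℝ] ℝ) := by
    rw [← (LinearMap.toContinuousLinearMap (𝕜 := ℝ) (E := E) (F' := ℝ)).finrank_eq]
    exact (Subspace.dual_finrank_eq (K := ℝ) (V := E)).symm
  exact ⟨(LinearEquiv.ofInjectiveOfFinrankEq G.toLinearMap hinj hdim).toContinuousLinearEquiv,
    by ext; rfl⟩

namespace IsRiemannian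

variable {g : Tensor2 n M} (hg : IsRiemannian g)
include hg

lemma isInvertible (x : M) : (g x).IsInvertible :=
  isInvertible_of_pos (E := EuclideanSpace ℝ (Fin n)) (g x) (hg.pos x)

lemma apply_sharp (x : M) (ξ : TangentSpace (𝓡 n) x →L[ℝ] ℝ) : g x (sharp g x ξ) = ξ :=
  (hg.isInvertible x).self_apply_inverse ξ

lemma sharp_apply (x : M) (v : TangentSpace (𝓡 n) x) : sharp g x (g x v) = v :=
  (hg.isInvertible x).inverse_apply_self v

lemma ext {x : M} {v w : TangentSpace (𝓡 n) x} (h : ∀ u, g x v u = g x w u) : v = w := by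
  rw [← hg.sharp_apply x v, ← hg.sharp_apply x w]
  congr 1
  ext u
  exact h u

end IsRiemannian

end Metric

/-! ### Smooth families of tensor fields -/

section TensorFamilies

variable [T2Space M] {J : Set ℝ}

/-- Smoothness of a family of functions is a local question. -/
lemma smoothFamily0_of_local {F : ℝ → M → ℝ}
    (h : ∀ x : M, ∃ G : ℝ → M → ℝ, SmoothFamily0 n J G ∧
      ∀ t ∈ J, ∀ y ∈ coordNhd n x, F t y = G t y) : SmoothFamily0 n J F := by
  intro p hp
  obtain ⟨G, hG, hFG⟩ := h p.2
  refine (hG p hp).congr_of_eventuallyEq ?_ (hFG p.1 hp.1 p.2 (mem_coordNhd p.2))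
  filter_upwards [mem_nhdsWithin_of_mem_nhds (continuous_snd.continuousAt.preimage_mem_nhds
    (coordNhd_mem_nhds (n := n) p.2)), self_mem_nhdsWithin] with q hq hq'
  exact hFG q.1 hq'.1 q.2 hq

/-- A family of trilinear forms that is smooth in `(t, x) ∈ J × M`. -/
def SmoothFamily3 (J : Set ℝ) (H : ℝ → Tensor3 n M) : Prop :=
  ∀ X Y Z : VectorField n M, SmoothVF X → SmoothVF Y → SmoothVF Z →
    SmoothFamily0 n J fun t y => H t y (X y) (Y y) (Z y)

lemma SmoothFamilyVF.coord {Z : ℝ → VectorField n M} (hZ : SmoothFamilyVF J Z) (x : M)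
    (k : Fin n) : SmoothFamily0 n J fun t y => GenRicci.dirDeriv (coordFn x k) (Z t y) :=
  smoothFamilyVF_iff.1 hZ _ (smoothFn_coordFn x k)

lemma SmoothFamily1.apply {ξ : ℝ → Tensor1 n M} (hξ : SmoothFamily1 J ξ)
    {Z : ℝ → VectorField n M} (hZ : SmoothFamilyVF J Z) :
    SmoothFamily0 n J fun t y => ξ t y (Z t y) := by
  refine smoothFamily0_of_local fun x => ⟨fun t y => ∑ k, dirDeriv (coordFn x k) (Z t y) *
    ξ t y (extVec (stdVec x k) y), smoothFamily0_sum _ fun k _ => (hZ.coord x k).mul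
      (hξ _ (smoothVF_extVec _)), fun t _ y hy => ?_⟩
  conv_lhs => rw [← sum_dirDeriv_coordFn_smul hy (Z t y)]
  simp only [map_sum, map_smul, smul_eq_mul]

lemma SmoothFamily2.apply {B : ℝ → Tensor2 n M} (hB : SmoothFamily2 J B)
    {Z W : ℝ → VectorField n M} (hZ : SmoothFamilyVF J Z) (hW : SmoothFamilyVF J W) :
    SmoothFamily0 n J fun t y => B t y (Z t y) (W t y) := by
  have h1 : ∀ X, SmoothVF X → SmoothFamily0 n J fun t y => B t y (X y) (W t y) := fun X hX =>
    SmoothFamily1.apply (ξ := fun t y => B t y (X y)) (fun Y hY => hB X Y hX hY) hW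
  refine smoothFamily0_of_local fun x => ⟨fun t y => ∑ k, dirDeriv (coordFn x k) (Z t y) *
    B t y (extVec (stdVec x k) y) (W t y), smoothFamily0_sum _ fun k _ => (hZ.coord x k).mul
      (h1 _ (smoothVF_extVec _)), fun t _ y hy => ?_⟩
  conv_lhs => rw [← sum_dirDeriv_coordFn_smul hy (Z t y)]
  simp only [map_sum, map_smul, _root_.sum_apply, _root_.smul_apply,
    smul_eq_mul]

lemma SmoothFamily3.apply {H : ℝ → Tensor3 n M} (hH : SmoothFamily3 J H)
    {Z W V : ℝ → VectorField n M} (hZ : SmoothFamilyVF J Z) (hW : SmoothFamilyVF J W)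
    (hV : SmoothFamilyVF J V) :
    SmoothFamily0 n J fun t y => H t y (Z t y) (W t y) (V t y) := by
  have h1 : ∀ X, SmoothVF X → SmoothFamily0 n J fun t y => H t y (X y) (W t y) (V t y) :=
    fun X hX => SmoothFamily2.apply (B := fun t y => H t y (X y))
      (fun Y Z hY hZ => hH X Y Z hX hY hZ) hW hV
  refine smoothFamily0_of_local fun x => ⟨fun t y => ∑ k, dirDeriv (coordFn x k) (Z t y) *
    H t y (extVec (stdVec x k) y) (W t y) (V t y), smoothFamily0_sum _ fun k _ =>
      (hZ.coord x k).mul (h1 _ (smoothVF_extVec _)), fun t _ y hy => ?_⟩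
  conv_lhs => rw [← sum_dirDeriv_coordFn_smul hy (Z t y)]
  simp only [map_sum, map_smul, _root_.sum_apply, _root_.smul_apply,
    smul_eq_mul]

lemma Smooth1.family {ξ : Tensor1 n M} (h : Smooth1 ξ) (J : Set ℝ) :
    SmoothFamily1 J fun _ => ξ := fun X hX => SmoothFn.family (h X hX) J

lemma Smooth2.family {B : Tensor2 n M} (h : Smooth2 B) (J : Set ℝ) :
    SmoothFamily2 J fun _ => B := fun X Y hX hY => SmoothFn.family (h X Y hX hY) J

lemma SmoothFamily1.slice {ξ : ℝ → Tensor1 n M} (h : SmoothFamily1 J ξ) {t : ℝ} (ht : t ∈ J) :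
    Smooth1 (ξ t) := fun X hX => SmoothFamily0.slice (F := fun t y => ξ t y (X y)) (h X hX) ht

lemma SmoothFamily2.slice {B : ℝ → Tensor2 n M} (h : SmoothFamily2 J B) {t : ℝ} (ht : t ∈ J) :
    Smooth2 (B t) := fun X Y hX hY =>
  SmoothFamily0.slice (F := fun t y => B t y (X y) (Y y)) (h X Y hX hY) ht

lemma SmoothFamily3.slice {H : ℝ → Tensor3 n M} (h : SmoothFamily3 J H) {t : ℝ} (ht : t ∈ J) :
    Smooth3 (H t) := fun X Y Z hX hY hZ => SmoothFamily0.slice (h X Y Z hX hY hZ) ht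

end TensorFamilies

/-! ### Smoothness of the inverse metric -/

section Sharp

variable [T2Space M] {J : Set ℝ}

/-- The vector field with coordinate components `w` near `x`. -/
def frameComb (x : M) (w : EuclideanSpace ℝ (Fin n)) (y : M) : TangentSpace (𝓡 n) y :=
  ∑ k, w k • extVec (stdVec x k) y

lemma frameComb_ne_zero {x y : M} (hy : y ∈ coordNhd n x) {w : EuclideanSpace ℝ (Fin n)}
    (hw : w ≠ 0) : frameComb x w y ≠ 0 := by
  intro h
  apply hw
  ext k
  have := congrArg (fun v => dirDeriv (coordFn (n := n) x k) v) h
  simpa [frameComb, dirDeriv_sum_vec, dirDeriv_smul_vec, dirDeriv_coordFn_extVec hy,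
    stdCov_stdVec, dirDeriv_zero_vec] using this

/-- The Gram matrix of `g` in the coordinate frame at `x`, as a linear map. -/
def gramMap (g : Tensor2 n M) (x y : M) :
    EuclideanSpace ℝ (Fin n) →L[ℝ] EuclideanSpace ℝ (Fin n) →L[ℝ] ℝ :=
  ∑ i, ∑ j, g y (extVec (stdVec x i) y) (extVec (stdVec x j) y) •
    (EuclideanSpace.proj i : EuclideanSpace ℝ (Fin n) →L[ℝ] ℝ).smulRight
      (EuclideanSpace.proj j : EuclideanSpace ℝ (Fin n) →L[ℝ] ℝ)

lemma gramMap_apply (g : Tensor2 n M) (x y : M) (v w : EuclideanSpace ℝ (Fin n)) :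
    gramMap g x y v w = g y (frameComb x v y) (frameComb x w y) := by
  simp only [gramMap, frameComb, map_sum, map_smul, _root_.sum_apply,
    _root_.smul_apply, smul_eq_mul, ContinuousLinearMap.smulRight_apply,
    PiLp.proj_apply, Finset.mul_sum]
  rw [Finset.sum_comm]
  refine Finset.sum_congr rfl fun i _ => Finset.sum_congr rfl fun j _ => ?_
  ring

/-- In a coordinate frame, the inverse of a smooth family of metrics is the inverse of a smooth
family of Gram matrices. -/
lemma SmoothFamily2.sharp {g : ℝ → Tensor2 n M} (hgs : SmoothFamily2 J g)
    (hg : ∀ t ∈ J, IsRiemannian (g t)) {ξ : ℝ → Tensor1 n M} (hξ : SmoothFamily1 J ξ) :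
    SmoothFamilyVF J fun t y => GenRicci.sharp (g t) y (ξ t y) := by
  rw [smoothFamilyVF_iff]
  intro f hf p hp
  set x := p.2
  let η : ℝ × M → (EuclideanSpace ℝ (Fin n) →L[ℝ] ℝ) := fun q => ∑ i,
    ξ q.1 q.2 (extVec (stdVec x i) q.2) • (EuclideanSpace.proj i : EuclideanSpace ℝ (Fin n) →L[ℝ] ℝ)
  have hη : ∀ q w, η q w = ξ q.1 q.2 (frameComb x w q.2) := fun q w => by
    simp only [η, frameComb, map_sum, map_smul, _root_.sum_apply,
      _root_.smul_apply, smul_eq_mul, PiLp.proj_apply]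
    exact Finset.sum_congr rfl fun i _ => mul_comm _ _
  have hinv : ∀ q ∈ J ×ˢ (Set.univ : Set M), q.2 ∈ coordNhd n x →
      (gramMap (g q.1) x q.2).IsInvertible := fun q hq hqx => isInvertible_of_pos _ fun u hu => by
    rw [gramMap_apply]
    exact (hg q.1 hq.1).pos _ _ (frameComb_ne_zero hqx hu)
  have hAs : ContMDiffWithinAt (𝓘(ℝ, ℝ).prod (𝓡 n)) 𝓘(ℝ, EuclideanSpace ℝ (Fin n) →L[ℝ]
      EuclideanSpace ℝ (Fin n) →L[ℝ] ℝ) ∞ (fun q : ℝ × M => gramMap (g q.1) x q.2)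
      (J ×ˢ Set.univ) p :=
    contMDiffWithinAt_finsetSum fun i _ => contMDiffWithinAt_finsetSum fun j _ =>
      (hgs _ _ (smoothVF_extVec _) (smoothVF_extVec _) p hp).smul contMDiffWithinAt_const
  have hηs : ContMDiffWithinAt (𝓘(ℝ, ℝ).prod (𝓡 n)) 𝓘(ℝ, EuclideanSpace ℝ (Fin n) →L[ℝ] ℝ) ∞
      η (J ×ˢ Set.univ) p :=
    contMDiffWithinAt_finsetSum fun i _ => (hξ _ (smoothVF_extVec _) p hp).smul
      contMDiffWithinAt_const
  have hcs : ContMDiffWithinAt (𝓘(ℝ, ℝ).prod (𝓡 n)) 𝓘(ℝ, EuclideanSpace ℝ (Fin n)) ∞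
      (fun q => (gramMap (g q.1) x q.2).inverse (η q)) (J ×ˢ Set.univ) p := by
    obtain ⟨e, he⟩ := hinv p hp (mem_coordNhd x)
    have h1 : ContMDiffAt 𝓘(ℝ, EuclideanSpace ℝ (Fin n) →L[ℝ] EuclideanSpace ℝ (Fin n) →L[ℝ] ℝ)
        𝓘(ℝ, (EuclideanSpace ℝ (Fin n) →L[ℝ] ℝ) →L[ℝ] EuclideanSpace ℝ (Fin n)) ∞
        ContinuousLinearMap.inverse (gramMap (g p.1) x p.2) := by
      rw [← he]
      exact (contDiffAt_map_inverse e).contMDiffAt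
    exact (ContMDiffAt.comp_contMDiffWithinAt p h1 hAs).clm_apply hηs
  have hsum : ContMDiffWithinAt (𝓘(ℝ, ℝ).prod (𝓡 n)) 𝓘(ℝ, ℝ) ∞
      (fun q : ℝ × M => ∑ k, (EuclideanSpace.proj k : EuclideanSpace ℝ (Fin n) →L[ℝ] ℝ)
        ((gramMap (g q.1) x q.2).inverse (η q)) *
        dirDeriv f (extVec (stdVec x k) q.2)) (J ×ˢ Set.univ) p :=
    contMDiffWithinAt_finsetSum fun k _ => ContMDiffWithinAt.mul
      ((ContinuousLinearMap.contMDiff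
        (EuclideanSpace.proj k : EuclideanSpace ℝ (Fin n) →L[ℝ] ℝ)).contMDiffAt.comp_contMDiffWithinAt
          p hcs)
      (SmoothFn.family (SmoothFn.dirDeriv hf (smoothVF_extVec _)) J p hp)
  have key : ∀ q ∈ J ×ˢ (Set.univ : Set M), q.2 ∈ coordNhd n x →
      dirDeriv f (GenRicci.sharp (g q.1) q.2 (ξ q.1 q.2)) =
      ∑ k, (EuclideanSpace.proj k : EuclideanSpace ℝ (Fin n) →L[ℝ] ℝ)
        ((gramMap (g q.1) x q.2).inverse (η q)) *
        dirDeriv f (extVec (stdVec x k) q.2) := by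
    intro q hq hqx
    have h1 : GenRicci.sharp (g q.1) q.2 (ξ q.1 q.2) =
        frameComb x ((gramMap (g q.1) x q.2).inverse (η q)) q.2 := by
      refine (hg q.1 hq.1).ext fun u => ?_
      rw [(hg q.1 hq.1).apply_sharp]
      have h2 : u = frameComb x (∑ k, dirDeriv (coordFn x k) u •
          (EuclideanSpace.single k 1 : EuclideanSpace ℝ (Fin n))) q.2 := by
        conv_lhs => rw [← sum_dirDeriv_coordFn_smul hqx u]
        simp [frameComb, Pi.single_apply]
      rw [h2, ← gramMap_apply, (hinv q hq hqx).self_apply_inverse, hη]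
    rw [h1, frameComb, dirDeriv_sum_vec]
    simp only [dirDeriv_smul_vec, PiLp.proj_apply]
  refine hsum.congr_of_eventuallyEq ?_ (key p hp (mem_coordNhd x))
  filter_upwards [mem_nhdsWithin_of_mem_nhds (continuous_snd.continuousAt.preimage_mem_nhds
    (coordNhd_mem_nhds (n := n) p.2)), self_mem_nhdsWithin] with q hq hq'
  exact key q hq' hq

end Sharp

section

variable [T2Space M]

/-! ### The Levi-Civita connection -/

section LeviCivita

/-- A covector that is defined through extensions of vectors takes the expected values on smooth
vector fields. -/
lemma toCovector_apply_of_tensorial {x : M} {Φ : VectorField n M → ℝ}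
    (hadd : ∀ X Y, SmoothVF X → SmoothVF Y → Φ (fun y => X y + Y y) = Φ X + Φ Y)
    (hsmul : ∀ (f : M → ℝ) X, SmoothFn (n := n) f → SmoothVF X →
      Φ (fun y => f y • X y) = f x • Φ X)
    {X : VectorField n M} (hX : SmoothVF X) :
    toCovector x (fun v => Φ (extVec v)) (X x) = Φ X := by
  rw [tensorial_apply hadd hsmul hX]
  simp only [toCovector, _root_.sum_apply, _root_.smul_apply, smul_eq_mul]
  exact Finset.sum_congr rfl fun i _ => mul_comm _ _

variable {g : Tensor2 n M} (hg : IsRiemannian g)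
include hg

namespace IsRiemannian

lemma smoothFn {X Y : VectorField n M} (hX : SmoothVF X) (hY : SmoothVF Y) :
    SmoothFn (n := n) fun y => g y (X y) (Y y) := hg.smooth X Y hX hY

lemma koszul_add_right {X Y Z W : VectorField n M} (hX : SmoothVF X) (hY : SmoothVF Y)
    (hZ : SmoothVF Z) (hW : SmoothVF W) (x : M) :
    koszul g X Y (fun y => Z y + W y) x = koszul g X Y Z x + koszul g X Y W x := by
  simp only [koszul, map_add, dirDeriv_add_vec]
  rw [dirDeriv_add (hg.smoothFn hY hZ) (hg.smoothFn hY hW),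
    dirDeriv_add (hg.smoothFn hX hZ) (hg.smoothFn hX hW), bracket_add_right hZ hW,
    bracket_add_right hZ hW]
  simp only [map_add, _root_.add_apply]
  ring

lemma koszul_smul_right {f : M → ℝ} {X Y Z : VectorField n M} (hf : SmoothFn (n := n) f)
    (hX : SmoothVF X) (hY : SmoothVF Y) (hZ : SmoothVF Z) (x : M) :
    koszul g X Y (fun y => f y • Z y) x = f x * koszul g X Y Z x := by
  simp only [koszul, map_smul, smul_eq_mul, dirDeriv_smul_vec]
  rw [dirDeriv_mul hf (hg.smoothFn hY hZ), dirDeriv_mul hf (hg.smoothFn hX hZ),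
    bracket_smul_right hf hZ, bracket_smul_right hf hZ]
  simp only [map_add, _root_.add_apply, map_smul, _root_.smul_apply, smul_eq_mul]
  rw [hg.symm x (Z x) (Y x), hg.symm x (Z x) (X x)]
  ring

/-- The defining property of the Levi-Civita connection. -/
lemma apply_leviCivita {X Y Z : VectorField n M} (hX : SmoothVF X) (hY : SmoothVF Y)
    (hZ : SmoothVF Z) (x : M) : g x (leviCivita g X Y x) (Z x) = koszul g X Y Z x := by
  rw [leviCivita, hg.apply_sharp]
  exact toCovector_apply_of_tensorial (Φ := fun Z => koszul g X Y Z x)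
    (fun Z W hZ hW => hg.koszul_add_right hX hY hZ hW x)
    (fun f Z hf hZ => hg.koszul_smul_right hf hX hY hZ x) hZ

/-- A tangent vector is determined by its products with smooth vector fields. -/
lemma ext_field {x : M} {v w : TangentSpace (𝓡 n) x}
    (h : ∀ Z : VectorField n M, SmoothVF Z → g x v (Z x) = g x w (Z x)) : v = w :=
  hg.ext fun u => by simpa only [extVec_self] using h (extVec u) (smoothVF_extVec u)

lemma leviCivita_add_left {X Y Z : VectorField n M} (hX : SmoothVF X) (hY : SmoothVF Y)
    (hZ : SmoothVF Z) (x : M) :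
    leviCivita g (fun y => X y + Y y) Z x = leviCivita g X Z x + leviCivita g Y Z x := by
  refine hg.ext_field fun W hW => ?_
  rw [map_add, _root_.add_apply, hg.apply_leviCivita (hX.add hY) hZ hW,
    hg.apply_leviCivita hX hZ hW, hg.apply_leviCivita hY hZ hW]
  simp only [koszul, map_add, dirDeriv_add_vec, _root_.add_apply]
  rw [dirDeriv_add (hg.smoothFn hX hW) (hg.smoothFn hY hW),
    dirDeriv_add (hg.smoothFn hX hZ) (hg.smoothFn hY hZ), bracket_add_left hX hY,
    bracket_add_left hX hY]
  simp only [map_add, _root_.add_apply]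
  ring

lemma leviCivita_smul_left {f : M → ℝ} {X Y : VectorField n M} (hf : SmoothFn (n := n) f)
    (hX : SmoothVF X) (hY : SmoothVF Y) (x : M) :
    leviCivita g (fun y => f y • X y) Y x = f x • leviCivita g X Y x := by
  refine hg.ext_field fun W hW => ?_
  rw [map_smul, _root_.smul_apply, hg.apply_leviCivita (SmoothVF.smul hf hX) hY hW,
    hg.apply_leviCivita hX hY hW]
  simp only [koszul, map_smul, smul_eq_mul, dirDeriv_smul_vec, _root_.smul_apply]
  rw [dirDeriv_mul hf (hg.smoothFn hX hW), dirDeriv_mul hf (hg.smoothFn hX hY),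
    bracket_smul_left hf hX, bracket_smul_left hf hX]
  simp only [map_add, _root_.add_apply, map_smul, _root_.smul_apply, smul_eq_mul]
  ring

lemma leviCivita_add_right {X Y Z : VectorField n M} (hX : SmoothVF X) (hY : SmoothVF Y)
    (hZ : SmoothVF Z) (x : M) :
    leviCivita g X (fun y => Y y + Z y) x = leviCivita g X Y x + leviCivita g X Z x := by
  refine hg.ext_field fun W hW => ?_
  rw [map_add, _root_.add_apply, hg.apply_leviCivita hX (hY.add hZ) hW,
    hg.apply_leviCivita hX hY hW, hg.apply_leviCivita hX hZ hW]
  simp only [koszul, map_add, dirDeriv_add_vec, _root_.add_apply]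
  rw [dirDeriv_add (hg.smoothFn hY hW) (hg.smoothFn hZ hW),
    dirDeriv_add (hg.smoothFn hX hY) (hg.smoothFn hX hZ), bracket_add_right hY hZ,
    bracket_add_left hY hZ]
  simp only [map_add, _root_.add_apply]
  ring

lemma leviCivita_smul_right {f : M → ℝ} {X Y : VectorField n M} (hf : SmoothFn (n := n) f)
    (hX : SmoothVF X) (hY : SmoothVF Y) (x : M) :
    leviCivita g X (fun y => f y • Y y) x = dirDeriv f (X x) • Y x + f x • leviCivita g X Y x := by
  refine hg.ext_field fun W hW => ?_
  rw [map_add, _root_.add_apply, map_smul, map_smul, _root_.smul_apply, _root_.smul_apply,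
    hg.apply_leviCivita hX (SmoothVF.smul hf hY) hW, hg.apply_leviCivita hX hY hW]
  simp only [koszul, map_smul, smul_eq_mul, dirDeriv_smul_vec, _root_.smul_apply]
  rw [dirDeriv_mul hf (hg.smoothFn hY hW), dirDeriv_mul hf (hg.smoothFn hX hY),
    bracket_smul_right hf hY, bracket_smul_left hf hY]
  simp only [map_add, _root_.add_apply, map_smul, _root_.smul_apply, smul_eq_mul]
  rw [hg.symm x (Y x) (X x)]
  ring

/-- The Levi-Civita connection is metric. -/
lemma dirDeriv_metric {X Y Z : VectorField n M} (hX : SmoothVF X) (hY : SmoothVF Y)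
    (hZ : SmoothVF Z) (x : M) :
    dirDeriv (fun y => g y (Y y) (Z y)) (X x)
      = g x (leviCivita g X Y x) (Z x) + g x (Y x) (leviCivita g X Z x) := by
  rw [hg.symm x (Y x), hg.apply_leviCivita hX hY hZ, hg.apply_leviCivita hX hZ hY]
  simp only [koszul]
  have h : (fun y => g y (Z y) (Y y)) = fun y => g y (Y y) (Z y) :=
    funext fun y => hg.symm y _ _
  rw [h, bracket_swap Z Y]
  simp only [map_neg, _root_.neg_apply]
  ring

/-- The Levi-Civita connection is torsion-free. -/
lemma leviCivita_sub_swap {X Y : VectorField n M} (hX : SmoothVF X) (hY : SmoothVF Y) (x : M) :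
    leviCivita g X Y x - leviCivita g Y X x = bracket X Y x := by
  refine hg.ext_field fun W hW => ?_
  rw [map_sub, _root_.sub_apply, hg.apply_leviCivita hX hY hW, hg.apply_leviCivita hY hX hW]
  simp only [koszul]
  have h : (fun y => g y (Y y) (X y)) = fun y => g y (X y) (Y y) :=
    funext fun y => hg.symm y _ _
  rw [h, bracket_swap Y X]
  simp only [map_neg, _root_.neg_apply]
  ring

end IsRiemannian

end LeviCivita

section LeviCivitaSmooth

variable {J : Set ℝ}

lemma SmoothFamily2.koszul {g : ℝ → Tensor2 n M} (hgs : SmoothFamily2 J g)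
    {X Y Z : ℝ → VectorField n M} (hX : SmoothFamilyVF J X) (hY : SmoothFamilyVF J Y)
    (hZ : SmoothFamilyVF J Z) :
    SmoothFamily0 n J fun t => GenRicci.koszul (g t) (X t) (Y t) (Z t) :=
  (smoothFamily0_const (1 / 2)).mul <|
    ((((((hgs.apply hY hZ).dirDeriv hX).add ((hgs.apply hX hZ).dirDeriv hY)).sub
      ((hgs.apply hX hY).dirDeriv hZ)).add (hgs.apply (hX.bracket hY) hZ)).sub
      (hgs.apply (hX.bracket hZ) hY)).sub (hgs.apply (hY.bracket hZ) hX)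

lemma SmoothFamily2.leviCivita {g : ℝ → Tensor2 n M} (hgs : SmoothFamily2 J g)
    (hg : ∀ t ∈ J, IsRiemannian (g t)) {X Y : ℝ → VectorField n M} (hX : SmoothFamilyVF J X)
    (hY : SmoothFamilyVF J Y) : SmoothFamilyVF J fun t => GenRicci.leviCivita (g t) (X t) (Y t) := by
  refine hgs.sharp hg (ξ := fun t y => toCovector y fun v =>
    GenRicci.koszul (g t) (X t) (Y t) (extVec v) y) fun Z hZ => ?_
  refine SmoothFamily0.congr (G := fun t y => toCovector y (fun v =>
    GenRicci.koszul (g t) (X t) (Y t) (extVec v) y) (Z y)) (hgs.koszul hX hY (hZ.family J))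
    fun t ht y => ?_
  rw [← (hg t ht).apply_leviCivita (hX.slice ht) (hY.slice ht) hZ, GenRicci.leviCivita,
    (hg t ht).apply_sharp]

lemma IsRiemannian.smoothVF_leviCivita {g : Tensor2 n M} (hg : IsRiemannian g)
    {X Y : VectorField n M} (hX : SmoothVF X) (hY : SmoothVF Y) :
    SmoothVF (GenRicci.leviCivita g X Y) :=
  ((hg.smooth.family Set.univ).leviCivita (fun _ _ => hg) (hX.family _) (hY.family _)).slice
    (t := 0) trivial

lemma IsRiemannian.smoothVF_sharp {g : Tensor2 n M} (hg : IsRiemannian g) {ξ : Tensor1 n M}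
    (hξ : Smooth1 ξ) : SmoothVF fun y => GenRicci.sharp g y (ξ y) :=
  ((hg.smooth.family Set.univ).sharp (fun _ _ => hg) (hξ.family _)).slice (t := 0) trivial

end LeviCivitaSmooth

/-! ### Traces of fields of endomorphisms -/

section Trace

lemma traceT_comp_comm {x : M} (A B : TangentSpace (𝓡 n) x →ₗ[ℝ] TangentSpace (𝓡 n) x) :
    traceT x (fun v => A (B v)) = traceT x fun v => B (A v) := by
  have h : ∀ A B : TangentSpace (𝓡 n) x →ₗ[ℝ] TangentSpace (𝓡 n) x,
      traceT x (fun v => A (B v)) =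
        ∑ i, ∑ j, stdCov x j (B (stdVec x i)) * stdCov x i (A (stdVec x j)) := fun A B => by
    refine Finset.sum_congr rfl fun i _ => ?_
    beta_reduce
    conv_lhs => rw [← sum_stdCov_smul x (B (stdVec x i))]
    simp only [map_sum, map_smul, smul_eq_mul]
  rw [h, h, Finset.sum_comm]
  exact Finset.sum_congr rfl fun i _ => Finset.sum_congr rfl fun j _ => mul_comm _ _

/-- The trace in the coordinate frame of a nearby point. -/
lemma traceT_eq_sum {x y : M} (hy : y ∈ coordNhd n x)
    (A : TangentSpace (𝓡 n) y →ₗ[ℝ] TangentSpace (𝓡 n) y) :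
    traceT y A = ∑ k, dirDeriv (coordFn x k) (A (extVec (stdVec x k) y)) := by
  have h1 : ∀ i, stdCov y i (A (stdVec y i)) = ∑ k, dirDeriv (coordFn x k) (stdVec y i) *
      stdCov y i (A (extVec (stdVec x k) y)) := fun i => by
    conv_lhs => rw [← sum_dirDeriv_coordFn_smul hy (stdVec y i)]
    simp only [map_sum, map_smul, smul_eq_mul]
  simp only [traceT, h1]
  rw [Finset.sum_comm]
  refine Finset.sum_congr rfl fun k _ => ?_
  conv_rhs => rw [← sum_stdCov_smul y (A (extVec (stdVec x k) y))]
  rw [dirDeriv_sum_vec]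
  refine Finset.sum_congr rfl fun i _ => ?_
  rw [dirDeriv_smul_vec, mul_comm]

/-- A derivation along `v` of smooth vector fields in terms of its values on the coordinate
frame. -/
lemma derivation_apply {x : M} {v : TangentSpace (𝓡 n) x}
    {N : VectorField n M → TangentSpace (𝓡 n) x}
    (hadd : ∀ X Y, SmoothVF X → SmoothVF Y → N (fun y => X y + Y y) = N X + N Y)
    (hleib : ∀ (f : M → ℝ) X, SmoothFn (n := n) f → SmoothVF X →
      N (fun y => f y • X y) = dirDeriv f v • X x + f x • N X)
    {Z : VectorField n M} (hZ : SmoothVF Z) :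
    N Z = ∑ j, dirDeriv (fun y => dirDeriv (coordFn x j) (Z y)) v • stdVec x j
      + ∑ k, stdCov x k (Z x) • N (extVec (stdVec x k)) := by
  have hs : ∀ j {Z : VectorField n M}, SmoothVF Z →
      SmoothFn (n := n) fun y => dirDeriv (coordFn x j) (Z y) := fun j Z hZ =>
    SmoothFn.dirDeriv (smoothFn_coordFn x j) hZ
  have key := tensorial_apply (x := x) (Φ := fun Z : VectorField n M => N Z -
    ∑ j, dirDeriv (fun y => dirDeriv (coordFn (n := n) x j) (Z y)) v • stdVec x j) ?_ ?_ hZ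
  · have h0 : ∀ k, ∑ j, dirDeriv (fun y => dirDeriv (coordFn x j)
        (extVec (stdVec x k) y)) v • stdVec x j = 0 := fun k => by
      refine Finset.sum_eq_zero fun j _ => ?_
      have : (fun y => dirDeriv (coordFn (n := n) x j) (extVec (stdVec x k) y)) =ᶠ[𝓝 x]
          fun _ => stdCov x j (stdVec x k) := by
        exact Filter.eventually_of_mem (coordNhd_mem_nhds (n := n) x) fun y hy =>
          dirDeriv_coordFn_extVec hy j _
      rw [dirDeriv_congr this, dirDeriv_const, zero_smul]
    rw [sub_eq_iff_eq_add'] at key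
    rw [key]
    simp only [h0, sub_zero]
  · intro X Y hX hY
    simp only [dirDeriv_add_vec]
    rw [hadd X Y hX hY]
    simp only [dirDeriv_add (hs _ hX) (hs _ hY), add_smul, Finset.sum_add_distrib]
    abel
  · intro f X hf hX
    simp only [dirDeriv_smul_vec]
    rw [hleib f X hf hX]
    simp only [dirDeriv_mul hf (hs _ hX), add_smul, Finset.sum_add_distrib, mul_smul]
    have h1 : ∑ j, dirDeriv (coordFn x j) (X x) • dirDeriv f v • stdVec x j
        = dirDeriv f v • X x := by
      conv_rhs => rw [← sum_stdCov_smul x (X x)]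
      simp only [dirDeriv_coordFn_self, Finset.smul_sum, smul_comm (dirDeriv f v)]
    rw [h1, smul_sub, Finset.smul_sum]
    abel

/-- The trace commutes with derivations. -/
lemma dirDeriv_traceT {x : M} {v : TangentSpace (𝓡 n) x}
    {N : VectorField n M → TangentSpace (𝓡 n) x}
    (hadd : ∀ X Y, SmoothVF X → SmoothVF Y → N (fun y => X y + Y y) = N X + N Y)
    (hleib : ∀ (f : M → ℝ) X, SmoothFn (n := n) f → SmoothVF X →
      N (fun y => f y • X y) = dirDeriv f v • X x + f x • N X)
    (A : (y : M) → TangentSpace (𝓡 n) y →ₗ[ℝ] TangentSpace (𝓡 n) y)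
    (hA : ∀ Z, SmoothVF Z → SmoothVF fun y => A y (Z y)) :
    dirDeriv (fun y => traceT y (A y)) v =
      ∑ k, stdCov x k (N fun y => A y (extVec (stdVec x k) y))
        - ∑ k, stdCov x k (A x (N (extVec (stdVec x k)))) := by
  have h1 : (fun y => traceT y (A y)) =ᶠ[𝓝 x] fun y =>
      ∑ k, dirDeriv (coordFn x k) (A y (extVec (stdVec x k) y)) := by
    filter_upwards [coordNhd_mem_nhds (n := n) x] with y hy
    exact traceT_eq_sum hy (A y)
  have h2 : ∀ k, stdCov x k (N fun y => A y (extVec (stdVec x k) y)) =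
      dirDeriv (fun y => dirDeriv (coordFn x k) (A y (extVec (stdVec x k) y))) v +
      ∑ j, stdCov x j (A x (stdVec x k)) * stdCov x k (N (extVec (stdVec x j))) := fun k => by
    rw [derivation_apply hadd hleib (hA _ (smoothVF_extVec _))]
    simp only [map_add, map_sum, map_smul, smul_eq_mul, stdCov_stdVec, extVec_self]
    simp
  have h3 : ∀ k, stdCov x k (A x (N (extVec (stdVec x k)))) =
      ∑ j, stdCov x j (N (extVec (stdVec x k))) * stdCov x k (A x (stdVec x j)) := fun k => by
    conv_lhs => rw [← sum_stdCov_smul x (N (extVec (stdVec x k)))]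
    simp only [map_sum, map_smul, smul_eq_mul]
  rw [dirDeriv_congr h1, dirDeriv_sum _ fun k _ =>
    SmoothFn.dirDeriv (smoothFn_coordFn x k) (hA _ (smoothVF_extVec _))]
  simp only [h2, h3, Finset.sum_add_distrib]
  rw [Finset.sum_comm (f := fun k j => stdCov x j (A x (stdVec x k)) *
    stdCov x k (N (extVec (stdVec x j))))]
  simp only [mul_comm (stdCov x _ (A x _))]
  ring

end Trace

/-! ### Curvature and the Ricci tensor -/

section Curvature

/-- The Jacobi identity for vector fields. -/
lemma bracket_jacobi {X Y Z : VectorField n M} (hX : SmoothVF X) (hY : SmoothVF Y)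
    (hZ : SmoothVF Z) (x : M) :
    bracket X (bracket Y Z) x + bracket Y (bracket Z X) x + bracket Z (bracket X Y) x = 0 := by
  refine eq_of_dirDeriv fun f hf => ?_
  have h : ∀ {X Y Z : VectorField n M}, SmoothVF X → SmoothVF Y → SmoothVF Z →
      dirDeriv f (bracket X (bracket Y Z) x) =
        dirDeriv (fun y => dirDeriv (fun z => dirDeriv f (Z z)) (Y y)) (X x)
        - dirDeriv (fun y => dirDeriv (fun z => dirDeriv f (Y z)) (Z y)) (X x)
        - dirDeriv (fun y => dirDeriv (fun z => dirDeriv f (X z)) (Z y)) (Y x)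
        + dirDeriv (fun y => dirDeriv (fun z => dirDeriv f (X z)) (Y y)) (Z x)
      := fun {X Y Z} hX hY hZ => by
    rw [dirDeriv_bracket hf hX (hY.bracket hZ), dirDeriv_bracket (SmoothFn.dirDeriv hf hX) hY hZ]
    simp only [dirDeriv_bracket hf hY hZ]
    rw [dirDeriv_sub (SmoothFn.dirDeriv (SmoothFn.dirDeriv hf hZ) hY)
      (SmoothFn.dirDeriv (SmoothFn.dirDeriv hf hY) hZ)]
    ring
  rw [dirDeriv_add_vec, dirDeriv_add_vec, h hX hY hZ, h hY hZ hX, h hZ hX hY, dirDeriv_zero_vec]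
  ring

namespace IsRiemannian

variable {g : Tensor2 n M} (hg : IsRiemannian g)
include hg

lemma leviCivita_congr_left {X X' Y : VectorField n M} (hX : SmoothVF X) (hX' : SmoothVF X')
    (hY : SmoothVF Y) {x : M} (h : X x = X' x) : leviCivita g X Y x = leviCivita g X' Y x :=
  tensorial_eq (Φ := fun X => leviCivita g X Y x)
    (fun _ _ h1 h2 => hg.leviCivita_add_left h1 h2 hY x)
    (fun _ _ hf h1 => hg.leviCivita_smul_left hf h1 hY x) hX hX' h

lemma leviCivita_sub_right {X Y Z : VectorField n M} (hX : SmoothVF X) (hY : SmoothVF Y)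
    (hZ : SmoothVF Z) (x : M) :
    leviCivita g X (fun y => Y y - Z y) x = leviCivita g X Y x - leviCivita g X Z x := by
  have := hg.leviCivita_add_right hX (hY.sub hZ) hZ x
  simp only [sub_add_cancel] at this
  exact eq_sub_of_add_eq this.symm

/-- The endomorphism `v ↦ ∇_v Y` of the tangent space at `x`. -/
def nabla {Y : VectorField n M} (hY : SmoothVF Y) (x : M) :
    TangentSpace (𝓡 n) x →ₗ[ℝ] TangentSpace (𝓡 n) x where
  toFun v := leviCivita g (extVec v) Y x
  map_add' v w := by
    rw [← hg.leviCivita_add_left (smoothVF_extVec v) (smoothVF_extVec w) hY]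
    exact congrArg (fun Z => leviCivita g Z Y x) (funext fun y => extVec_add v w y)
  map_smul' c v := by
    rw [RingHom.id_apply, ← hg.leviCivita_smul_left (smoothFn_const c) (smoothVF_extVec v) hY]
    exact congrArg (fun Z => leviCivita g Z Y x) (funext fun y => extVec_smul c v y)

lemma nabla_apply {X Y : VectorField n M} (hX : SmoothVF X) (hY : SmoothVF Y) (x : M) :
    hg.nabla hY x (X x) = leviCivita g X Y x :=
  hg.leviCivita_congr_left (smoothVF_extVec _) hX hY (extVec_self _)

lemma riemann_swap {X Y Z : VectorField n M} (hX : SmoothVF X) (hY : SmoothVF Y)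
    (hZ : SmoothVF Z) (x : M) : riemann g X Y Z x = -riemann g Y X Z x := by
  have h : leviCivita g (bracket X Y) Z x = -leviCivita g (bracket Y X) Z x := by
    rw [← hg.nabla_apply (hX.bracket hY) hZ, ← hg.nabla_apply (hY.bracket hX) hZ, bracket_swap X Y,
      map_neg]
  simp only [riemann, h]
  abel

lemma riemann_add_middle {X Y Z W : VectorField n M} (hX : SmoothVF X) (hY : SmoothVF Y)
    (hZ : SmoothVF Z) (hW : SmoothVF W) (x : M) :
    riemann g X (fun y => Y y + Z y) W x = riemann g X Y W x + riemann g X Z W x := by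
  have h1 : leviCivita g (fun y => Y y + Z y) W =
      fun y => leviCivita g Y W y + leviCivita g Z W y :=
    funext fun y => hg.leviCivita_add_left hY hZ hW y
  have h2 : bracket X (fun y => Y y + Z y) = fun y => bracket X Y y + bracket X Z y :=
    funext fun y => bracket_add_right hY hZ y
  simp only [riemann]
  rw [h1, h2, hg.leviCivita_add_right hX (hg.smoothVF_leviCivita hY hW)
    (hg.smoothVF_leviCivita hZ hW), hg.leviCivita_add_left hY hZ (hg.smoothVF_leviCivita hX hW),
    hg.leviCivita_add_left (hX.bracket hY) (hX.bracket hZ) hW]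
  abel

lemma riemann_smul_middle {f : M → ℝ} {X Y W : VectorField n M} (hf : SmoothFn (n := n) f)
    (hX : SmoothVF X) (hY : SmoothVF Y) (hW : SmoothVF W) (x : M) :
    riemann g X (fun y => f y • Y y) W x = f x • riemann g X Y W x := by
  have h1 : leviCivita g (fun y => f y • Y y) W = fun y => f y • leviCivita g Y W y :=
    funext fun y => hg.leviCivita_smul_left hf hY hW y
  have h2 : bracket X (fun y => f y • Y y) =
      fun y => dirDeriv f (X y) • Y y + f y • bracket X Y y :=
    funext fun y => bracket_smul_right hf hY y
  simp only [riemann]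
  rw [h1, h2, hg.leviCivita_smul_right hf hX (hg.smoothVF_leviCivita hY hW),
    hg.leviCivita_smul_left hf hY (hg.smoothVF_leviCivita hX hW),
    hg.leviCivita_add_left (SmoothVF.smul (SmoothFn.dirDeriv hf hX) hY)
      (SmoothVF.smul hf (hX.bracket hY)) hW,
    hg.leviCivita_smul_left (SmoothFn.dirDeriv hf hX) hY hW,
    hg.leviCivita_smul_left hf (hX.bracket hY) hW]
  module

lemma riemann_add_right {X Y Z W : VectorField n M} (hX : SmoothVF X) (hY : SmoothVF Y)
    (hZ : SmoothVF Z) (hW : SmoothVF W) (x : M) :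
    riemann g X Y (fun y => Z y + W y) x = riemann g X Y Z x + riemann g X Y W x := by
  have h1 : ∀ {X : VectorField n M}, SmoothVF X → leviCivita g X (fun y => Z y + W y) =
      fun y => leviCivita g X Z y + leviCivita g X W y := fun hX =>
    funext fun y => hg.leviCivita_add_right hX hZ hW y
  simp only [riemann]
  rw [h1 hX, h1 hY, h1 (hX.bracket hY), hg.leviCivita_add_right hX (hg.smoothVF_leviCivita hY hZ)
    (hg.smoothVF_leviCivita hY hW), hg.leviCivita_add_right hY (hg.smoothVF_leviCivita hX hZ)
    (hg.smoothVF_leviCivita hX hW)]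
  module

lemma riemann_smul_right {f : M → ℝ} {X Y Z : VectorField n M} (hf : SmoothFn (n := n) f)
    (hX : SmoothVF X) (hY : SmoothVF Y) (hZ : SmoothVF Z) (x : M) :
    riemann g X Y (fun y => f y • Z y) x = f x • riemann g X Y Z x := by
  have h1 : ∀ {X : VectorField n M}, SmoothVF X → leviCivita g X (fun y => f y • Z y) =
      fun y => dirDeriv f (X y) • Z y + f y • leviCivita g X Z y := fun hX =>
    funext fun y => hg.leviCivita_smul_right hf hX hZ y
  have h2 : ∀ {X Y : VectorField n M}, SmoothVF X → SmoothVF Y →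
      leviCivita g X (fun y => dirDeriv f (Y y) • Z y + f y • leviCivita g Y Z y) x =
        dirDeriv (fun y => dirDeriv f (Y y)) (X x) • Z x + dirDeriv f (Y x) • leviCivita g X Z x +
        (dirDeriv f (X x) • leviCivita g Y Z x + f x • leviCivita g X (leviCivita g Y Z) x) :=
    fun {X Y} hX hY => by
    rw [hg.leviCivita_add_right hX (SmoothVF.smul (SmoothFn.dirDeriv hf hY) hZ)
      (SmoothVF.smul hf (hg.smoothVF_leviCivita hY hZ)),
      hg.leviCivita_smul_right (SmoothFn.dirDeriv hf hY) hX hZ,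
      hg.leviCivita_smul_right hf hX (hg.smoothVF_leviCivita hY hZ)]
  simp only [riemann]
  rw [h1 hX, h1 hY, h1 (hX.bracket hY), h2 hX hY, h2 hY hX]
  beta_reduce
  rw [dirDeriv_bracket hf hX hY]
  module

lemma riemann_congr {X Y Y' Z Z' : VectorField n M} (hX : SmoothVF X) (hY : SmoothVF Y)
    (hY' : SmoothVF Y') (hZ : SmoothVF Z) (hZ' : SmoothVF Z') {x : M} (h : Y x = Y' x)
    (h' : Z x = Z' x) : riemann g X Y Z x = riemann g X Y' Z' x :=
  (tensorial_eq (Φ := fun Y => riemann g X Y Z x)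
    (fun _ _ h1 h2 => hg.riemann_add_middle hX h1 h2 hZ x)
    (fun _ _ hf h1 => hg.riemann_smul_middle hf hX h1 hZ x) hY hY' h).trans
  (tensorial_eq (Φ := fun Z => riemann g X Y' Z x)
    (fun _ _ h1 h2 => hg.riemann_add_right hX hY' h1 h2 x)
    (fun _ _ hf h1 => hg.riemann_smul_right hf hX hY' h1 x) hZ hZ' h')

/-- The first Bianchi identity. -/
lemma riemann_bianchi {X Y Z : VectorField n M} (hX : SmoothVF X) (hY : SmoothVF Y)
    (hZ : SmoothVF Z) (x : M) :
    riemann g X Y Z x + riemann g Y Z X x + riemann g Z X Y x = 0 := by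
  have h : ∀ {X Y Z : VectorField n M}, SmoothVF X → SmoothVF Y → SmoothVF Z →
      bracket X (bracket Y Z) x = leviCivita g X (leviCivita g Y Z) x
        - leviCivita g X (leviCivita g Z Y) x - leviCivita g (bracket Y Z) X x :=
    fun {X Y Z} hX hY hZ => by
    have h1 : bracket Y Z = fun y => leviCivita g Y Z y - leviCivita g Z Y y :=
      funext fun y => (hg.leviCivita_sub_swap hY hZ y).symm
    rw [← hg.leviCivita_sub_swap hX (hY.bracket hZ)]
    conv_lhs => enter [1]; rw [h1]
    rw [hg.leviCivita_sub_right hX (hg.smoothVF_leviCivita hY hZ) (hg.smoothVF_leviCivita hZ hY)]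
  have hj := bracket_jacobi hX hY hZ x
  rw [h hX hY hZ, h hY hZ hX, h hZ hX hY] at hj
  simp only [riemann]
  rw [← hj]
  abel

/-- The curvature is skew with respect to the metric. -/
lemma riemann_skew {X Y Z W : VectorField n M} (hX : SmoothVF X) (hY : SmoothVF Y)
    (hZ : SmoothVF Z) (hW : SmoothVF W) (x : M) :
    g x (riemann g X Y Z x) (W x) = -g x (riemann g X Y W x) (Z x) := by
  have h : ∀ {X Y : VectorField n M}, SmoothVF X → SmoothVF Y →
      dirDeriv (fun y => dirDeriv (fun z => g z (Z z) (W z)) (Y y)) (X x) =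
        g x (leviCivita g X (leviCivita g Y Z) x) (W x)
        + g x (leviCivita g Y Z x) (leviCivita g X W x)
        + (g x (leviCivita g X Z x) (leviCivita g Y W x)
        + g x (Z x) (leviCivita g X (leviCivita g Y W) x)) := fun {X Y} hX hY => by
    simp only [hg.dirDeriv_metric hY hZ hW]
    rw [dirDeriv_add (hg.smoothFn (hg.smoothVF_leviCivita hY hZ) hW)
      (hg.smoothFn hZ (hg.smoothVF_leviCivita hY hW)),
      hg.dirDeriv_metric hX (hg.smoothVF_leviCivita hY hZ) hW,
      hg.dirDeriv_metric hX hZ (hg.smoothVF_leviCivita hY hW)]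
  have hb := dirDeriv_bracket (hg.smoothFn hZ hW) hX hY x
  rw [h hX hY, h hY hX, hg.dirDeriv_metric (hX.bracket hY) hZ hW] at hb
  simp only [riemann, map_sub, _root_.sub_apply]
  rw [hg.symm x _ (Z x), hg.symm x _ (Z x), hg.symm x _ (Z x)]
  linarith

lemma traceT_eq_traceMetric {x : M} (F : TangentSpace (𝓡 n) x → TangentSpace (𝓡 n) x) :
    traceT x F = traceMetric g x fun v w => g x (F v) w := by
  refine Finset.sum_congr rfl fun i _ => ?_
  beta_reduce
  rw [hg.symm, hg.apply_sharp]

lemma stdCov_sharp_comm (x : M) (i j : Fin n) :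
    stdCov x j (sharp g x (stdCov x i)) = stdCov x i (sharp g x (stdCov x j)) := by
  rw [← hg.apply_sharp x (stdCov x j), hg.symm, hg.apply_sharp, hg.apply_sharp]

/-- The trace of a bilinear form with respect to the metric does not depend on the order of the
arguments. -/
lemma traceMetric_swap {x : M}
    (F : TangentSpace (𝓡 n) x → TangentSpace (𝓡 n) x → ℝ)
    (h₁ : ∀ u v, F u v = ∑ j, stdCov x j u * F (stdVec x j) v)
    (h₂ : ∀ u v, F u v = ∑ j, stdCov x j v * F u (stdVec x j)) :
    traceMetric g x F = traceMetric g x fun v w => F w v := by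
  simp only [traceMetric, h₂ _ (sharp g x _), h₁ (sharp g x _)]
  rw [Finset.sum_comm]
  exact Finset.sum_congr rfl fun i _ => Finset.sum_congr rfl fun j _ => by
    rw [hg.stdCov_sharp_comm]

/-- The Ricci tensor is symmetric: by the first Bianchi identity its skew-symmetric part is a trace
of `R(u, v)`, which vanishes because `R(u, v)` is skew with respect to the metric. -/
lemma ricci_symm (x : M) (u v : TangentSpace (𝓡 n) x) : ricci g x u v = ricci g x v u := by
  have hU := smoothVF_extVec u
  have hV := smoothVF_extVec v
  have h1 : ∀ k, stdCov x k (riemann g (extVec (stdVec x k)) (extVec u) (extVec v) x) -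
      stdCov x k (riemann g (extVec (stdVec x k)) (extVec v) (extVec u) x) =
      -∑ j, g x (sharp g x (stdCov x j)) (sharp g x (stdCov x k)) *
        g x (riemann g (extVec u) (extVec v) (extVec (stdVec x k)) x) (stdVec x j) := fun k => by
    have hE := smoothVF_extVec (stdVec x k)
    have hb := hg.riemann_bianchi hE hU hV x
    rw [hg.riemann_swap hV hE hU, add_assoc, add_comm, add_assoc, ← sub_eq_neg_add] at hb
    rw [← map_sub, ← neg_eq_of_add_eq_zero_right hb, map_neg]
    congr 1
    have h2 : ∀ w, stdCov x k w = g x w (sharp g x (stdCov x k)) := fun w => by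
      rw [hg.symm, hg.apply_sharp]
    rw [h2]
    conv_lhs => rw [← sum_stdCov_smul x (sharp g x (stdCov x k))]
    simp only [map_sum, map_smul, smul_eq_mul, hg.apply_sharp]
  rw [← sub_eq_zero]
  simp only [ricci, traceT]
  rw [← Finset.sum_sub_distrib, Finset.sum_congr rfl fun k _ => h1 k, Finset.sum_neg_distrib,
    neg_eq_zero]
  have h3 : ∀ k j, g x (sharp g x (stdCov x j)) (sharp g x (stdCov x k)) *
        g x (riemann g (extVec u) (extVec v) (extVec (stdVec x k)) x) (stdVec x j) =
      -(g x (sharp g x (stdCov x k)) (sharp g x (stdCov x j)) *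
        g x (riemann g (extVec u) (extVec v) (extVec (stdVec x j)) x) (stdVec x k)) :=
      fun k j => by
    have := hg.riemann_skew hU hV (smoothVF_extVec (stdVec x k)) (smoothVF_extVec (stdVec x j)) x
    rw [extVec_self, extVec_self] at this
    rw [this, hg.symm x (sharp g x (stdCov x j))]
    ring
  -- The sum is antisymmetric in its two indices, hence equal to its negative.
  have h4 : ∀ S : ℝ, S = -S → S = 0 := fun S h => by linarith
  refine h4 _ ?_
  conv_lhs => rw [Finset.sum_comm]
  rw [← Finset.sum_neg_distrib]
  refine Finset.sum_congr rfl fun j _ => ?_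
  rw [← Finset.sum_neg_distrib]
  exact Finset.sum_congr rfl fun k _ => h3 k j

/-- The Ricci tensor in terms of the divergence: the trace of the definition of the curvature, where
`∇_X` is taken out of the trace. -/
lemma ricci_eq {X Y : VectorField n M} (hX : SmoothVF X) (hY : SmoothVF Y) (x : M) :
    ricci g x (X x) (Y x) = divergence g (leviCivita g X Y) x
      - dirDeriv (divergence g Y) (X x)
      - traceT x fun v => hg.nabla hY x (hg.nabla hX x v) := by
  have h1 : dirDeriv (divergence g Y) (X x) = _ :=
    dirDeriv_traceT (N := fun Z => leviCivita g X Z x)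
      (fun Z W hZ hW => hg.leviCivita_add_right hX hZ hW x)
      (fun f Z hf hZ => hg.leviCivita_smul_right hf hX hZ x)
      (hg.nabla hY) (fun Z hZ => by
        simpa only [hg.nabla_apply hZ hY] using hg.smoothVF_leviCivita hZ hY)
  have h2 : ∀ k, riemann g (extVec (stdVec x k)) (extVec (X x)) (extVec (Y x)) x =
      leviCivita g (extVec (stdVec x k)) (leviCivita g X Y) x
      - leviCivita g X (fun y => hg.nabla hY y (extVec (stdVec x k) y)) x
      - (hg.nabla hY x (hg.nabla hX x (stdVec x k))
        - hg.nabla hY x (leviCivita g X (extVec (stdVec x k)) x)) := fun k => by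
    have hE := smoothVF_extVec (stdVec x k)
    rw [hg.riemann_congr hE (smoothVF_extVec _) hX (smoothVF_extVec _) hY (extVec_self _)
      (extVec_self _), riemann]
    have h3 : leviCivita g (extVec (stdVec x k)) Y =
        fun y => hg.nabla hY y (extVec (stdVec x k) y) :=
      funext fun y => (hg.nabla_apply hE hY y).symm
    rw [h3, ← hg.nabla_apply (hE.bracket hX) hY, ← hg.leviCivita_sub_swap hE hX, map_sub]
    rfl
  rw [h1]
  simp only [ricci, divergence, traceT, h2, map_sub, Finset.sum_sub_distrib]
  ring

end IsRiemannian

end Curvature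

/-! ### Alternating forms -/

section Forms

lemma IsAlternating2.swap {B : Tensor2 n M} (hB : IsAlternating2 B) (x : M)
    (u v : TangentSpace (𝓡 n) x) : B x u v = -B x v u := by
  have h := hB x (u + v)
  simp only [map_add, _root_.add_apply, hB x u, hB x v] at h
  linarith

namespace IsAlternating3

variable {H : Tensor3 n M} (hH : IsAlternating3 H)
include hH

lemma swap_right (x : M) (u v w : TangentSpace (𝓡 n) x) : H x u v w = -H x u w v := by
  have h := (hH x u (v + w)).2
  simp only [map_add, _root_.add_apply, (hH x u v).2, (hH x u w).2] at h
  linarith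

lemma swap_left (x : M) (u v w : TangentSpace (𝓡 n) x) : H x u v w = -H x v u w := by
  have h := (hH x (u + v) w).1
  simp only [map_add, _root_.add_apply, (hH x u w).1, (hH x v w).1] at h
  linarith

lemma rotate (x : M) (u v w : TangentSpace (𝓡 n) x) : H x u v w = H x w u v := by
  rw [hH.swap_right, hH.swap_left x u w v, neg_neg]

end IsAlternating3

end Forms

/-! ### The symmetric and skew-symmetric parts of the soliton equation -/

section Soliton

lemma covDeriv3_swap_right {g : Tensor2 n M} {H : Tensor3 n M} (hH : IsAlternating3 H)
    (W A B C : VectorField n M) (x : M) :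
    covDeriv3 g H W A B C x = -covDeriv3 g H W A C B x := by
  have h : (fun y => H y (A y) (B y) (C y)) = fun y => -H y (A y) (C y) (B y) :=
    funext fun y => hH.swap_right _ _ _ _
  rw [covDeriv3, covDeriv3, h, dirDeriv_neg, hH.swap_right x _ (B x), hH.swap_right x _ (B x),
    hH.swap_right x _ (leviCivita g W B x)]
  ring

lemma covDeriv3_swap_left {g : Tensor2 n M} {H : Tensor3 n M} (hH : IsAlternating3 H)
    (W A B C : VectorField n M) (x : M) :
    covDeriv3 g H W A B C x = -covDeriv3 g H W B A C x := by
  have h : (fun y => H y (A y) (B y) (C y)) = fun y => -H y (B y) (A y) (C y) :=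
    funext fun y => hH.swap_left _ _ _ _
  rw [covDeriv3, covDeriv3, h, dirDeriv_neg, hH.swap_left x (A x), hH.swap_left x (A x),
    hH.swap_left x (leviCivita g W A x)]
  ring

/-- The covariant derivative of a 1-form, `(∇_u θ)(v)`. -/
def covDeriv1 (g : Tensor2 n M) (θ : Tensor1 n M) (x : M) (u v : TangentSpace (𝓡 n) x) : ℝ :=
  dirDeriv (fun y => θ y (extVec v y)) u - θ x (leviCivita g (extVec u) (extVec v) x)

namespace IsRiemannian

variable {g : Tensor2 n M} (hg : IsRiemannian g)
include hg

lemma lieDeriv_eq {X : VectorField n M} (hX : SmoothVF X) (x : M) (u v : TangentSpace (𝓡 n) x) :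
    lieDeriv X g x u v = g x (leviCivita g (extVec u) X x) v
      + g x u (leviCivita g (extVec v) X x) := by
  have hU := smoothVF_extVec u
  have hV := smoothVF_extVec v
  rw [lieDeriv, hg.dirDeriv_metric hX hU hV, ← hg.leviCivita_sub_swap hX hU,
    ← hg.leviCivita_sub_swap hX hV, extVec_self, extVec_self]
  simp only [map_sub, _root_.sub_apply]
  ring

lemma lieDeriv_symm {X : VectorField n M} (hX : SmoothVF X) (x : M)
    (u v : TangentSpace (𝓡 n) x) : lieDeriv X g x u v = lieDeriv X g x v u := by
  rw [hg.lieDeriv_eq hX, hg.lieDeriv_eq hX, hg.symm x _ v, hg.symm x _ u, add_comm]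

lemma lieDeriv_sharp {θ : Tensor1 n M} (hθ : Smooth1 θ) (x : M) (u v : TangentSpace (𝓡 n) x) :
    lieDeriv (fun y => sharp g y (θ y)) g x u v = covDeriv1 g θ x u v + covDeriv1 g θ x v u := by
  have hS := hg.smoothVF_sharp hθ
  have h : ∀ u v : TangentSpace (𝓡 n) x,
      g x (leviCivita g (extVec u) (fun y => sharp g y (θ y)) x) v = covDeriv1 g θ x u v := by
    intro u v
    have h1 := hg.dirDeriv_metric (smoothVF_extVec u) hS (smoothVF_extVec v) x
    simp only [hg.apply_sharp, extVec_self] at h1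
    rw [covDeriv1, h1]
    ring
  rw [hg.lieDeriv_eq hS, hg.symm x u, h, h]

lemma extDeriv1_eq (θ : Tensor1 n M) (x : M) (u v : TangentSpace (𝓡 n) x) :
    extDeriv1 θ x u v = covDeriv1 g θ x u v - covDeriv1 g θ x v u := by
  rw [extDeriv1, ← hg.leviCivita_sub_swap (smoothVF_extVec u) (smoothVF_extVec v), map_sub,
    covDeriv1, covDeriv1]
  ring

lemma bismutDeriv_eq {H : Tensor3 n M} (hH : IsAlternating3 H) (θ : Tensor1 n M) (x : M)
    (u v : TangentSpace (𝓡 n) x) :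
    bismutDeriv g H θ x u v = covDeriv1 g θ x u v - (1 / 2) * H x (sharp g x (θ x)) u v := by
  have h : θ x (sharp g x (H x u v)) = H x (sharp g x (θ x)) u v := by
    conv_lhs => rw [← hg.apply_sharp x (θ x), hg.symm, hg.apply_sharp]
    rw [hH.rotate]
  simp only [bismutDeriv, bismut, covDeriv1, map_add, map_smul, smul_eq_mul, extVec_self, h]
  ring

lemma codiff_swap {H : Tensor3 n M} (hH : IsAlternating3 H) (x : M)
    (u v : TangentSpace (𝓡 n) x) : codiff g H x u v = -codiff g H x v u := by
  simp only [codiff, traceMetric, covDeriv3_swap_right hH _ _ (extVec u)]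
  rw [Finset.sum_neg_distrib]

lemma traceMetric_mul_swap {x : M} (ξ η : TangentSpace (𝓡 n) x →L[ℝ] ℝ) :
    (traceMetric g x fun b b' => ξ b * η b') = traceMetric g x fun b b' => ξ b' * η b := by
  have hlin : ∀ (ξ : TangentSpace (𝓡 n) x →L[ℝ] ℝ) w,
      ξ w = ∑ j, stdCov x j w * ξ (stdVec x j) := fun ξ w => by
    conv_lhs => rw [← sum_stdCov_smul x w]
    simp only [map_sum, map_smul, smul_eq_mul]
  refine hg.traceMetric_swap _ (fun b b' => ?_) fun b b' => ?_
  · rw [hlin _ b, Finset.sum_mul]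
    simp only [mul_assoc]
  · rw [hlin _ b', Finset.mul_sum]
    exact Finset.sum_congr rfl fun j _ => by ring

lemma circ_symm (H : Tensor3 n M) (x : M) (u v : TangentSpace (𝓡 n) x) :
    circ g H x u v = circ g H x v u := by
  have hlin2 : ∀ (F : TangentSpace (𝓡 n) x →L[ℝ] TangentSpace (𝓡 n) x →L[ℝ] ℝ) w z,
      F w z = ∑ j, stdCov x j w * F (stdVec x j) z := fun F w z => by
    conv_lhs => rw [← sum_stdCov_smul x w]
    simp only [map_sum, map_smul, smul_eq_mul, _root_.sum_apply, _root_.smul_apply]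
  rw [circ, hg.traceMetric_swap]
  · unfold circ
    congr 1
    funext a a'
    rw [hg.traceMetric_mul_swap]
    simp only [mul_comm]
  · intro a a'
    simp only [traceMetric, Finset.mul_sum]
    rw [Finset.sum_comm]
    refine Finset.sum_congr rfl fun i _ => ?_
    rw [hlin2 _ a, Finset.sum_mul]
    exact Finset.sum_congr rfl fun j _ => by ring
  · intro a a'
    simp only [traceMetric, Finset.mul_sum]
    rw [Finset.sum_comm]
    refine Finset.sum_congr rfl fun i _ => ?_
    rw [hlin2 _ a', Finset.mul_sum]
    exact Finset.sum_congr rfl fun j _ => by ring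

/-- The soliton equation splits into its symmetric and its skew-symmetric part. -/
theorem solitonEq_iff {H : Tensor3 n M} (hH : IsAlternating3 H) (lam : ℝ) {X : VectorField n M}
    (hX : SmoothVF X) {θ : Tensor1 n M} (hθ : Smooth1 θ) {β : Tensor2 n M}
    (hβ : IsAlternating2 β) :
    SolitonEq g lam X H θ β ↔ SplitSolitonEq g lam X H θ β := by
  simp only [SolitonEq, SplitSolitonEq, hg.lieDeriv_sharp hθ, hg.extDeriv1_eq,
    hg.bismutDeriv_eq hH]
  constructor
  · intro h
    refine ⟨fun x u v => ?_, fun x u v => ?_⟩ <;>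
    · have h1 := h x u v
      have h2 := h x v u
      rw [hg.ricci_symm x v u, hg.lieDeriv_symm hX x v u, hg.circ_symm H x v u,
        hg.codiff_swap hH x v u, hβ.swap x v u, hH.swap_right x _ v u, hg.symm x v u] at h2
      linarith
  · rintro ⟨h1, h2⟩ x u v
    rw [h1, h2]
    ring

end IsRiemannian

end Soliton

/-! ### The eigenbundles of a generalized metric -/

section GenMetric

/-- The lift `v ↦ v + s g(v) + ι_v B` of tangent vectors to the eigenbundle `E_s` of the generalized
metric, for `s = ±1`. -/
def lift (s : ℝ) (g B : Tensor2 n M) (x : M) : TangentSpace (𝓡 n) x →L[ℝ] GFiber (n := n) x :=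
  (ContinuousLinearMap.id ℝ _).prod (s • g x + B x)

/-- The tangent vector whose lift is the projection of an element of the fibre to `E_s`. -/
def proj (s : ℝ) (g B : Tensor2 n M) (x : M) : GFiber (n := n) x →L[ℝ] TangentSpace (𝓡 n) x :=
  (1 / 2 : ℝ) • (ContinuousLinearMap.fst ℝ _ _ + s • (sharp g x).comp
    (ContinuousLinearMap.snd ℝ _ _ - (B x).comp (ContinuousLinearMap.fst ℝ _ _)))

/-- The lift of a vector field to a section of `E_s`. -/
def liftSec (s : ℝ) (g B : Tensor2 n M) (X : VectorField n M) : GSection n M :=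
  fun y => lift s g B y (X y)

variable {g B : Tensor2 n M}

lemma lift_fst (s : ℝ) (x : M) (v : TangentSpace (𝓡 n) x) : (lift s g B x v).1 = v := rfl

lemma lift_snd (s : ℝ) (x : M) (v : TangentSpace (𝓡 n) x) :
    (lift s g B x v).2 = s • g x v + B x v := rfl

lemma proj_apply (s : ℝ) (x : M) (a : GFiber (n := n) x) :
    proj s g B x a = (1 / 2 : ℝ) • (a.1 + s • sharp g x (a.2 - B x a.1)) := rfl

lemma genMetric_apply (x : M) (a : GFiber (n := n) x) :
    genMetric g B x a = (sharp g x (a.2 - B x a.1),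
      g x a.1 + B x (sharp g x (a.2 - B x a.1))) := by
  simp only [genMetric, expB, sub_eq_add_neg]
  rfl

lemma pairing_sub_left {x : M} (a b c : GFiber (n := n) x) :
    pairing (a - b) c = pairing a c - pairing b c := by
  simp only [pairing, Prod.fst_sub, Prod.snd_sub, map_sub, _root_.sub_apply]
  ring

lemma pairing_comm {x : M} (a b : GFiber (n := n) x) : pairing a b = pairing b a := by
  simp only [pairing, add_comm]

namespace IsRiemannian

variable (hg : IsRiemannian g)
include hg

lemma proj_lift {s : ℝ} (hs : s * s = 1) (x : M) (v : TangentSpace (𝓡 n) x) :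
    proj s g B x (lift s g B x v) = v := by
  rw [proj_apply, lift_fst, lift_snd, add_sub_cancel_right, map_smul, hg.sharp_apply, smul_smul, hs]
  module

lemma genMetric_lift {s : ℝ} (hs : s * s = 1) (x : M) (v : TangentSpace (𝓡 n) x) :
    genMetric g B x (lift s g B x v) = s • lift s g B x v := by
  rw [genMetric_apply, lift_fst, lift_snd, add_sub_cancel_right, map_smul, hg.sharp_apply]
  refine Prod.ext rfl ?_
  change g x v + B x (s • v) = s • (s • g x v + B x v)
  rw [map_smul, smul_add, smul_smul, hs, one_smul]

lemma eq_lift {s : ℝ} {x : M} {a : GFiber (n := n) x} (h : genMetric g B x a = s • a) :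
    a = lift s g B x a.1 := by
  rw [genMetric_apply] at h
  have h1 : sharp g x (a.2 - B x a.1) = s • a.1 := congrArg Prod.fst h
  refine Prod.ext rfl ?_
  rw [lift_snd, ← map_smul, ← h1, hg.apply_sharp, sub_add_cancel]

lemma plusPart_eq (z : GSection n M) :
    plusPart (genMetric g B) z = liftSec 1 g B fun y => proj 1 g B y (z y) := by
  funext y
  simp only [plusPart, liftSec, proj_apply, genMetric_apply, map_smul]
  congr 1
  refine Prod.ext ?_ ?_
  · simp only [Prod.fst_add, lift_fst, one_smul]
  · simp only [Prod.snd_add, lift_snd, one_smul, map_add, hg.apply_sharp]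
    abel

lemma minusPart_eq (z : GSection n M) :
    minusPart (genMetric g B) z = liftSec (-1) g B fun y => proj (-1) g B y (z y) := by
  funext y
  simp only [minusPart, liftSec, proj_apply, genMetric_apply, map_smul]
  congr 1
  refine Prod.ext ?_ ?_
  · simp only [Prod.fst_sub, lift_fst]
    module
  · rw [Prod.snd_sub, lift_snd]
    simp only [map_add, map_smul, hg.apply_sharp]
    module

lemma lift_proj_add (x : M) (a : GFiber (n := n) x) :
    lift 1 g B x (proj 1 g B x a) + lift (-1) g B x (proj (-1) g B x a) = a := by
  simp only [proj_apply, map_smul]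
  rw [← smul_add]
  refine Prod.ext ?_ ?_
  · simp only [Prod.smul_fst, Prod.fst_add, lift_fst]
    module
  · simp only [Prod.smul_snd, Prod.snd_add, lift_snd, map_add, map_smul, hg.apply_sharp]
    module

variable (hB : IsAlternating2 B)
include hB

/-- The pairing with an element of `E_s` depends only on the projection to `E_s`. -/
lemma pairing_lift {s : ℝ} (hs : s * s = 1) (x : M) (a : GFiber (n := n) x)
    (v : TangentSpace (𝓡 n) x) :
    pairing a (lift s g B x v) = s * g x (proj s g B x a) v := by
  simp only [pairing, lift_fst, lift_snd, proj_apply, map_smul, map_add, hg.apply_sharp,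
    _root_.add_apply, _root_.smul_apply, _root_.sub_apply, smul_eq_mul]
  rw [hB.swap x v, hg.symm x v]
  linear_combination (-(1 / 2) * (a.2 v - B x a.1 v)) * hs

lemma proj_lift_neg {s : ℝ} (hs : s * s = 1) (x : M) (v : TangentSpace (𝓡 n) x) :
    proj s g B x (lift (-s) g B x v) = 0 := by
  rw [proj_apply, lift_fst, lift_snd, add_sub_cancel_right, map_smul, hg.sharp_apply, smul_smul,
    mul_neg, hs]
  module

/-- The trace of an operator on the fibre with values in `E_+` is the trace of its restriction to
`E_+`, which is identified with the tangent space. -/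
lemma traceG_lift {x : M} (N : GFiber (n := n) x →ₗ[ℝ] TangentSpace (𝓡 n) x) :
    traceG x (fun a => lift 1 g B x (N a)) = traceT x fun v => N (lift 1 g B x v) := by
  let A : TangentSpace (𝓡 n) x →ₗ[ℝ] TangentSpace (𝓡 n) x :=
    { toFun := fun v => N (0, g x v)
      map_add' := fun v w => by rw [← map_add, Prod.mk_add_mk, map_add, add_zero]
      map_smul' := fun c v => by
        rw [RingHom.id_apply, ← map_smul, Prod.smul_mk, map_smul, smul_zero] }
  let C : TangentSpace (𝓡 n) x →ₗ[ℝ] TangentSpace (𝓡 n) x := ((sharp g x).comp (B x)).toLinearMap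
  have hA : ∀ v, A v = N (0, g x v) := fun v => rfl
  have hC : ∀ v, g x (C v) = B x v := fun v => hg.apply_sharp x (B x v)
  have htr : ∀ A : TangentSpace (𝓡 n) x →ₗ[ℝ] TangentSpace (𝓡 n) x,
      traceT x A = ∑ i, g x (A (sharp g x (stdCov x i))) (stdVec x i) := fun A => by
    rw [hg.traceT_eq_traceMetric, hg.traceMetric_swap]
    · rfl
    · intro u v
      conv_lhs => rw [← sum_stdCov_smul x u]
      simp only [map_sum, map_smul, _root_.sum_apply, _root_.smul_apply, smul_eq_mul]
    · intro u v
      conv_lhs => rw [← sum_stdCov_smul x v]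
      simp only [map_sum, map_smul, smul_eq_mul]
  have h1 : ∀ v, N (lift 1 g B x v) = N (v, 0) + A v + A (C v) := fun v => by
    rw [hA, hA, hC, ← map_add, ← map_add]
    congr 1
    refine Prod.ext ?_ ?_ <;> simp [lift_fst, lift_snd]
  have h2 : ∀ i, (lift 1 g B x (N (0, stdCov x i))).2 (stdVec x i) =
      g x (A (sharp g x (stdCov x i))) (stdVec x i)
        + g x (C (A (sharp g x (stdCov x i)))) (stdVec x i) := fun i => by
    rw [hC, hA, hg.apply_sharp, lift_snd, one_smul, _root_.add_apply]
  have h3 := traceT_comp_comm A C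
  have h4 := htr (C ∘ₗ A)
  have h5 : traceT x (fun v => N (lift 1 g B x v)) = (∑ i, stdCov x i (N (stdVec x i, 0)))
      + traceT x A + traceT x fun v => A (C v) := by
    simp only [traceT, h1, map_add, Finset.sum_add_distrib]
  rw [h5, h3, htr A]
  simp only [LinearMap.comp_apply] at h4
  change traceT x (fun v => C (A v)) = _ at h4
  rw [h4, traceG]
  simp only [h2, Finset.sum_add_distrib, lift_fst]
  ring

end IsRiemannian

end GenMetric

/-! ### Smooth sections of the generalized tangent bundle -/

section Sections

lemma Smooth1.add {ξ η : Tensor1 n M} (hξ : Smooth1 ξ) (hη : Smooth1 η) :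
    Smooth1 fun y => ξ y + η y := fun X hX => (hξ X hX).add (hη X hX)

lemma Smooth1.sub {ξ η : Tensor1 n M} (hξ : Smooth1 ξ) (hη : Smooth1 η) :
    Smooth1 fun y => ξ y - η y := fun X hX => (hξ X hX).sub (hη X hX)

lemma Smooth1.const_smul (c : ℝ) {ξ : Tensor1 n M} (hξ : Smooth1 ξ) :
    Smooth1 fun y => c • ξ y := fun X hX =>
  SmoothFn.mul (smoothFn_const c) (hξ X hX)

lemma smoothSec_liftSec (s : ℝ) {g B : Tensor2 n M} (hg : Smooth2 g) (hB : Smooth2 B)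
    {X : VectorField n M} (hX : SmoothVF X) : SmoothSec (liftSec s g B X) :=
  ⟨hX, Smooth1.add (Smooth1.const_smul s fun Y hY => hg X Y hX hY) fun Y hY => hB X Y hX hY⟩

lemma IsRiemannian.smoothVF_proj (s : ℝ) {g B : Tensor2 n M} (hg : IsRiemannian g)
    (hB : Smooth2 B) {z : GSection n M} (hz : SmoothSec z) :
    SmoothVF fun y => proj s g B y (z y) :=
  SmoothVF.const_smul (1 / 2) (hz.1.add (SmoothVF.const_smul s
    (hg.smoothVF_sharp (hz.2.sub fun Y hY => hB _ Y hz.1 hY))))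

lemma smooth1_extCov {x : M} (ξ : TangentSpace (𝓡 n) x →L[ℝ] ℝ) : Smooth1 (extCov ξ) := by
  intro X hX
  refine (bump (n := n) x).contMDiff_smul ?_
  have h1 := (Bundle.Trivialization.contMDiffOn_section_baseSet_iff
      (trivializationAt (EuclideanSpace ℝ (Fin n)) (TangentSpace (𝓡 n) (M := M)) x)
      (IB := 𝓡 n) (n := ∞) (s := X)).1 hX.contMDiffOn
  rw [TangentBundle.trivializationAt_baseSet] at h1
  have h2 : ContMDiff 𝓘(ℝ, EuclideanSpace ℝ (Fin n)) 𝓘(ℝ, ℝ) ∞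
      (ξ.comp ((trivializationAt (EuclideanSpace ℝ (Fin n))
        (TangentSpace (𝓡 n)) x).symmL ℝ x) : EuclideanSpace ℝ (Fin n) →L[ℝ] ℝ) :=
    ContinuousLinearMap.contMDiff _
  refine (h2.comp_contMDiffOn h1).congr fun y hy => ?_
  have e1 : ((trivializationAt (EuclideanSpace ℝ (Fin n)) (TangentSpace (𝓡 n)) x)
      ⟨y, X y⟩).2 = (trivializationAt (EuclideanSpace ℝ (Fin n))
        (TangentSpace (𝓡 n)) x).continuousLinearMapAt ℝ y (X y) := by
    rw [Bundle.Trivialization.continuousLinearMapAt_apply,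
      Bundle.Trivialization.linearMapAt_apply, if_pos]
    rw [TangentBundle.trivializationAt_baseSet]
    exact hy
  exact (congrArg (fun w => ξ ((trivializationAt (EuclideanSpace ℝ (Fin n))
        (TangentSpace (𝓡 n)) x).symmL ℝ x w)) e1).symm

lemma smoothSec_extG {x : M} (a : GFiber (n := n) x) : SmoothSec (extG a) :=
  ⟨smoothVF_extVec a.1, smooth1_extCov a.2⟩

lemma extCov_self {x : M} (ξ : TangentSpace (𝓡 n) x →L[ℝ] ℝ) : extCov ξ x = ξ := by
  ext v
  rw [extCov, bump_eq_one (mem_coordNhd x), one_smul]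
  exact congrArg ξ (Bundle.Trivialization.symmL_continuousLinearMapAt (R := ℝ)
    (trivializationAt (EuclideanSpace ℝ (Fin n)) (TangentSpace (𝓡 n)) x)
    (mem_baseSet (mem_coordNhd x)) v)

lemma extG_self {x : M} (a : GFiber (n := n) x) : extG a x = a :=
  Prod.ext (extVec_self a.1) (extCov_self a.2)

end Sections

/-! ### Mixed Dorfman brackets -/

section Dorfman

/-- `dB(X, Y, Z)` for a 2-form `B`. -/
def extDeriv2 (B : Tensor2 n M) (X Y Z : VectorField n M) (x : M) : ℝ :=
  dirDeriv (fun y => B y (Y y) (Z y)) (X x) - dirDeriv (fun y => B y (X y) (Z y)) (Y x)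
    + dirDeriv (fun y => B y (X y) (Y y)) (Z x) - B x (bracket X Y x) (Z x)
    + B x (bracket X Z x) (Y x) - B x (bracket Y Z x) (X x)

/-- `H' = H + dB`, evaluated on smooth vector fields. -/
def IsTwist (H : Tensor3 n M) (B : Tensor2 n M) (H' : Tensor3 n M) : Prop :=
  ∀ X Y Z : VectorField n M, SmoothVF X → SmoothVF Y → SmoothVF Z → ∀ x : M,
    H' x (X x) (Y x) (Z x) = H x (X x) (Y x) (Z x) + extDeriv2 B X Y Z x

/-- The covector part of the Dorfman bracket on smooth vector fields. -/
lemma dorfman_snd_apply (H : Tensor3 n M) {z w : GSection n M} (hz : SmoothSec z)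
    (hw : SmoothSec w) {W : VectorField n M} (hW : SmoothVF W) (x : M) :
    (dorfman H z w x).2 (W x) =
      (dirDeriv (fun y => (w y).2 (W y)) (z x).1 - (w x).2 (bracket (fun y => (z y).1) W x))
      - (dirDeriv (fun y => (z y).2 (W y)) (w x).1 - dirDeriv (fun y => (z y).2 (w y).1) (W x)
        - (z x).2 (bracket (fun y => (w y).1) W x)) + H x (z x).1 (w x).1 (W x) := by
  have h := toCovector_apply_of_tensorial (x := x) (Φ := fun W =>
      (dirDeriv (fun y => (w y).2 (W y)) (z x).1 - (w x).2 (bracket (fun y => (z y).1) W x))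
      - (dirDeriv (fun y => (z y).2 (W y)) (w x).1 - dirDeriv (fun y => (z y).2 (w y).1) (W x)
        - (z x).2 (bracket (fun y => (w y).1) W x))) ?_ ?_ hW
  · rw [← h]
    simp only [extVec_self]
    rfl
  · intro X Y hX hY
    simp only [map_add]
    rw [dirDeriv_add (hw.2 X hX) (hw.2 Y hY), dirDeriv_add (hz.2 X hX) (hz.2 Y hY),
      bracket_add_right hX hY, bracket_add_right hX hY, dirDeriv_add_vec, map_add, map_add]
    ring
  · intro f X hf hX
    simp only [map_smul, smul_eq_mul]
    rw [dirDeriv_mul hf (hw.2 X hX), dirDeriv_mul hf (hz.2 X hX), bracket_smul_right hf hX,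
      bracket_smul_right hf hX, dirDeriv_smul_vec, map_add, map_add, map_smul, map_smul, map_smul,
      map_smul]
    simp only [smul_eq_mul]
    ring

/-- The connection `∇ + (s / 2) g⁻¹H` with skew-symmetric torsion, used for `s = ±1`. -/
def skewConn (s : ℝ) (g : Tensor2 n M) (H : Tensor3 n M) (X Y : VectorField n M) :
    VectorField n M :=
  fun x => leviCivita g X Y x + (s / 2) • sharp g x (H x (X x) (Y x))

/-- The mixed Dorfman brackets of sections of `E_±` are given by the connections with torsion
`±(H + dB)`. -/
lemma proj_dorfman {g B : Tensor2 n M} (hg : IsRiemannian g) (hBs : Smooth2 B)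
    (hB : IsAlternating2 B) {H H' : Tensor3 n M} (hH' : IsTwist H B H') {s : ℝ} (hs : s * s = 1)
    {X Y : VectorField n M} (hX : SmoothVF X) (hY : SmoothVF Y) (x : M) :
    proj s g B x (dorfman H (liftSec (-s) g B X) (liftSec s g B Y) x) = skewConn s g H' X Y x := by
  refine hg.ext_field fun W hW => ?_
  have hsm : ∀ {X Y : VectorField n M} (c : ℝ), SmoothVF X → SmoothVF Y →
      (dirDeriv (fun y => (liftSec c g B X y).2 (Y y)) : TangentSpace (𝓡 n) x → ℝ) =
      fun v => c * dirDeriv (fun y => g y (X y) (Y y)) v +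
        dirDeriv (fun y => B y (X y) (Y y)) v := fun {X Y} c hX hY => by
    funext v
    rw [← dirDeriv_const_mul c (hg.smoothFn hX hY), ← dirDeriv_add
      ((smoothFn_const c).mul (hg.smoothFn hX hY)) (hBs X Y hX hY)]
    rfl
  have h1 := dorfman_snd_apply H (smoothSec_liftSec (-s) hg.smooth hBs hX)
    (smoothSec_liftSec s hg.smooth hBs hY) hW x
  have h2 : (dorfman H (liftSec (-s) g B X) (liftSec s g B Y) x).1 = bracket X Y x := rfl
  rw [hsm _ hY hW, hsm _ hX hW] at h1
  have h3 : (fun y => (liftSec (-s) g B X y).2 (liftSec s g B Y y).1) =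
      fun y => (liftSec (-s) g B X y).2 (Y y) := rfl
  rw [h3, hsm _ hX hY] at h1
  simp only [liftSec, lift_fst, lift_snd, _root_.add_apply, _root_.smul_apply, smul_eq_mul] at h1
  rw [proj_apply, h2, map_smul, map_add, map_smul, hg.apply_sharp, skewConn, map_add, map_smul,
    hg.apply_sharp]
  simp only [_root_.add_apply, _root_.smul_apply, _root_.sub_apply, smul_eq_mul]
  rw [hg.apply_leviCivita hX hY hW, hH' X Y W hX hY hW]
  rw [h1, koszul, extDeriv2, hB.swap x (Y x), hB.swap x (X x) (bracket Y W x),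
    hg.symm x (Y x), hg.symm x (X x) (bracket Y W x)]
  -- The two sides differ by the factor `s * s = 1` in the terms of the Koszul formula.
  linear_combination (1 / 2 * (dirDeriv (fun y => g y (Y y) (W y)) (X x)
    + dirDeriv (fun y => g y (X y) (W y)) (Y x) - dirDeriv (fun y => g y (X y) (Y y)) (W x)
    - g x (bracket X W x) (Y x) - g x (bracket Y W x) (X x))) * hs

end Dorfman

/-! ### Generalized connections on mixed pairs of sections -/

section Connection

variable {g B : Tensor2 n M} {H H' : Tensor3 n M} {D : GenConnection n M}

/-- A generalized connection that preserves the generalized metric maps sections of `E_s` to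
`E_s`. -/
lemma GenConnection.Compatible.toFun_liftSec (hD : D.Compatible (genMetric g B))
    (hg : IsRiemannian g) (hBs : Smooth2 B) {s : ℝ} (hs : s * s = 1) {X : VectorField n M}
    (hX : SmoothVF X) (x : M) (a : GFiber (n := n) x) :
    D.toFun (liftSec s g B X) x a = lift s g B x (D.toFun (liftSec s g B X) x a).1 := by
  have hz := smoothSec_liftSec s hg.smooth hBs hX
  refine hg.eq_lift ?_
  rw [← hD _ hz x a]
  have h1 : (fun y => genMetric g B y (liftSec s g B X y)) = fun y => s • liftSec s g B X y :=
    funext fun y => hg.genMetric_lift hs y (X y)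
  rw [h1, D.leibniz (fun _ => s) _ (smoothFn_const s) hz, dirDeriv_const, zero_smul, add_zero]

variable (hD : D.Compatible (genMetric g B)) (hT : D.TorsionFree H) (hg : IsRiemannian g)
  (hBs : Smooth2 B) (hB : IsAlternating2 B)
include hD hT hg hBs hB

/-- For a torsion-free compatible connection, the mixed operators `D_a b`, `a ∈ E_{-s}` and
`b ∈ E_s`, are determined by the Dorfman bracket. -/
lemma proj_dorfman_eq {s : ℝ} (hs : s * s = 1) {X Y : VectorField n M} (hX : SmoothVF X)
    (hY : SmoothVF Y) (x : M) :
    D.toFun (liftSec s g B Y) x (lift (-s) g B x (X x)) =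
      lift s g B x (proj s g B x (dorfman H (liftSec (-s) g B X) (liftSec s g B Y) x)) ∧
    D.toFun (liftSec s g B Y) x (lift (-s) g B x (X x)) =
      -lift s g B x (proj s g B x (dorfman H (liftSec s g B Y) (liftSec (-s) g B X) x)) := by
  have hs' : -s * -s = 1 := by rw [neg_mul_neg, hs]
  have hb := smoothSec_liftSec s hg.smooth hBs hY
  have ha := smoothSec_liftSec (-s) hg.smooth hBs hX
  have hs0 : s ≠ 0 := by rintro rfl; simp at hs
  have horth : ∀ u v, pairing (lift (-s) g B x u) (lift s g B x v) = 0 := fun u v => by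
    rw [hg.pairing_lift hB hs, hg.proj_lift_neg hB hs, map_zero, _root_.zero_apply, mul_zero]
  have e1 := hD.toFun_liftSec hg hBs hs hY x (lift (-s) g B x (X x))
  have h4 : proj s g B x (D.toFun (liftSec s g B Y) x (liftSec (-s) g B X x)) =
      (D.toFun (liftSec s g B Y) x (lift (-s) g B x (X x))).1 :=
    (congrArg (proj s g B x) e1).trans (hg.proj_lift hs _ _)
  constructor
  · rw [e1]
    refine congrArg _ (hg.ext fun e => mul_left_cancel₀ hs0 ?_)
    have h := hT _ _ ha hb x (lift s g B x e)
    rw [pairing_sub_left, pairing_sub_left, hD.toFun_liftSec hg hBs hs' hX x (liftSec s g B Y x),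
      hD.toFun_liftSec hg hBs hs' hX x (lift s g B x e), horth, hg.pairing_lift hB hs,
      hg.pairing_lift hB hs, pairing_comm (liftSec s g B Y x)] at h
    have h2 : pairing (lift (-s) g B x (D.toFun (liftSec (-s) g B X) x (lift s g B x e)).1)
        (liftSec s g B Y x) = 0 := horth _ _
    rw [h2, h4] at h
    linarith
  · rw [e1, ← map_neg]
    refine congrArg _ (hg.ext fun e => mul_left_cancel₀ hs0 ?_)
    have h := hT _ _ hb ha x (lift s g B x e)
    rw [pairing_sub_left, pairing_sub_left, hD.toFun_liftSec hg hBs hs' hX x (liftSec s g B Y x),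
      hD.toFun_liftSec hg hBs hs hY x (lift s g B x e), horth, hg.pairing_lift hB hs,
      hg.pairing_lift hB hs] at h
    have h2 : pairing (liftSec (-s) g B X x)
        (lift s g B x (D.toFun (liftSec s g B Y) x (lift s g B x e)).1) = 0 := horth _ _
    rw [h2, h4] at h
    rw [map_neg, _root_.neg_apply]
    linarith

end Connection

/-! ### Curvature of the connections with skew-symmetric torsion -/

section Divergence

variable {J : Set ℝ}

lemma SmoothFamily2.divergence {g : ℝ → Tensor2 n M} (hgs : SmoothFamily2 J g)
    (hg : ∀ t ∈ J, IsRiemannian (g t)) {Y : ℝ → VectorField n M} (hY : SmoothFamilyVF J Y) :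
    SmoothFamily0 n J fun t => GenRicci.divergence (g t) (Y t) := by
  refine smoothFamily0_of_local fun x => ⟨fun t y => ∑ k, dirDeriv (coordFn x k)
    (GenRicci.leviCivita (g t) (extVec (stdVec x k)) (Y t) y), smoothFamily0_sum _ fun k _ =>
      (hgs.leviCivita hg ((smoothVF_extVec _).family J) hY).coord x k, fun t ht y hy => ?_⟩
  have h1 := traceT_eq_sum hy ((hg t ht).nabla (hY.slice ht) y)
  simp only [(hg t ht).nabla_apply (smoothVF_extVec _) (hY.slice ht)] at h1
  exact h1

lemma IsRiemannian.smoothFn_divergence {g : Tensor2 n M} (hg : IsRiemannian g)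
    {Y : VectorField n M} (hY : SmoothVF Y) : SmoothFn (n := n) (GenRicci.divergence g Y) :=
  ((hg.smooth.family Set.univ).divergence (fun _ _ => hg) (hY.family _)).slice (t := 0) trivial

end Divergence

section RiemannianPart

/-- The vector `½ g⁻¹H(v, w, ·)`. -/
def halfTorsion (g : Tensor2 n M) (H : Tensor3 n M) (x : M) (v w : TangentSpace (𝓡 n) x) :
    TangentSpace (𝓡 n) x := (1 / 2 : ℝ) • sharp g x (H x v w)

/-- The endomorphism `v ↦ ½ g⁻¹H(v, w, ·)`. -/
def halfTorsionEnd (g : Tensor2 n M) (H : Tensor3 n M) (x : M) (w : TangentSpace (𝓡 n) x) :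
    TangentSpace (𝓡 n) x →ₗ[ℝ] TangentSpace (𝓡 n) x where
  toFun v := halfTorsion g H x v w
  map_add' v v' := by simp only [halfTorsion, map_add, _root_.add_apply, smul_add]
  map_smul' c v := by
    simp only [halfTorsion, map_smul, _root_.smul_apply, RingHom.id_apply, smul_comm c]

namespace IsRiemannian

variable {g : Tensor2 n M} (hg : IsRiemannian g) {H : Tensor3 n M} (hHs : Smooth3 H)
  (hH : IsAlternating3 H)
include hg

lemma stdCov_eq (x : M) (k : Fin n) (w : TangentSpace (𝓡 n) x) :
    stdCov x k w = g x w (sharp g x (stdCov x k)) := by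
  rw [hg.symm, hg.apply_sharp]

lemma apply_halfTorsion (H : Tensor3 n M) (x : M) (u v w : TangentSpace (𝓡 n) x) :
    g x (halfTorsion g H x u v) w = (1 / 2) * H x u v w := by
  rw [halfTorsion, map_smul, hg.apply_sharp]
  rfl

lemma stdCov_halfTorsion (H : Tensor3 n M) (x : M) (k : Fin n) (u v : TangentSpace (𝓡 n) x) :
    stdCov x k (halfTorsion g H x u v) = (1 / 2) * H x u v (sharp g x (stdCov x k)) := by
  rw [hg.stdCov_eq, hg.apply_halfTorsion]

include hHs in
lemma smoothVF_halfTorsion {X Y : VectorField n M} (hX : SmoothVF X) (hY : SmoothVF Y) :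
    SmoothVF fun y => halfTorsion g H y (X y) (Y y) :=
  SmoothVF.const_smul _ (hg.smoothVF_sharp fun Z hZ => hHs X Y Z hX hY hZ)

include hHs in
lemma covDeriv3_congr_left {W A A' B C : VectorField n M} (hW : SmoothVF W) (hA : SmoothVF A)
    (hA' : SmoothVF A') (hB : SmoothVF B) (hC : SmoothVF C) {x : M} (h : A x = A' x) :
    covDeriv3 g H W A B C x = covDeriv3 g H W A' B C x := by
  refine tensorial_eq (Φ := fun A => covDeriv3 g H W A B C x) (fun X Y hX hY => ?_)
    (fun f X hf hX => ?_) hA hA' h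
  · simp only [covDeriv3, map_add, _root_.add_apply]
    rw [dirDeriv_add (hHs X B C hX hB hC) (hHs Y B C hY hB hC), hg.leviCivita_add_right hW hX hY]
    simp only [map_add, _root_.add_apply]
    ring
  · simp only [covDeriv3, map_smul, _root_.smul_apply, smul_eq_mul]
    rw [dirDeriv_mul hf (hHs X B C hX hB hC), hg.leviCivita_smul_right hf hW hX]
    simp only [map_add, _root_.add_apply, map_smul, _root_.smul_apply, smul_eq_mul]
    ring

include hHs hH

/-- The divergence of the vector field `½ g⁻¹H(X, Y, ·)`. -/
lemma divergence_halfTorsion {X Y : VectorField n M} (hX : SmoothVF X) (hY : SmoothVF Y) (x : M) :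
    divergence g (fun y => halfTorsion g H y (X y) (Y y)) x =
      -(1 / 2) * codiff g H x (X x) (Y x)
      + traceT x (fun v => halfTorsion g H x (hg.nabla hX x v) (Y x))
      + traceT x fun v => halfTorsion g H x (X x) (hg.nabla hY x v) := by
  simp only [divergence, codiff, traceT, traceMetric, hg.stdCov_halfTorsion]
  rw [neg_mul_neg, Finset.mul_sum, ← Finset.sum_add_distrib, ← Finset.sum_add_distrib]
  refine Finset.sum_congr rfl fun k _ => ?_
  have hE := smoothVF_extVec (stdVec x k)
  have hV := smoothVF_extVec (sharp g x (stdCov x k))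
  have h1 := hg.dirDeriv_metric hE (hg.smoothVF_halfTorsion hHs hX hY) hV x
  simp only [hg.apply_halfTorsion] at h1
  rw [dirDeriv_const_mul _ (hHs X Y _ hX hY hV), extVec_self, extVec_self] at h1
  have h2 : covDeriv3 g H (extVec (stdVec x k)) (extVec (sharp g x (stdCov x k))) (extVec (X x))
      (extVec (Y x)) x = covDeriv3 g H (extVec (stdVec x k)) X Y
        (extVec (sharp g x (stdCov x k))) x := by
    rw [covDeriv3_swap_left hH, hg.covDeriv3_congr_left hHs hE (smoothVF_extVec _) hX hV
      (smoothVF_extVec _) (extVec_self _), covDeriv3_swap_right hH, covDeriv3_swap_left hH,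
      hg.covDeriv3_congr_left hHs hE (smoothVF_extVec _) hY hX hV (extVec_self _),
      covDeriv3_swap_left hH]
    ring
  have h3 : ∀ {X : VectorField n M} (hX : SmoothVF X), hg.nabla hX x (stdVec x k) =
      leviCivita g (extVec (stdVec x k)) X x := fun hX => rfl
  rw [hg.stdCov_eq, h2, covDeriv3, h3, h3]
  simp only [extVec_self]
  linarith

omit hHs in
lemma traceT_halfTorsion_halfTorsion (x : M) (u v : TangentSpace (𝓡 n) x) :
    traceT x (fun w => halfTorsion g H x (halfTorsion g H x w u) v) =
      -(1 / 4) * circ g H x u v := by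
  have h1 : ∀ k, stdCov x k (halfTorsion g H x (halfTorsion g H x (stdVec x k) u) v) =
      ∑ j, -(1 / 4) * (H x u (stdVec x k) (sharp g x (stdCov x j))
        * H x v (sharp g x (stdCov x k)) (stdVec x j)) := fun k => by
    rw [hg.stdCov_halfTorsion]
    conv_lhs => rw [← sum_stdCov_smul x (halfTorsion g H x (stdVec x k) u)]
    simp only [map_sum, map_smul, _root_.sum_apply, _root_.smul_apply, smul_eq_mul,
      hg.stdCov_halfTorsion, Finset.mul_sum]
    refine Finset.sum_congr rfl fun j _ => ?_
    rw [hH.swap_left x (stdVec x k) u, hH.rotate x v]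
    ring
  simp only [traceT, h1, ← Finset.mul_sum]
  congr 1
  rw [circ, traceMetric]
  refine Finset.sum_congr rfl fun k _ => ?_
  exact (hg.traceMetric_mul_swap (H x u (stdVec x k))
    (H x v (sharp g x (stdCov x k)))).symm

/-- The Riemannian content of the formula for the Ricci curvature of a generalized metric: the
terms on the left are what remains of `Rc⁺` once the free part of the generalized connection has
been expressed through its divergence. -/
lemma ricci_skewConn {X Y : VectorField n M} (hX : SmoothVF X) (hY : SmoothVF Y) (x : M) :
    divergence g (skewConn 1 g H X Y) x - dirDeriv (divergence g Y) (X x)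
      - traceT x (fun v => skewConn 1 g H (extVec (skewConn (-1) g H (extVec v) X x)) Y x) =
    ricci g x (X x) (Y x) - (1 / 2) * codiff g H x (X x) (Y x)
      - (1 / 4) * circ g H x (X x) (Y x) := by
  have hh := hg.smoothVF_halfTorsion hHs hX hY
  have h1 : divergence g (skewConn 1 g H X Y) x = divergence g (leviCivita g X Y) x
      + divergence g (fun y => halfTorsion g H y (X y) (Y y)) x := by
    simp only [divergence, traceT]
    rw [← Finset.sum_add_distrib]
    refine Finset.sum_congr rfl fun k _ => ?_
    rw [← map_add, ← hg.leviCivita_add_right (smoothVF_extVec _) (hg.smoothVF_leviCivita hX hY) hh]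
    rfl
  have h2 : ∀ v, skewConn 1 g H (extVec (skewConn (-1) g H (extVec v) X x)) Y x =
      hg.nabla hY x (hg.nabla hX x v) - hg.nabla hY x (halfTorsionEnd g H x (X x) v)
      + (halfTorsion g H x (hg.nabla hX x v) (Y x)
        - halfTorsion g H x (halfTorsion g H x v (X x)) (Y x)) := fun v => by
    have e1 : skewConn (-1) g H (extVec v) X x = hg.nabla hX x v
        - halfTorsionEnd g H x (X x) v := by
      simp only [skewConn, extVec_self, neg_div, neg_smul, ← sub_eq_add_neg]
      rfl
    have e2 : ∀ q, skewConn 1 g H (extVec q) Y x = hg.nabla hY x q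
        + halfTorsionEnd g H x (Y x) q := fun q => by
      simp only [skewConn, extVec_self]
      rfl
    rw [e2, e1, map_sub, map_sub]
    rfl
  have h3 : traceT x (fun v => hg.nabla hY x (halfTorsionEnd g H x (X x) v)) =
      -traceT x fun v => halfTorsion g H x (X x) (hg.nabla hY x v) := by
    rw [traceT_comp_comm, traceT, traceT, ← Finset.sum_neg_distrib]
    refine Finset.sum_congr rfl fun k _ => ?_
    change stdCov x k (halfTorsion g H x _ _) = _
    rw [hg.stdCov_halfTorsion, hg.stdCov_halfTorsion, hH.swap_left]
    ring
  have h4 := hg.traceT_halfTorsion_halfTorsion hH x (X x) (Y x)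
  have h5 : traceT x (fun v => skewConn 1 g H (extVec (skewConn (-1) g H (extVec v) X x)) Y x) =
      traceT x (fun v => hg.nabla hY x (hg.nabla hX x v))
      - traceT x (fun v => hg.nabla hY x (halfTorsionEnd g H x (X x) v))
      + (traceT x (fun v => halfTorsion g H x (hg.nabla hX x v) (Y x))
        - traceT x fun v => halfTorsion g H x (halfTorsion g H x v (X x)) (Y x)) := by
    simp only [h2, traceT, map_add, map_sub, Finset.sum_add_distrib, Finset.sum_sub_distrib]
  rw [h5, h1, h3, h4, hg.divergence_halfTorsion hHs hH hX hY, hg.ricci_eq hX hY]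
  ring

end IsRiemannian

end RiemannianPart

section SkewConn

variable {g : Tensor2 n M} (hg : IsRiemannian g) {H : Tensor3 n M} (s : ℝ)
include hg

lemma skewConn_add_right {X Y Z : VectorField n M} (hX : SmoothVF X) (hY : SmoothVF Y)
    (hZ : SmoothVF Z) (x : M) :
    skewConn s g H X (fun y => Y y + Z y) x = skewConn s g H X Y x + skewConn s g H X Z x := by
  simp only [skewConn]
  rw [hg.leviCivita_add_right hX hY hZ, map_add, map_add, smul_add]
  abel

lemma skewConn_smul_right {f : M → ℝ} {X Y : VectorField n M} (hf : SmoothFn (n := n) f)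
    (hX : SmoothVF X) (hY : SmoothVF Y) (x : M) :
    skewConn s g H X (fun y => f y • Y y) x =
      dirDeriv f (X x) • Y x + f x • skewConn s g H X Y x := by
  simp only [skewConn]
  rw [hg.leviCivita_smul_right hf hX hY, map_smul, map_smul]
  module

lemma smoothVF_skewConn (hH : Smooth3 H) {X Y : VectorField n M} (hX : SmoothVF X)
    (hY : SmoothVF Y) : SmoothVF (skewConn s g H X Y) :=
  (hg.smoothVF_leviCivita hX hY).add (SmoothVF.const_smul _
    (hg.smoothVF_sharp fun Z hZ => hH X Y Z hX hY hZ))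

/-- The connection with skew-symmetric torsion as a map `v ↦ ∇_v Y` on the tangent space. -/
lemma exists_skewConn_eq {Y : VectorField n M} (hY : SmoothVF Y) (x : M) :
    ∃ L : TangentSpace (𝓡 n) x →ₗ[ℝ] TangentSpace (𝓡 n) x,
      (∀ v, L v = skewConn s g H (extVec v) Y x) ∧
      ∀ X, SmoothVF X → L (X x) = skewConn s g H X Y x := by
  refine ⟨hg.nabla hY x + s • halfTorsionEnd g H x (Y x), fun v => ?_, fun X hX => ?_⟩
  · have : skewConn s g H (extVec v) Y x = leviCivita g (extVec v) Y x
        + s • (1 / 2 : ℝ) • sharp g x (H x v (Y x)) := by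
      rw [skewConn, extVec_self, smul_smul, mul_one_div]
    rw [this]
    rfl
  · rw [skewConn, ← hg.nabla_apply hX hY, ← mul_one_div, ← smul_smul]
    rfl

end SkewConn

/-! ### The Ricci curvature of a generalized metric -/

section RicciPlus

variable {g B : Tensor2 n M} {H H' : Tensor3 n M} {D : GenConnection n M}

/-- The operator `Z ↦ D_{Z^+} Y^+` on the tangent space, where `Z^+`, `Y^+` are the lifts to
`E_+`. -/
def plusEnd (D : GenConnection n M) (g B : Tensor2 n M) (Y : VectorField n M) (x : M) :
    TangentSpace (𝓡 n) x →ₗ[ℝ] TangentSpace (𝓡 n) x :=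
  (LinearMap.fst ℝ _ _).comp ((D.toFun (liftSec 1 g B Y) x).comp (lift 1 g B x).toLinearMap)

variable (hD : D.Compatible (genMetric g B)) (hT : D.TorsionFree H) (hg : IsRiemannian g)
  (hBs : Smooth2 B) (hB : IsAlternating2 B) (hH' : IsTwist H B H') (hHs : Smooth3 H')
include hD hg hBs

lemma toFun_lift_plus {Y : VectorField n M} (hY : SmoothVF Y) (x : M)
    (v : TangentSpace (𝓡 n) x) : D.toFun (liftSec 1 g B Y) x (lift 1 g B x v) =
      lift 1 g B x (plusEnd D g B Y x v) :=
  hD.toFun_liftSec hg hBs (one_mul 1) hY x _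

omit hD in
lemma smoothVF_plusEnd {Y Z : VectorField n M} (hY : SmoothVF Y) (hZ : SmoothVF Z) :
    SmoothVF fun y => plusEnd D g B Y y (Z y) :=
  (D.smooth _ _ (smoothSec_liftSec 1 hg.smooth hBs hY)
    (smoothSec_liftSec 1 hg.smooth hBs hZ)).1

include hB

lemma traceT_plusEnd {Y : VectorField n M} (hY : SmoothVF Y) (x : M) :
    traceT x (plusEnd D g B Y x) = traceG x (D.toFun (liftSec 1 g B Y) x) := by
  have h := hg.traceG_lift hB
    ((LinearMap.fst ℝ _ _).comp (D.toFun (liftSec 1 g B Y) x))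
  have h2 : ∀ a, lift 1 g B x (((LinearMap.fst ℝ _ _).comp (D.toFun (liftSec 1 g B Y) x)) a) =
      D.toFun (liftSec 1 g B Y) x a := fun a =>
    (hD.toFun_liftSec hg hBs (one_mul 1) hY x a).symm
  simp only [h2] at h
  exact h.symm

include hT hH'

/-- On `E_+`, the operators `D_a` with `a ∈ E_-` form the Bismut connection. -/
lemma toFun_lift_minus {X Y : VectorField n M} (hX : SmoothVF X) (hY : SmoothVF Y) (x : M) :
    D.toFun (liftSec 1 g B Y) x (lift (-1) g B x (X x)) =
      lift 1 g B x (skewConn 1 g H' X Y x) := by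
  rw [(proj_dorfman_eq hD hT hg hBs hB (one_mul 1) hX hY x).1,
    proj_dorfman hg hBs hB hH' (one_mul 1) hX hY]

/-- Both components of a mixed Dorfman bracket. -/
lemma dorfman_lift_plus_minus {X Z : VectorField n M} (hX : SmoothVF X) (hZ : SmoothVF Z) (x : M) :
    dorfman H (liftSec 1 g B Z) (liftSec (-1) g B X) x =
      lift (-1) g B x (skewConn (-1) g H' Z X x) - lift 1 g B x (skewConn 1 g H' X Z x) := by
  have h1 := proj_dorfman hg hBs hB hH' (s := -1) (by norm_num) hZ hX x
  rw [neg_neg] at h1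
  have h2 := (proj_dorfman_eq hD hT hg hBs hB (one_mul 1) hX hZ x).2
  rw [toFun_lift_minus hD hT hg hBs hB hH' hX hZ] at h2
  conv_lhs =>
    rw [← hg.lift_proj_add (B := B) x (dorfman H (liftSec 1 g B Z) (liftSec (-1) g B X) x)]
  rw [h1, h2]
  abel

include hHs

/-- The curvature operator of a torsion-free compatible connection that enters the Ricci
curvature. -/
lemma curvature_lift {X Y Z : VectorField n M} (hX : SmoothVF X) (hY : SmoothVF Y)
    (hZ : SmoothVF Z) (x : M) :
    D.curvature H (liftSec 1 g B Z) (liftSec (-1) g B X) (liftSec 1 g B Y) x =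
      lift 1 g B x (plusEnd D g B (skewConn 1 g H' X Y) x (Z x)
        - skewConn 1 g H' X (fun y => plusEnd D g B Y y (Z y)) x
        + plusEnd D g B Y x (skewConn 1 g H' X Z x)
        - skewConn 1 g H' (skewConn (-1) g H' Z X) Y x) := by
  have h1 : (fun y => D.toFun (liftSec 1 g B Y) y (liftSec (-1) g B X y)) =
      liftSec 1 g B (skewConn 1 g H' X Y) :=
    funext fun y => toFun_lift_minus hD hT hg hBs hB hH' hX hY y
  have h2 : (fun y => D.toFun (liftSec 1 g B Y) y (liftSec 1 g B Z y)) =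
      liftSec 1 g B fun y => plusEnd D g B Y y (Z y) :=
    funext fun y => toFun_lift_plus hD hg hBs hY y (Z y)
  have h3 := toFun_lift_plus hD hg hBs (smoothVF_skewConn hg 1 hHs hX hY) x (Z x)
  have h4 := toFun_lift_minus hD hT hg hBs hB hH' hX (smoothVF_plusEnd (D := D) hg hBs hY hZ) x
  have h5 := toFun_lift_minus hD hT hg hBs hB hH' (smoothVF_skewConn hg (-1) hHs hZ hX) hY x
  rw [GenConnection.curvature, h1, h2, dorfman_lift_plus_minus hD hT hg hBs hB hH' hX hZ, map_sub,
    toFun_lift_plus hD hg hBs hY, h5]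
  refine (congrArg₂ (fun a b => a - b - _) h3 h4).trans ?_
  simp only [map_add, map_sub]
  abel

/-- The Ricci curvature of a generalized metric, for any torsion-free compatible connection with the
given divergence. The unknown part `Z ↦ D_{Z^+} Y^+` of `D` enters through its trace only, because
the trace commutes with the Bismut derivative in the direction `X`. -/
theorem ricciPlus_eq (hHalt : IsAlternating3 H') {θ : Tensor1 n M} (hθ : Smooth1 θ)
    (hdiv : D.HasDivergence (divOp g fun x => (0, θ x))) (x : M) (u v : TangentSpace (𝓡 n) x) :
    ricciPlus D H (genMetric g B) (lift (-1) g B x u) (lift 1 g B x v) =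
      ricci g x u v - (1 / 2) * codiff g H' x u v - (1 / 4) * circ g H' x u v
        + (1 / 2) * bismutDeriv g H' θ x u v := by
  have hneg : (-1 : ℝ) * -1 = 1 := by norm_num
  set X : VectorField n M := fun y => proj (-1) g B y (extG (lift (-1) g B x u) y) with hXdef
  set Y : VectorField n M := fun y => proj 1 g B y (extG (lift 1 g B x v) y) with hYdef
  have hX : SmoothVF X := hg.smoothVF_proj _ hBs (smoothSec_extG _)
  have hY : SmoothVF Y := hg.smoothVF_proj _ hBs (smoothSec_extG _)
  have hXx : X x = u := by
    simp only [hXdef, extG_self]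
    exact hg.proj_lift hneg x u
  have hYx : Y x = v := by
    simp only [hYdef, extG_self]
    exact hg.proj_lift (one_mul 1) x v
  have hW := smoothVF_skewConn hg 1 hHs hX hY
  obtain ⟨L, hL, hL'⟩ := exists_skewConn_eq hg (H := H') 1 hY x
  obtain ⟨L₂, hL₂, hL₂'⟩ := exists_skewConn_eq hg (H := H') (-1) hX x
  let Φ : VectorField n M → TangentSpace (𝓡 n) x := fun Z =>
    plusEnd D g B (skewConn 1 g H' X Y) x (Z x)
      - skewConn 1 g H' X (fun y => plusEnd D g B Y y (Z y)) x
      + plusEnd D g B Y x (skewConn 1 g H' X Z x)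
      - skewConn 1 g H' (skewConn (-1) g H' Z X) Y x
  have hΦ : ∀ Z, SmoothVF Z → Φ Z = plusEnd D g B (skewConn 1 g H' X Y) x (Z x)
      - skewConn 1 g H' X (fun y => plusEnd D g B Y y (Z y)) x
      + plusEnd D g B Y x (skewConn 1 g H' X Z x) - L (L₂ (Z x)) := fun Z hZ => by
    rw [hL₂' Z hZ]
    rw [hL' (skewConn (-1) g H' Z X) (smoothVF_skewConn hg (-1) hHs hZ hX)]
  have hplus : ∀ {Z : VectorField n M}, SmoothVF Z →
      SmoothVF fun y => plusEnd D g B Y y (Z y) := fun hZ => smoothVF_plusEnd hg hBs hY hZ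
  have hΦapply : ∀ Z, SmoothVF Z →
      Φ Z = ∑ k, stdCov x k (Z x) • Φ (extVec (stdVec x k)) := by
    intro Z hZ
    refine tensorial_apply (fun Z Z' hZ hZ' => ?_) (fun f Z hf hZ => ?_) hZ
    · rw [hΦ _ (hZ.add hZ'), hΦ _ hZ, hΦ _ hZ', skewConn_add_right hg 1 hX hZ hZ']
      simp only [map_add]
      rw [skewConn_add_right hg 1 hX (hplus hZ) (hplus hZ')]
      abel
    · rw [hΦ _ (SmoothVF.smul hf hZ), hΦ _ hZ, skewConn_smul_right hg 1 hf hX hZ]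
      simp only [map_add, map_smul]
      rw [skewConn_smul_right hg 1 hf hX (hplus hZ)]
      module
  -- The curvature operator on the whole fibre, which factors through the projection to `E_+`.
  let N : GFiber (n := n) x →ₗ[ℝ] TangentSpace (𝓡 n) x :=
    ∑ k, (((stdCov x k).comp (proj 1 g B x)).toLinearMap).smulRight (Φ (extVec (stdVec x k)))
  have hN : ∀ a, N a = ∑ k, stdCov x k (proj 1 g B x a) • Φ (extVec (stdVec x k)) := fun a => by
    simp only [N, LinearMap.sum_apply, LinearMap.smulRight_apply]
    rfl
  have h1 : ricciPlus D H (genMetric g B) (lift (-1) g B x u) (lift 1 g B x v) =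
      traceG x fun a => lift 1 g B x (N a) := by
    rw [ricciPlus]
    congr 1
    funext c
    have hZ : SmoothVF fun y => proj 1 g B y (extG c y) := hg.smoothVF_proj _ hBs (smoothSec_extG c)
    rw [hg.plusPart_eq, hg.plusPart_eq, hg.minusPart_eq,
      curvature_lift hD hT hg hBs hB hH' hHs hX hY hZ, hN]
    refine congrArg _ ((hΦapply _ hZ).trans ?_)
    simp only [extG_self]
  have h2 : ricciPlus D H (genMetric g B) (lift (-1) g B x u) (lift 1 g B x v) =
      ∑ k, stdCov x k (Φ (extVec (stdVec x k))) := by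
    rw [h1, hg.traceG_lift hB, traceT]
    refine Finset.sum_congr rfl fun k _ => ?_
    rw [hN, hg.proj_lift (one_mul 1)]
    simp only [stdCov_stdVec, ite_smul, one_smul, zero_smul, Finset.sum_ite_eq', Finset.mem_univ,
      if_true]
  have htr : ∀ {Z : VectorField n M}, SmoothVF Z → ∀ y, traceT y (plusEnd D g B Z y) =
      divergence g Z y - (1 / 2) * θ y (Z y) := fun {Z} hZ y => by
    rw [traceT_plusEnd hD hg hBs hB hZ, hdiv _ (smoothSec_liftSec 1 hg.smooth hBs hZ), divOp]
    simp only [pairing, liftSec, lift_fst, map_zero, zero_add]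
  have h3 := dirDeriv_traceT (x := x) (v := X x) (N := fun Z => skewConn 1 g H' X Z x)
    (fun Z Z' hZ hZ' => skewConn_add_right hg 1 hX hZ hZ' x)
    (fun f Z hf hZ => skewConn_smul_right hg 1 hf hX hZ x) (plusEnd D g B Y)
    (fun Z hZ => hplus hZ)
  have h4 : (fun y => traceT y (plusEnd D g B Y y)) = fun y =>
      divergence g Y y - (1 / 2) * θ y (Y y) := funext fun y => htr hY y
  have hdivs : SmoothFn (n := n) (divergence g Y) := hg.smoothFn_divergence hY
  rw [h4, dirDeriv_sub hdivs ((smoothFn_const _).mul (hθ Y hY)),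
    dirDeriv_const_mul _ (hθ Y hY)] at h3
  have h5 : ∑ k, stdCov x k (Φ (extVec (stdVec x k))) =
      traceT x (plusEnd D g B (skewConn 1 g H' X Y) x)
      - (∑ k, stdCov x k (skewConn 1 g H' X (fun y => plusEnd D g B Y y
          (extVec (stdVec x k) y)) x)
        - ∑ k, stdCov x k (plusEnd D g B Y x (skewConn 1 g H' X (extVec (stdVec x k)) x)))
      - traceT x fun w => skewConn 1 g H' (extVec (skewConn (-1) g H' (extVec w) X x)) Y x := by
    simp only [fun k => hΦ _ (smoothVF_extVec (stdVec x k)), traceT, extVec_self, map_add, map_sub,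
      Finset.sum_add_distrib, Finset.sum_sub_distrib, ← hL, ← hL₂]
    ring
  have h6 := hg.ricci_skewConn hHs hHalt hX hY x
  have h7 : bismutDeriv g H' θ x u v = dirDeriv (fun y => θ y (Y y)) (X x)
      - θ x (skewConn 1 g H' X Y x) := by
    obtain ⟨L₃, hL₃, hL₃'⟩ := exists_skewConn_eq hg (H := H') 1 (smoothVF_extVec v) x
    have e1 : bismutDeriv g H' θ x u v = dirDeriv (fun y => θ y (extVec v y)) (X x)
        - θ x (skewConn 1 g H' X (extVec v) x) := by
      rw [← hL₃' X hX, hXx, hL₃]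
      rfl
    rw [e1]
    refine tensorial_eq (Φ := fun Y => dirDeriv (fun y => θ y (Y y)) (X x)
      - θ x (skewConn 1 g H' X Y x)) (fun Z Z' hZ hZ' => ?_) (fun f Z hf hZ => ?_)
      (smoothVF_extVec v) hY ((extVec_self v).trans hYx.symm)
    · rw [skewConn_add_right hg 1 hX hZ hZ']
      simp only [map_add]
      rw [dirDeriv_add (hθ Z hZ) (hθ Z' hZ')]
      ring
    · rw [skewConn_smul_right hg 1 hf hX hZ]
      simp only [map_add, map_smul, smul_eq_mul]
      rw [dirDeriv_mul hf (hθ Z hZ)]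
      ring
  rw [h2, h5, htr hW, ← h3, h7, ← hXx, ← hYx, ← sub_eq_zero]
  rw [← sub_eq_zero] at h6
  linarith

end RicciPlus

/-! ### The 3-form `H + dB` -/

section Twist

-- Instances on spaces of trilinear forms need a deeper search.
set_option maxSynthPendingDepth 3

variable {B : Tensor2 n M} (hBs : Smooth2 B) (hB : IsAlternating2 B)

include hB in
lemma extDeriv2_swap_left (X Y Z : VectorField n M) (x : M) :
    extDeriv2 B X Y Z x = -extDeriv2 B Y X Z x := by
  have h : (fun y => B y (Y y) (X y)) = fun y => -B y (X y) (Y y) :=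
    funext fun y => hB.swap _ _ _
  simp only [extDeriv2]
  rw [h, dirDeriv_neg, bracket_swap Y X, map_neg, _root_.neg_apply]
  ring

include hB in
lemma extDeriv2_swap_right (X Y Z : VectorField n M) (x : M) :
    extDeriv2 B X Y Z x = -extDeriv2 B X Z Y x := by
  have h : (fun y => B y (Z y) (Y y)) = fun y => -B y (Y y) (Z y) :=
    funext fun y => hB.swap _ _ _
  simp only [extDeriv2]
  rw [h, dirDeriv_neg, bracket_swap Z Y, map_neg, _root_.neg_apply]
  ring

include hBs hB in
lemma extDeriv2_apply_left {X Y Z : VectorField n M} (hX : SmoothVF X) (hY : SmoothVF Y)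
    (hZ : SmoothVF Z) (x : M) :
    extDeriv2 B X Y Z x = ∑ k, stdCov x k (X x) * extDeriv2 B (extVec (stdVec x k)) Y Z x := by
  refine tensorial_apply (Φ := fun X => extDeriv2 B X Y Z x) (fun X X' hX hX' => ?_)
    (fun f X hf hX => ?_) hX
  · simp only [extDeriv2, map_add, _root_.add_apply, dirDeriv_add_vec]
    rw [dirDeriv_add (hBs X Z hX hZ) (hBs X' Z hX' hZ), dirDeriv_add (hBs X Y hX hY)
      (hBs X' Y hX' hY), bracket_add_left hX hX', bracket_add_left hX hX']
    simp only [map_add, _root_.add_apply]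
    ring
  · simp only [extDeriv2, map_smul, _root_.smul_apply, smul_eq_mul, dirDeriv_smul_vec]
    rw [dirDeriv_mul hf (hBs X Z hX hZ), dirDeriv_mul hf (hBs X Y hX hY), bracket_smul_left hf hX,
      bracket_smul_left hf hX]
    simp only [map_add, map_smul, _root_.add_apply, _root_.smul_apply, smul_eq_mul]
    rw [hB.swap x (X x) (Y x), hB.swap x (X x) (Z x)]
    ring

/-- The trilinear form with the coefficients `c`. -/
def trilinear (c : Fin n → Fin n → Fin n → ℝ) : EuclideanSpace ℝ (Fin n) →L[ℝ]
    EuclideanSpace ℝ (Fin n) →L[ℝ] EuclideanSpace ℝ (Fin n) →L[ℝ] ℝ :=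
  ∑ i, ∑ j, ∑ k, c i j k • (EuclideanSpace.proj i : EuclideanSpace ℝ (Fin n) →L[ℝ] ℝ).smulRight
    ((EuclideanSpace.proj j : EuclideanSpace ℝ (Fin n) →L[ℝ] ℝ).smulRight
      (EuclideanSpace.proj k : EuclideanSpace ℝ (Fin n) →L[ℝ] ℝ))

omit [T2Space M] [IsManifold (𝓡 n) ∞ M] in
lemma trilinear_apply (c : Fin n → Fin n → Fin n → ℝ) (u v w : EuclideanSpace ℝ (Fin n)) :
    trilinear c u v w = ∑ i, ∑ j, ∑ k, c i j k * (u i * (v j * w k)) := by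
  simp only [trilinear, _root_.sum_apply, _root_.smul_apply, smul_eq_mul,
    ContinuousLinearMap.smulRight_apply, PiLp.proj_apply]

/-- The 3-form `H + dB`. Since `dB` is tensorial, it is defined by its values on the coordinate
frame at each point. -/
def twist (H : Tensor3 n M) (B : Tensor2 n M) : Tensor3 n M := fun x =>
  id (α := EuclideanSpace ℝ (Fin n) →L[ℝ] EuclideanSpace ℝ (Fin n) →L[ℝ]
      EuclideanSpace ℝ (Fin n) →L[ℝ] ℝ) (H x) +
    trilinear fun i j k => extDeriv2 B (extVec (stdVec x i)) (extVec (stdVec x j))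
      (extVec (stdVec x k)) x

lemma twist_apply (H : Tensor3 n M) (B : Tensor2 n M) (x : M) (u v w : TangentSpace (𝓡 n) x) :
    twist H B x u v w = H x u v w + ∑ i, ∑ j, ∑ k, extDeriv2 B (extVec (stdVec x i))
      (extVec (stdVec x j)) (extVec (stdVec x k)) x *
        (stdCov x i u * (stdCov x j v * stdCov x k w)) :=
  congrArg (H x u v w + ·) (trilinear_apply (fun i j k => extDeriv2 B (extVec (stdVec x i))
    (extVec (stdVec x j)) (extVec (stdVec x k)) x) u v w)

include hBs hB in
lemma isTwist_twist (H : Tensor3 n M) : IsTwist H B (twist H B) := by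
  intro X Y Z hX hY hZ x
  have h2 : ∀ i, extDeriv2 B (extVec (stdVec x i)) Y Z x = ∑ j, stdCov x j (Y x) *
      extDeriv2 B (extVec (stdVec x i)) (extVec (stdVec x j)) Z x := fun i => by
    rw [extDeriv2_swap_left hB, extDeriv2_apply_left hBs hB hY (smoothVF_extVec _) hZ,
      ← Finset.sum_neg_distrib]
    refine Finset.sum_congr rfl fun j _ => ?_
    rw [extDeriv2_swap_left hB (extVec (stdVec x j))]
    ring
  have h3 : ∀ i j, extDeriv2 B (extVec (stdVec x i)) (extVec (stdVec x j)) Z x =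
      ∑ k, stdCov x k (Z x) *
      extDeriv2 B (extVec (stdVec x i)) (extVec (stdVec x j)) (extVec (stdVec x k)) x :=
      fun i j => by
    rw [extDeriv2_swap_right hB, extDeriv2_swap_left hB, neg_neg,
      extDeriv2_apply_left hBs hB hZ (smoothVF_extVec _) (smoothVF_extVec _)]
    refine Finset.sum_congr rfl fun k _ => ?_
    rw [extDeriv2_swap_left hB (extVec (stdVec x k)), extDeriv2_swap_right hB, neg_neg]
  rw [extDeriv2_apply_left hBs hB hX hY hZ]
  rw [twist_apply]
  simp only [h2, h3, Finset.mul_sum]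
  congr 1
  refine Finset.sum_congr rfl fun i _ => Finset.sum_congr rfl fun j _ =>
    Finset.sum_congr rfl fun k _ => ?_
  ring

include hBs hB in
lemma isAlternating3_twist {H : Tensor3 n M} (hH : IsAlternating3 H) :
    IsAlternating3 (twist H B) := by
  intro x u v
  have hU := smoothVF_extVec u
  have hV := smoothVF_extVec v
  have h1 := isTwist_twist hBs hB H (extVec u) (extVec u) (extVec v) hU hU hV x
  have h2 := isTwist_twist hBs hB H (extVec u) (extVec v) (extVec v) hU hV hV x
  have h3 := extDeriv2_swap_left hB (extVec u) (extVec u) (extVec v) x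
  have h4 := extDeriv2_swap_right hB (extVec u) (extVec v) (extVec v) x
  simp only [extVec_self, (hH x u v).1, (hH x u v).2] at h1 h2
  constructor <;> linarith

lemma twist_zero (H : Tensor3 n M) : twist H 0 = H := by
  funext x
  have h : ∀ X Y Z : VectorField n M, extDeriv2 (0 : Tensor2 n M) X Y Z x = 0 := by
    intro X Y Z
    simp [extDeriv2, dirDeriv_const]
  ext u v w
  rw [twist_apply]
  simp only [h, zero_mul, Finset.sum_const_zero, add_zero]

lemma smoothFamily3_twist {J : Set ℝ} {H : Tensor3 n M} (hH : Smooth3 H) {B : ℝ → Tensor2 n M}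
    (hBs : SmoothFamily2 J B) (hB : ∀ t ∈ J, IsAlternating2 (B t)) :
    SmoothFamily3 J fun t => twist H (B t) := by
  intro X Y Z hX hY hZ
  have hX' := hX.family J
  have hY' := hY.family J
  have hZ' := hZ.family J
  refine SmoothFamily0.congr ((SmoothFn.family (hH X Y Z hX hY hZ) J).add
    ((((((hBs.apply hY' hZ').dirDeriv hX').sub ((hBs.apply hX' hZ').dirDeriv hY')).add
      ((hBs.apply hX' hY').dirDeriv hZ')).sub (hBs.apply (hX'.bracket hY') hZ')).add
      (hBs.apply (hX'.bracket hZ') hY') |>.sub (hBs.apply (hY'.bracket hZ') hX')))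
    fun t ht y => isTwist_twist (hBs.slice ht) (hB t ht) H X Y Z hX hY hZ y

end Twist

/-! ### Continuity of the curvature terms in time -/

section TimeContinuity

variable {J : Set ℝ}

lemma SmoothFamily0.contDiffOn {F : ℝ → M → ℝ} (hF : SmoothFamily0 n J F) (x : M) :
    ContDiffOn ℝ ∞ (fun t => F t x) J := by
  rw [← contMDiffOn_iff_contDiffOn]
  exact ContMDiffOn.comp (t := J ×ˢ Set.univ) (f := fun t : ℝ => ((t, x) : ℝ × M)) hF
    (contMDiff_id.prodMk contMDiff_const).contMDiffOn fun t ht => ⟨ht, trivial⟩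

lemma SmoothFamily0.continuousOn {F : ℝ → M → ℝ} (hF : SmoothFamily0 n J F) (x : M) :
    ContinuousOn (fun t => F t x) J := (hF.contDiffOn x).continuousOn

lemma SmoothFamilyVF.contDiffOn_stdCov {Z : ℝ → VectorField n M} (hZ : SmoothFamilyVF J Z) (x : M)
    (k : Fin n) : ContDiffOn ℝ ∞ (fun t => stdCov x k (Z t x)) J := by
  simpa only [dirDeriv_coordFn_self] using (hZ.coord x k).contDiffOn x

variable {g : ℝ → Tensor2 n M} (hgs : SmoothFamily2 J g) (hg : ∀ t ∈ J, IsRiemannian (g t))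
include hgs hg

lemma continuousOn_ricci (x : M) (u v : TangentSpace (𝓡 n) x) :
    ContinuousOn (fun t => ricci (g t) x u v) J := by
  simp only [ricci, traceT]
  refine continuousOn_finsetSum _ fun k _ => ?_
  have hE := (smoothVF_extVec (stdVec x k)).family J
  have hU := (smoothVF_extVec u).family J
  have hV := (smoothVF_extVec v).family J
  exact (SmoothFamilyVF.contDiffOn_stdCov (((hgs.leviCivita hg hE (hgs.leviCivita hg hU hV)).sub
    (hgs.leviCivita hg hU (hgs.leviCivita hg hE hV))).sub
      (hgs.leviCivita hg (hE.bracket hU) hV)) x k).continuousOn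

/-- The vector fields dual to the coordinate frame at a point form smooth families. -/
lemma smoothFamilyVF_sharp_extCov {x : M} (ξ : TangentSpace (𝓡 n) x →L[ℝ] ℝ) :
    SmoothFamilyVF J fun t y => sharp (g t) y (extCov ξ y) :=
  hgs.sharp hg (Smooth1.family (smooth1_extCov ξ) J)

variable {H : ℝ → Tensor3 n M} (hHs : SmoothFamily3 J H)
include hHs

lemma continuousOn_circ (x : M) (u v : TangentSpace (𝓡 n) x) :
    ContinuousOn (fun t => circ (g t) (H t) x u v) J := by
  simp only [circ, traceMetric]
  refine continuousOn_finsetSum _ fun i _ => continuousOn_finsetSum _ fun j _ => ?_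
  have h1 := (hHs.apply ((smoothVF_extVec u).family J) ((smoothVF_extVec (stdVec x i)).family J)
    ((smoothVF_extVec (stdVec x j)).family J)).continuousOn x
  have h2 := (hHs.apply ((smoothVF_extVec v).family J)
    (smoothFamilyVF_sharp_extCov hgs hg (stdCov x i))
    (smoothFamilyVF_sharp_extCov hgs hg (stdCov x j))).continuousOn x
  simp only [extVec_self, extCov_self] at h1 h2
  exact h1.mul h2

lemma continuousOn_codiff (x : M) (u v : TangentSpace (𝓡 n) x) :
    ContinuousOn (fun t => codiff (g t) (H t) x u v) J := by
  simp only [codiff, traceMetric]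
  refine (continuousOn_finsetSum _ fun i _ => ?_).neg
  have hE := (smoothVF_extVec (stdVec x i)).family J
  have hU := (smoothVF_extVec u).family J
  have hV := (smoothVF_extVec v).family J
  have hS := smoothFamilyVF_sharp_extCov hgs hg (stdCov x i)
  have h1 := (((((hHs.apply hS hU hV).dirDeriv hE).sub
    (hHs.apply (hgs.leviCivita hg hE hS) hU hV)).sub
    (hHs.apply hS (hgs.leviCivita hg hE hU) hV)).sub
    (hHs.apply hS hU (hgs.leviCivita hg hE hV))).continuousOn x
  refine h1.congr fun t ht => ?_
  refine (hg t ht).covDeriv3_congr_left (hHs.slice ht) (smoothVF_extVec _) (smoothVF_extVec _)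
    (hS.slice ht) (smoothVF_extVec _) (smoothVF_extVec _) ?_
  rw [extVec_self, extCov_self]

lemma continuousOn_bismutDeriv {θ : ℝ → Tensor1 n M} (hθ : SmoothFamily1 J θ) (x : M)
    (u v : TangentSpace (𝓡 n) x) :
    ContinuousOn (fun t => bismutDeriv (g t) (H t) (θ t) x u v) J := by
  have hU := (smoothVF_extVec u).family J
  have hV := (smoothVF_extVec v).family J
  have hb : SmoothFamilyVF J fun t => bismut (g t) (H t) (extVec u) (extVec v) :=
    (hgs.leviCivita hg hU hV).add (SmoothFamilyVF.smul (smoothFamily0_const (1 / 2))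
      (hgs.sharp hg (ξ := fun t y => H t y (extVec u y) (extVec v y))
        fun Z hZ => hHs _ _ Z (smoothVF_extVec u) (smoothVF_extVec v) hZ))
  have h1 := (((hθ.apply hV).dirDeriv hU).sub (hθ.apply hb)).continuousOn x
  simpa only [extVec_self, bismutDeriv] using h1

end TimeContinuity

/-! ### Time derivatives of smooth families -/

section TimeDerivative

variable {J : Set ℝ}

/-- The time derivative of a smooth family of functions is smooth. -/
lemma SmoothFamily0.smoothFn_derivWithin {F : ℝ → M → ℝ} (hF : SmoothFamily0 n J F)
    (hJ : UniqueDiffOn ℝ J) {t : ℝ} (ht : t ∈ J) :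
    SmoothFn (n := n) fun y => derivWithin (fun s => F s y) J t := by
  intro x
  have h1 : ContMDiffWithinAt (𝓡 n) 𝓘(ℝ, ℝ →L[ℝ] ℝ) ∞
      (inTangentCoordinates 𝓘(ℝ, ℝ) 𝓘(ℝ, ℝ) (fun _ : M => t) (fun y : M => F t y)
        (fun y => mfderivWithin 𝓘(ℝ, ℝ) 𝓘(ℝ, ℝ) (fun s => F s y) J t) x) Set.univ x := by
    refine ContMDiffWithinAt.mfderivWithin (n := ∞) (f := fun (y : M) (s : ℝ) => F s y)
      (u := J) (g := fun _ : M => t) ?_ contMDiffWithinAt_const (Set.mem_univ _)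
      (fun _ _ => ht) (by simp) hJ.uniqueMDiffOn
    have h0 := hF (t, x) ⟨ht, trivial⟩
    exact h0.comp (t := J ×ˢ Set.univ) (x := (x, t))
      (f := fun q : M × ℝ => ((q.2, q.1) : ℝ × M))
      (contMDiffWithinAt_snd.prodMk contMDiffWithinAt_fst) (fun q hq => ⟨hq.2, trivial⟩)
  rw [contMDiffWithinAt_univ] at h1
  have h2 : ContMDiffAt (𝓡 n) 𝓘(ℝ, ℝ) ∞ (fun y : M =>
      inTangentCoordinates 𝓘(ℝ, ℝ) 𝓘(ℝ, ℝ) (fun _ : M => t) (fun y : M => F t y)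
        (fun y => mfderivWithin 𝓘(ℝ, ℝ) 𝓘(ℝ, ℝ) (fun s => F s y) J t) x y 1) x :=
    h1.clm_apply contMDiffAt_const
  refine h2.congr_of_eventuallyEq (Filter.Eventually.of_forall fun y => ?_)
  simp only [inTangentCoordinates_model_space, mfderivWithin_eq_fderivWithin]
  exact fderivWithin_derivWithin.symm

/-- Derivatives in time and space commute. -/
lemma SmoothFamily0.hasDerivWithinAt_dirDeriv {F : ℝ → M → ℝ} (hF : SmoothFamily0 n J F)
    (hJ : UniqueDiffOn ℝ J) (hJi : J ⊆ closure (interior J)) {t : ℝ} (ht : t ∈ J) {x : M}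
    (v : TangentSpace (𝓡 n) x) :
    HasDerivWithinAt (fun s => GenRicci.dirDeriv (F s) v)
      (GenRicci.dirDeriv (fun y => derivWithin (fun s => F s y) J t) v) J t := by
  set φ := extChartAt (𝓡 n) x with hφ
  have hV : IsOpen φ.target := isOpen_extChartAt_target x
  set s : Set (ℝ × EuclideanSpace ℝ (Fin n)) := J ×ˢ φ.target with hs
  set z₀ : EuclideanSpace ℝ (Fin n) := φ x with hz
  have hz₀ : z₀ ∈ φ.target := mem_extChartAt_target x
  set w : EuclideanSpace ℝ (Fin n) :=
    mfderiv (𝓡 n) 𝓘(ℝ, EuclideanSpace ℝ (Fin n)) φ x v with hw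
  let f : ℝ × EuclideanSpace ℝ (Fin n) → ℝ := fun q => F q.1 (φ.symm q.2)
  have hsU : UniqueDiffOn ℝ s := hJ.prod hV.uniqueDiffOn
  have hf : ContDiffOn ℝ ∞ f s := by
    rw [← contMDiffOn_iff_contDiffOn]
    refine ContMDiffOn.comp (t := J ×ˢ Set.univ)
      (f := fun q : ℝ × EuclideanSpace ℝ (Fin n) => ((q.1, φ.symm q.2) : ℝ × M)) hF
      (contDiff_fst.contMDiff.contMDiffOn.prodMk ?_) fun q hq => ⟨hq.1, trivial⟩
    exact (contMDiffOn_extChartAt_symm x).comp contDiff_snd.contMDiff.contMDiffOn fun q hq => hq.2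
  set D := fderivWithin ℝ f s with hD
  have hDs : ContDiffOn ℝ ∞ D s := hf.fderivWithin hsU (by simp)
  have hfd : ∀ q ∈ s, HasFDerivWithinAt f (D q) s q := fun q hq =>
    ((hf.differentiableOn (by simp)) q hq).hasFDerivWithinAt
  have hp : (t, z₀) ∈ s := ⟨ht, hz₀⟩
  have hDd : HasFDerivWithinAt D (fderivWithin ℝ D s (t, z₀)) s (t, z₀) :=
    ((hDs.differentiableOn (by simp)) _ hp).hasFDerivWithinAt
  have hsym : IsSymmSndFDerivWithinAt ℝ f s (t, z₀) := by
    refine (hf _ hp).isSymmSndFDerivWithinAt (by simpa using ENat.LEInfty.out) hsU ?_ hp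
    rw [hs, interior_prod_eq, closure_prod_eq, hV.interior_eq]
    exact ⟨hJi ht, subset_closure hz₀⟩
  have hspace : ∀ r ∈ J, ∀ z ∈ φ.target, HasFDerivAt (fun z => (r, z))
      (ContinuousLinearMap.inr ℝ ℝ (EuclideanSpace ℝ (Fin n))) z := fun r _ z _ =>
    hasFDerivAt_prodMk_right r z
  have htime : ∀ r ∈ J, ∀ z ∈ φ.target, HasDerivWithinAt (fun r => ((r, z) : ℝ × _))
      ((1, 0) : ℝ × EuclideanSpace ℝ (Fin n)) J r := fun r _ z _ =>
    (hasDerivWithinAt_id r J).prodMk (hasDerivWithinAt_const r J z)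
  have h1 : ∀ r ∈ J, GenRicci.dirDeriv (F r) v = D (r, z₀) (0, w) := fun r hr => by
    rw [dirDeriv_eq_fderiv_mfderiv (hF.slice hr) x v]
    have h2 : HasFDerivWithinAt (F r ∘ φ.symm) ((D (r, z₀)).comp
        (ContinuousLinearMap.inr ℝ ℝ (EuclideanSpace ℝ (Fin n)))) φ.target z₀ :=
      HasFDerivWithinAt.comp (g := f) (f := fun z => (r, z)) (t := s) z₀ (hfd (r, z₀) ⟨hr, hz₀⟩)
        (hspace r hr z₀ hz₀).hasFDerivWithinAt fun z hz => ⟨hr, hz⟩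
    exact congrArg (fun L => L w) (h2.hasFDerivAt (hV.mem_nhds hz₀)).fderiv
  have h3 : ∀ z ∈ φ.target, derivWithin (fun r => F r (φ.symm z)) J t = D (t, z) (1, 0) :=
    fun z hz => by
      have := HasFDerivWithinAt.comp_hasDerivWithinAt (t := s) (f := fun r => ((r, z) : ℝ × _)) t
        (hfd (t, z) ⟨ht, hz⟩) (htime t ht z hz) (fun r hr => ⟨hr, hz⟩)
      exact this.derivWithin (hJ t ht)
  have h4 : GenRicci.dirDeriv (fun y => derivWithin (fun s => F s y) J t) v =
      fderivWithin ℝ D s (t, z₀) (0, w) (1, 0) := by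
    rw [dirDeriv_eq_fderiv_mfderiv (hF.smoothFn_derivWithin hJ ht) x v]
    have h5 : HasFDerivWithinAt (fun z => D (t, z)) ((fderivWithin ℝ D s (t, z₀)).comp
        (ContinuousLinearMap.inr ℝ ℝ (EuclideanSpace ℝ (Fin n)))) φ.target z₀ :=
      HasFDerivWithinAt.comp (g := D) (f := fun z => (t, z)) (t := s) z₀ hDd
        (hspace t ht z₀ hz₀).hasFDerivWithinAt fun z hz => ⟨ht, hz⟩
    have h6 : HasFDerivAt (fun z => D (t, z) (1, 0)) _ z₀ :=
      (h5.hasFDerivAt (hV.mem_nhds hz₀)).clm_apply (hasFDerivAt_const _ _)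
    have h7 : ((fun y => derivWithin (fun s => F s y) J t) ∘ φ.symm) =ᶠ[𝓝 z₀]
        fun z => D (t, z) (1, 0) := by
      filter_upwards [hV.mem_nhds hz₀] with z hz
      exact h3 z hz
    refine (congrArg (fun L => L w) (h7.fderiv_eq.trans h6.fderiv)).trans ?_
    simp
  have h8 : HasDerivWithinAt (fun r => D (r, z₀)) (fderivWithin ℝ D s (t, z₀) (1, 0)) J t :=
    HasFDerivWithinAt.comp_hasDerivWithinAt (t := s) (f := fun r => ((r, z₀) : ℝ × _)) t
      hDd (htime t ht z₀ hz₀) (fun r hr => ⟨hr, hz₀⟩)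
  have h9 : HasDerivWithinAt (fun r => D (r, z₀) (0, w))
      (fderivWithin ℝ D s (t, z₀) (1, 0) (0, w)) J t := by
    have := h8.clm_apply (hasDerivWithinAt_const t J ((0, w) : ℝ × EuclideanSpace ℝ (Fin n)))
    simpa using this
  rw [h4, ← hsym.eq (1, 0) (0, w)]
  exact h9.congr h1 (h1 t ht)

end TimeDerivative

/-! ### Pull-backs of tensors -/

section Pullback

/-- A smooth section of Riemannian metrics in the sense of Mathlib is a Riemannian metric. -/
lemma isRiemannian_inner (g : Bundle.ContMDiffRiemannianMetric (𝓡 n) ∞ (EuclideanSpace ℝ (Fin n))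
    (TangentSpace (𝓡 n) : M → Type _)) : IsRiemannian g.inner where
  symm := g.symm
  pos := g.pos
  smooth X Y hX hY x := by
    have h := ContMDiffWithinAt.clm_bundle_apply₂ (F₁ := EuclideanSpace ℝ (Fin n))
      (F₂ := EuclideanSpace ℝ (Fin n)) (F₃ := ℝ) (E₃ := Bundle.Trivial M ℝ) (s := Set.univ)
      (b := fun x : M => x) (ψ := g.inner)
      (g.contMDiff x).contMDiffWithinAt (hX x).contMDiffWithinAt (hY x).contMDiffWithinAt
    simp only [Bundle.contMDiffWithinAt_totalSpace] at h
    exact contMDiffWithinAt_univ.1 h.2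

lemma dirDeriv_mfderiv {φ : M → M} {x : M} (hφ : MDifferentiableAt (𝓡 n) (𝓡 n) φ x) {f : M → ℝ}
    (hf : SmoothFn (n := n) f) (v : TangentSpace (𝓡 n) x) :
    dirDeriv f (mfderiv (𝓡 n) (𝓡 n) φ x v) = dirDeriv (fun y => f (φ y)) v := by
  have h := mfderiv_comp x (hf.mdiffAt (φ x)) hφ
  exact (congrArg (fun L => L v) h).symm

/-- The pull-back of a tensor in terms of coordinates near the image point. -/
lemma pullback_apply {φ : M → M} {x z : M} (hφ : MDifferentiableAt (𝓡 n) (𝓡 n) φ x)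
    (hz : φ x ∈ coordNhd n z) (g : Tensor2 n M) (u v : TangentSpace (𝓡 n) x) :
    pullback φ g x u v = ∑ k, ∑ l, g (φ x) (extVec (stdVec z k) (φ x)) (extVec (stdVec z l) (φ x)) *
      (dirDeriv (fun y => coordFn z k (φ y)) u * dirDeriv (fun y => coordFn z l (φ y)) v) := by
  have h : pullback φ g x u v =
      g (φ x) (mfderiv (𝓡 n) (𝓡 n) φ x u) (mfderiv (𝓡 n) (𝓡 n) φ x v) := rfl
  rw [h, ← sum_dirDeriv_coordFn_smul hz (mfderiv (𝓡 n) (𝓡 n) φ x u),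
    ← sum_dirDeriv_coordFn_smul hz (mfderiv (𝓡 n) (𝓡 n) φ x v)]
  simp only [map_sum, map_smul, _root_.sum_apply, _root_.smul_apply, smul_eq_mul,
    dirDeriv_mfderiv hφ (smoothFn_coordFn z _), Finset.mul_sum]
  rw [Finset.sum_comm]
  refine Finset.sum_congr rfl fun k _ => Finset.sum_congr rfl fun l _ => ?_
  ring

end Pullback

/-! ### The Lie derivative as a derivative of pull-backs -/

section Flow

variable {J : Set ℝ} {Φ : ℝ → M → M}
  (hΦ : ContMDiffOn (𝓘(ℝ, ℝ).prod (𝓡 n)) (𝓡 n) ∞ (fun p : ℝ × M => Φ p.1 p.2) (J ×ˢ Set.univ))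

include hΦ in
lemma SmoothFn.comp_family {f : M → ℝ} (hf : SmoothFn (n := n) f) :
    SmoothFamily0 n J fun t y => f (Φ t y) :=
  ContMDiff.comp_contMDiffOn (I' := 𝓡 n) hf hΦ

include hΦ in
lemma mdifferentiableAt_slice {t : ℝ} (ht : t ∈ J) (x : M) :
    MDifferentiableAt (𝓡 n) (𝓡 n) (Φ t) x := by
  have h : ContMDiffOn (𝓡 n) (𝓡 n) ∞ (fun y => Φ t y) Set.univ :=
    ContMDiffOn.comp (t := J ×ˢ Set.univ) (f := fun y : M => ((t, y) : ℝ × M)) hΦ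
      (contMDiff_const.prodMk contMDiff_id).contMDiffOn fun y _ => ⟨ht, trivial⟩
  exact (contMDiffOn_univ.1 h).mdifferentiableAt (by simp)

include hΦ in
lemma Smooth2.smoothFamily2_pullback {g : Tensor2 n M} (hg : Smooth2 g) :
    SmoothFamily2 J fun t => pullback (Φ t) g := by
  intro X Y hX hY p hp
  set z := Φ p.1 p.2
  have h1 : SmoothFamily0 n J fun t y => ∑ k, ∑ l,
      g (Φ t y) (extVec (stdVec z k) (Φ t y)) (extVec (stdVec z l) (Φ t y)) *
      (dirDeriv (fun y => coordFn z k (Φ t y)) (X y) *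
        dirDeriv (fun y => coordFn z l (Φ t y)) (Y y)) := by
    refine smoothFamily0_sum _ fun k _ => smoothFamily0_sum _ fun l _ => ?_
    exact (SmoothFn.comp_family hΦ (hg _ _ (smoothVF_extVec _) (smoothVF_extVec _))).mul
      (((SmoothFn.comp_family hΦ (smoothFn_coordFn z k)).dirDeriv (hX.family J)).mul
        ((SmoothFn.comp_family hΦ (smoothFn_coordFn z l)).dirDeriv (hY.family J)))
  refine (h1 p hp).congr_of_eventuallyEq ?_
    (pullback_apply (mdifferentiableAt_slice hΦ hp.1 p.2) (mem_coordNhd z) g _ _)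
  filter_upwards [(hΦ p hp).continuousWithinAt.preimage_mem_nhdsWithin
    (coordNhd_mem_nhds (n := n) z), self_mem_nhdsWithin] with q hq hq'
  exact pullback_apply (mdifferentiableAt_slice hΦ hq'.1 q.2) hq g _ _

lemma SmoothFn.hasDerivWithinAt_comp {f : M → ℝ} (hf : SmoothFn (n := n) f) {t : ℝ} {x : M}
    {w : TangentSpace (𝓡 n) (Φ t x)}
    (h : HasMFDerivWithinAt 𝓘(ℝ, ℝ) (𝓡 n) (fun s => Φ s x) J t
      (ContinuousLinearMap.toSpanSingleton ℝ w)) :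
    HasDerivWithinAt (fun s => f (Φ s x)) (GenRicci.dirDeriv f w) J t := by
  have h1 := (hf.mdiffAt (Φ t x)).hasMFDerivAt.comp_hasMFDerivWithinAt t h
  let L : ℝ →L[ℝ] ℝ := (mfderiv (𝓡 n) 𝓘(ℝ, ℝ) f (Φ t x)).comp
    (ContinuousLinearMap.toSpanSingleton ℝ w)
  have h2 : HasFDerivWithinAt (fun s => f (Φ s x)) L J t :=
    hasMFDerivWithinAt_iff_hasFDerivWithinAt.1 h1
  refine h2.hasDerivWithinAt.congr_deriv ?_
  refine congrArg (mfderiv (𝓡 n) 𝓘(ℝ, ℝ) f (Φ t x)) ?_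
  exact one_smul ℝ w

variable {Y : VectorField n M} (hJ : UniqueDiffOn ℝ J) (h0 : (0 : ℝ) ∈ J) (hid : ∀ x, Φ 0 x = x)
  (hY : ∀ x, HasMFDerivWithinAt 𝓘(ℝ, ℝ) (𝓡 n) (fun s => Φ s x) J 0
    (ContinuousLinearMap.toSpanSingleton ℝ (Y (Φ 0 x))))

include hJ h0 hid hY in
lemma derivWithin_comp_flow {f : M → ℝ} (hf : SmoothFn (n := n) f) (x : M) :
    derivWithin (fun s => f (Φ s x)) J 0 = dirDeriv f (Y x) := by
  rw [(hf.hasDerivWithinAt_comp (hY x)).derivWithin (hJ 0 h0), hid]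

include hΦ hJ h0 hid hY in
/-- The velocity of a smooth family of maps is a smooth vector field. -/
lemma smoothVF_velocity : SmoothVF Y := by
  rw [smoothVF_iff]
  intro f hf
  exact ((SmoothFn.comp_family hΦ hf).smoothFn_derivWithin hJ h0).congr fun y =>
    (derivWithin_comp_flow hJ h0 hid hY hf y).symm

lemma lieDeriv_eq_sum {g : Tensor2 n M} (hg : Smooth2 g) (hY : SmoothVF Y) (x : M)
    (u v : TangentSpace (𝓡 n) x) :
    lieDeriv Y g x u v = ∑ k, ∑ l,
      (dirDeriv (fun y => g y (extVec (stdVec x k) y) (extVec (stdVec x l) y)) (Y x) *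
          (stdCov x k u * stdCov x l v) +
        g x (stdVec x k) (stdVec x l) *
          (dirDeriv (fun y => dirDeriv (coordFn x k) (Y y)) u * stdCov x l v +
            stdCov x k u * dirDeriv (fun y => dirDeriv (coordFn x l) (Y y)) v)) := by
  have hG : ∀ k l, SmoothFn (n := n) fun y =>
      g y (extVec (stdVec x k) y) (extVec (stdVec x l) y) := fun k l =>
    hg _ _ (smoothVF_extVec _) (smoothVF_extVec _)
  have hext : ∀ w : TangentSpace (𝓡 n) x, ∀ y ∈ coordNhd n x,
      extVec w y = ∑ k, stdCov x k w • extVec (stdVec x k) y := fun w y hy => by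
    conv_lhs => rw [← sum_dirDeriv_coordFn_smul hy (extVec w y)]
    simp only [dirDeriv_coordFn_extVec hy]
  have hbr : ∀ w : TangentSpace (𝓡 n) x, bracket Y (extVec w) x =
      ∑ k, (-dirDeriv (fun y => dirDeriv (coordFn x k) (Y y)) w) • stdVec x k := fun w => by
    conv_lhs => rw [← sum_stdCov_smul x (bracket Y (extVec w) x)]
    refine Finset.sum_congr rfl fun k _ => ?_
    congr 1
    rw [← dirDeriv_coordFn_self, dirDeriv_bracket (smoothFn_coordFn x k) hY (smoothVF_extVec w),
      extVec_self]
    have h : (fun y => dirDeriv (coordFn x k) (extVec w y)) =ᶠ[𝓝 x] fun _ => stdCov x k w := by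
      filter_upwards [coordNhd_mem_nhds (n := n) x] with y hy
      exact dirDeriv_coordFn_extVec hy k w
    rw [dirDeriv_congr h, dirDeriv_const, zero_sub]
  have hd : dirDeriv (fun y => g y (extVec u y) (extVec v y)) (Y x) = ∑ k, ∑ l,
      dirDeriv (fun y => g y (extVec (stdVec x k) y) (extVec (stdVec x l) y)) (Y x) *
          (stdCov x k u * stdCov x l v) := by
    have h : (fun y => g y (extVec u y) (extVec v y)) =ᶠ[𝓝 x] fun y => ∑ k, ∑ l,
        (stdCov x k u * stdCov x l v) * g y (extVec (stdVec x k) y) (extVec (stdVec x l) y) := by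
      filter_upwards [coordNhd_mem_nhds (n := n) x] with y hy
      rw [hext u y hy, hext v y hy]
      simp only [map_sum, map_smul, _root_.sum_apply, _root_.smul_apply, smul_eq_mul,
        Finset.mul_sum]
      rw [Finset.sum_comm]
      refine Finset.sum_congr rfl fun k _ => Finset.sum_congr rfl fun l _ => ?_
      ring
    rw [dirDeriv_congr h, dirDeriv_sum _ fun k _ => smoothFn_sum _ fun l _ =>
      (smoothFn_const _).mul (hG k l)]
    refine Finset.sum_congr rfl fun k _ => ?_
    rw [dirDeriv_sum _ fun l _ => (smoothFn_const _).mul (hG k l)]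
    refine Finset.sum_congr rfl fun l _ => ?_
    rw [dirDeriv_const_mul _ (hG k l), mul_comm]
  have hu : u = ∑ k, stdCov x k u • stdVec x k := (sum_stdCov_smul x u).symm
  have hv : v = ∑ k, stdCov x k v • stdVec x k := (sum_stdCov_smul x v).symm
  have h1 : g x (bracket Y (extVec u) x) v = ∑ k, ∑ l, g x (stdVec x k) (stdVec x l) *
      (-dirDeriv (fun y => dirDeriv (coordFn x k) (Y y)) u * stdCov x l v) := by
    rw [hbr]
    conv_lhs => rw [hv]
    simp only [map_sum, map_smul, _root_.sum_apply, _root_.smul_apply, smul_eq_mul,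
      Finset.mul_sum]
    rw [Finset.sum_comm]
    refine Finset.sum_congr rfl fun k _ => Finset.sum_congr rfl fun l _ => ?_
    ring
  have h2 : g x u (bracket Y (extVec v) x) = ∑ k, ∑ l, g x (stdVec x k) (stdVec x l) *
      (stdCov x k u * -dirDeriv (fun y => dirDeriv (coordFn x l) (Y y)) v) := by
    rw [hbr]
    conv_lhs => rw [hu]
    simp only [map_sum, map_smul, _root_.sum_apply, _root_.smul_apply, smul_eq_mul,
      Finset.mul_sum]
    rw [Finset.sum_comm]
    refine Finset.sum_congr rfl fun k _ => Finset.sum_congr rfl fun l _ => ?_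
    ring
  rw [lieDeriv, hd, h1, h2, ← Finset.sum_sub_distrib, ← Finset.sum_sub_distrib]
  refine Finset.sum_congr rfl fun k _ => ?_
  rw [← Finset.sum_sub_distrib, ← Finset.sum_sub_distrib]
  refine Finset.sum_congr rfl fun l _ => ?_
  ring

include hΦ hJ h0 hid hY in
/-- The Lie derivative of a tensor is the derivative of its pull-back along a family of maps that
starts at the identity. -/
lemma hasDerivWithinAt_pullback (hJi : J ⊆ closure (interior J)) {g : Tensor2 n M}
    (hg : Smooth2 g) (x : M) (u v : TangentSpace (𝓡 n) x) :
    HasDerivWithinAt (fun t => pullback (Φ t) g x u v) (lieDeriv Y g x u v) J 0 := by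
  have hG : ∀ k l, SmoothFn (n := n) fun y =>
      g y (extVec (stdVec x k) y) (extVec (stdVec x l) y) := fun k l =>
    hg _ _ (smoothVF_extVec _) (smoothVF_extVec _)
  have hfk : ∀ k, ∀ w : TangentSpace (𝓡 n) x, HasDerivWithinAt
      (fun t => dirDeriv (fun y => coordFn x k (Φ t y)) w)
      (dirDeriv (fun y => dirDeriv (coordFn x k) (Y y)) w) J 0 := fun k w => by
    have h := (SmoothFn.comp_family hΦ (smoothFn_coordFn x k)).hasDerivWithinAt_dirDeriv hJ hJi
      h0 w
    simpa only [derivWithin_comp_flow hJ h0 hid hY (smoothFn_coordFn x k)] using h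
  have hGd : ∀ k l, HasDerivWithinAt
      (fun t => g (Φ t x) (extVec (stdVec x k) (Φ t x)) (extVec (stdVec x l) (Φ t x)))
      (dirDeriv (fun y => g y (extVec (stdVec x k) y) (extVec (stdVec x l) y)) (Y x)) J 0 :=
    fun k l => by
      have h := (hG k l).hasDerivWithinAt_comp (hY x)
      rwa [hid] at h
  have key : HasDerivWithinAt (fun t => ∑ k, ∑ l,
      g (Φ t x) (extVec (stdVec x k) (Φ t x)) (extVec (stdVec x l) (Φ t x)) *
      (dirDeriv (fun y => coordFn x k (Φ t y)) u * dirDeriv (fun y => coordFn x l (Φ t y)) v))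
      (lieDeriv Y g x u v) J 0 := by
    rw [lieDeriv_eq_sum hg (smoothVF_velocity hΦ hJ h0 hid hY)]
    refine HasDerivWithinAt.fun_sum fun k _ => HasDerivWithinAt.fun_sum fun l _ => ?_
    refine ((hGd k l).mul ((hfk k u).mul (hfk l v))).congr_deriv ?_
    have hg0 : g (Φ 0 x) (extVec (stdVec x k) (Φ 0 x)) (extVec (stdVec x l) (Φ 0 x)) =
        g x (stdVec x k) (stdVec x l) := by
      refine (congrArg (fun y => g y (extVec (stdVec x k) y) (extVec (stdVec x l) y))
        (hid x)).trans ?_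
      simp only [extVec_self]
    simp only [Pi.mul_apply, hid, hg0, dirDeriv_coordFn_self]
  have hcoord : ∀ t ∈ J, Φ t x ∈ coordNhd n x → pullback (Φ t) g x u v = ∑ k, ∑ l,
      g (Φ t x) (extVec (stdVec x k) (Φ t x)) (extVec (stdVec x l) (Φ t x)) *
      (dirDeriv (fun y => coordFn x k (Φ t y)) u * dirDeriv (fun y => coordFn x l (Φ t y)) v) :=
    fun t ht hx => pullback_apply (mdifferentiableAt_slice hΦ ht x) hx g u v
  refine key.congr_of_eventuallyEq ?_ (hcoord 0 h0 (by rw [hid]; exact mem_coordNhd x))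
  have hcont : ContinuousWithinAt (fun s => Φ s x) J 0 := (hY x).1
  filter_upwards [hcont.preimage_mem_nhdsWithin (t := coordNhd n x)
    (by rw [hid]; exact coordNhd_mem_nhds (n := n) x), self_mem_nhdsWithin] with t ht ht'
  exact hcoord t ht' ht

end Flow

/-! ### The evolution of `g - B` along the flow -/

section Evolution

variable {J : Set ℝ} {g B : ℝ → Tensor2 n M}
  (hJ : UniqueDiffOn ℝ J) (hgs : SmoothFamily2 J g) (hg : ∀ t ∈ J, IsRiemannian (g t))
  (hBs : SmoothFamily2 J B) (hB : ∀ t ∈ J, IsAlternating2 (B t))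

include hgs hBs in
lemma contDiffOn_metric_sub (x : M) (u v : TangentSpace (𝓡 n) x) :
    ContDiffOn ℝ ∞ (fun s => g s x u v - B s x u v) J := by
  have h := ((hgs _ _ (smoothVF_extVec u) (smoothVF_extVec v)).sub
    (hBs _ _ (smoothVF_extVec u) (smoothVF_extVec v)))
  simpa only [extVec_self] using SmoothFamily0.contDiffOn (F := fun s y =>
    g s y (extVec u y) (extVec v y) - B s y (extVec u y) (extVec v y)) h x

include hg hB in
/-- The pairing `⟨𝒢(s) a, b⟩` for `a ∈ E_-|_t` and `b ∈ E_+|_t` in terms of `g - B`. The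
coefficients in the sum multiply terms that vanish at `s = t`, so only their values at `t` matter
for the derivative. -/
lemma pairing_genMetric_lift {s t : ℝ} (hs : s ∈ J) (ht : t ∈ J) (x : M)
    (u v : TangentSpace (𝓡 n) x) :
    pairing (genMetric (g s) (B s) x (lift (-1) (g t) (B t) x u)) (lift 1 (g t) (B t) x v) =
      (1 / 2) * ((g s x u v - B s x u v) - (g t x u v - B t x u v) -
        ∑ k, stdCov x k (sharp (g s) x ((lift (-1) (g t) (B t) x u).2 - B s x u)) *
          ((g s x (stdVec x k) v - B s x (stdVec x k) v) -
            (g t x (stdVec x k) v - B t x (stdVec x k) v))) := by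
  set p := sharp (g s) x ((lift (-1) (g t) (B t) x u).2 - B s x u) with hp
  have h1 : g s x p v = -g t x u v + B t x u v - B s x u v := by
    rw [hp, (hg s hs).apply_sharp, lift_snd]
    simp
  have h2 : ∑ k, stdCov x k p * ((g s x (stdVec x k) v - B s x (stdVec x k) v) -
      (g t x (stdVec x k) v - B t x (stdVec x k) v)) =
      (g s x p v - B s x p v) - (g t x p v - B t x p v) := by
    have : ∀ T : TangentSpace (𝓡 n) x →L[ℝ] TangentSpace (𝓡 n) x →L[ℝ] ℝ,
        T p v = ∑ k, stdCov x k p * T (stdVec x k) v := fun T => by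
      conv_lhs => rw [← sum_stdCov_smul x p]
      simp only [map_sum, map_smul, _root_.sum_apply, _root_.smul_apply, smul_eq_mul]
    rw [this, this (B s x), this (g t x), this (B t x)]
    simp only [mul_sub, Finset.sum_sub_distrib]
  rw [h2, genMetric_apply, lift_fst, ← hp]
  simp only [pairing, lift_snd, lift_fst, _root_.add_apply, _root_.smul_apply, smul_eq_mul]
  rw [h1, (hg t ht).symm x v p, (hB t ht).swap x v p]
  ring

include hJ hgs hg hBs hB in
/-- On pairs in `E_- × E_+`, the derivative of the generalized metric is the derivative of
`g - B`. -/
lemma hasDerivWithinAt_pairing_genMetric {t : ℝ} (ht : t ∈ J) (x : M)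
    (u v : TangentSpace (𝓡 n) x) :
    HasDerivWithinAt (fun s => pairing (genMetric (g s) (B s) x (lift (-1) (g t) (B t) x u))
      (lift 1 (g t) (B t) x v)) (derivWithin (fun s => g s x u v - B s x u v) J t) J t := by
  -- `-u` is the value at `s = t` of the vector whose coefficients enter the pairing; the sum then
  -- contributes the derivative of `g - B` on `(u, v)` once more, by linearity.
  set ξ := (lift (-1) (g t) (B t) x u).2 with hξ
  have hm : ∀ w : TangentSpace (𝓡 n) x, HasDerivWithinAt (fun s => g s x w v - B s x w v)
      (derivWithin (fun s => g s x w v - B s x w v) J t) J t := fun w =>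
    ((contDiffOn_metric_sub hgs hBs x w v).differentiableOn (by simp) t ht).hasDerivWithinAt
  have hlin : derivWithin (fun s => g s x u v - B s x u v) J t =
      ∑ k, stdCov x k u *
        derivWithin (fun s => g s x (stdVec x k) v - B s x (stdVec x k) v) J t := by
    have h : HasDerivWithinAt (fun s => g s x u v - B s x u v) (∑ k, stdCov x k u *
        derivWithin (fun s => g s x (stdVec x k) v - B s x (stdVec x k) v) J t) J t := by
      have h1 := HasDerivWithinAt.fun_sum (u := Finset.univ) fun k _ =>
        (hm (stdVec x k)).const_mul (stdCov x k u)
      refine h1.congr_of_mem (fun s _ => ?_) ht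
      have : ∀ T : TangentSpace (𝓡 n) x →L[ℝ] TangentSpace (𝓡 n) x →L[ℝ] ℝ,
          T u v = ∑ k, stdCov x k u * T (stdVec x k) v := fun T => by
        conv_lhs => rw [← sum_stdCov_smul x u]
        simp only [map_sum, map_smul, _root_.sum_apply, _root_.smul_apply, smul_eq_mul]
      rw [this (g s x), this (B s x)]
      simp only [mul_sub, Finset.sum_sub_distrib]
    exact h.derivWithin (hJ t ht)
  have hp : ∀ k, HasDerivWithinAt (fun s => stdCov x k (sharp (g s) x (ξ - B s x u)))
      (derivWithin (fun s => stdCov x k (sharp (g s) x (ξ - B s x u))) J t) J t := fun k => by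
    have h1 : SmoothFamily1 J fun s y => extCov ξ y - B s y (extVec u y) := fun Z hZ =>
      SmoothFamily0.sub (F := fun _ y => extCov ξ y (Z y))
        (G := fun s y => B s y (extVec u y) (Z y)) (Smooth1.family (smooth1_extCov ξ) J Z hZ)
        (hBs _ _ (smoothVF_extVec u) hZ)
    have h2 := (hgs.sharp hg h1).contDiffOn_stdCov x k
    simp only [extCov_self, extVec_self] at h2
    exact (h2.differentiableOn (by simp) t ht).hasDerivWithinAt
  have hpt : sharp (g t) x (ξ - B t x u) = -u := by
    have : ξ - B t x u = g t x (-u) := by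
      rw [hξ, lift_snd, map_neg]
      module
    rw [this, (hg t ht).sharp_apply]
  have h := (((hm u).sub (hasDerivWithinAt_const t J (g t x u v - B t x u v))).sub
    (HasDerivWithinAt.fun_sum (u := Finset.univ) fun k _ => (hp k).mul ((hm (stdVec x k)).sub
      (hasDerivWithinAt_const t J (g t x (stdVec x k) v - B t x (stdVec x k) v))))).const_mul
        (1 / 2 : ℝ)
  refine (h.congr_of_mem (fun s hs => pairing_genMetric_lift hg hB hs ht x u v) ht).congr_deriv ?_
  simp only [Pi.sub_apply, sub_self, mul_zero, zero_add, sub_zero, hpt, map_neg, neg_mul,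
    Finset.sum_neg_distrib]
  rw [← hlin]
  ring

include hJ hgs hg hBs hB in
/-- Along the flow, `∂_t (g - B) = -2 Rc + d^*H_t + ½ H_t ∘ H_t - ∇⁺θ` with `H_t = H + dB`. In the
interior of `J` this is the flow equation, and it extends to the end points by continuity. -/
theorem SolvesGenRicciFlow.derivWithin_eq {H : Tensor3 n M} {θ : ℝ → Tensor1 n M}
    (hflow : SolvesGenRicciFlow H J (fun t => genMetric (g t) (B t))
      (fun t => divOp (g t) fun x => (0, θ t x)))
    (hJi : J ⊆ closure (interior J)) (hH : Smooth3 H) (hHalt : IsAlternating3 H)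
    (hθ : SmoothFamily1 J θ) {t : ℝ} (ht : t ∈ J) (x : M) (u v : TangentSpace (𝓡 n) x) :
    derivWithin (fun s => g s x u v - B s x u v) J t =
      -2 * (ricci (g t) x u v - (1 / 2) * codiff (g t) (twist H (B t)) x u v
        - (1 / 4) * circ (g t) (twist H (B t)) x u v
        + (1 / 2) * bismutDeriv (g t) (twist H (B t)) (θ t) x u v) := by
  have htw := smoothFamily3_twist hH hBs hB
  refine Set.EqOn.of_subset_closure (s := interior J) (t := J)
    (f := fun t => derivWithin (fun s => g s x u v - B s x u v) J t)
    (g := fun t => -2 * (ricci (g t) x u v - (1 / 2) * codiff (g t) (twist H (B t)) x u v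
        - (1 / 4) * circ (g t) (twist H (B t)) x u v
        + (1 / 2) * bismutDeriv (g t) (twist H (B t)) (θ t) x u v))
    (fun t ht => ?_) ?_ ?_ interior_subset hJi ht
  · have htJ := interior_subset ht
    obtain ⟨D, hT, hD, hdiv, hder⟩ := hflow t ht
    have h1 := hder x (lift (-1) (g t) (B t) x u) (lift 1 (g t) (B t) x v)
      (((hg t htJ).genMetric_lift (by norm_num) x u).trans
        (Prod.ext (neg_one_smul ℝ _) (ContinuousLinearMap.ext fun w => neg_one_mul _)))
      (((hg t htJ).genMetric_lift (by norm_num) x v).trans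
        (Prod.ext (one_smul ℝ _) (one_smul ℝ _)))
    have h2 := hasDerivWithinAt_pairing_genMetric hJ hgs hg hBs hB htJ x u v
    rw [ricciPlus_eq hD hT (hg t htJ) (hBs.slice htJ) (hB t htJ)
      (isTwist_twist (hBs.slice htJ) (hB t htJ) H) (htw.slice htJ)
      (isAlternating3_twist (hBs.slice htJ) (hB t htJ) hHalt) (hθ.slice htJ) hdiv] at h1
    exact (hJ t htJ).eq_deriv _ h2 h1.hasDerivWithinAt
  · exact (contDiffOn_metric_sub hgs hBs x u v).continuousOn_derivWithin hJ (by simp)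
  · exact continuousOn_const.mul ((((continuousOn_ricci hgs hg x u v).sub
      (continuousOn_const.mul (continuousOn_codiff hgs hg htw x u v))).sub
      (continuousOn_const.mul (continuousOn_circ hgs hg htw x u v))).add
      (continuousOn_const.mul (continuousOn_bismutDeriv hgs hg htw hθ x u v)))

end Evolution

/-! ### Self-similar solutions -/

section SelfSimilar

lemma pullback_id {φ : M → M} (hφ : ∀ x, φ x = x) (g : Tensor2 n M) : pullback φ g = g := by
  obtain rfl : φ = id := funext hφ
  funext x
  ext u v
  have h : ∀ w : TangentSpace (𝓡 n) x, mfderiv (𝓡 n) (𝓡 n) (id : M → M) x w = w := fun w =>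
    congrArg (fun L => L w) (mfderiv_id (I := 𝓡 n) (x := x))
  exact congrArg₂ (fun a b : TangentSpace (𝓡 n) x => g x a b) (h u) (h v)

lemma IsRiemannian.pullback {g : Tensor2 n M} (hg : IsRiemannian g)
    (φ : Diffeomorph (𝓡 n) (𝓡 n) M M ∞) : IsRiemannian (pullback φ g) where
  smooth := by
    have h : ContMDiffOn (𝓘(ℝ, ℝ).prod (𝓡 n)) (𝓡 n) ∞ (fun p : ℝ × M => φ p.2)
        (Set.univ ×ˢ Set.univ) := (φ.contMDiff.comp contMDiff_snd).contMDiffOn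
    exact (Smooth2.smoothFamily2_pullback (Φ := fun _ => φ) h hg.smooth).slice
      (Set.mem_univ (0 : ℝ))
  symm x u v := hg.symm _ _ _
  pos x u hu := by
    refine hg.pos (φ x) _ fun h0 => hu ?_
    have h1 : mfderiv (𝓡 n) (𝓡 n) φ x u = 0 := h0
    have hφ : MDifferentiableAt (𝓡 n) (𝓡 n) φ x := φ.contMDiff.mdifferentiableAt (by simp)
    -- Every function on `M` factors through the diffeomorphism, so `u` annihilates it.
    refine eq_of_dirDeriv fun f hf => ?_
    have h2 := dirDeriv_mfderiv hφ (ContMDiff.comp (I' := 𝓡 n) hf φ.symm.contMDiff) u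
    rw [h1, dirDeriv_zero_vec] at h2
    rw [dirDeriv_zero_vec, h2]
    simp

lemma IsRiemannian.const_smul {g : Tensor2 n M} (hg : IsRiemannian g) {c : ℝ} (hc : 0 < c) :
    IsRiemannian fun x => c • g x where
  smooth X Y hX hY := SmoothFn.mul (smoothFn_const c) (hg.smooth X Y hX hY)
  symm x u v := congrArg (c * ·) (hg.symm x u v)
  pos x u hu := mul_pos hc (hg.pos x u hu)

lemma lieDeriv_const_smul {X : VectorField n M} (hX : SmoothVF X) (c : ℝ) (g : Tensor2 n M) (x : M)
    (u v : TangentSpace (𝓡 n) x) :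
    lieDeriv (fun y => c • X y) g x u v = c * lieDeriv X g x u v := by
  have h : ∀ w : TangentSpace (𝓡 n) x, bracket (fun y => c • X y) (extVec w) x =
      c • bracket X (extVec w) x := fun w => by
    rw [bracket_smul_left (smoothFn_const c) hX, dirDeriv_const, neg_zero, zero_smul, zero_add]
  simp only [lieDeriv, dirDeriv_smul_vec, h, map_smul, _root_.smul_apply, smul_eq_mul]
  ring

variable {J : Set ℝ}

lemma SmoothFamily2.smooth2_of_hasDerivWithinAt {B : ℝ → Tensor2 n M} (hBs : SmoothFamily2 J B)
    (hJ : UniqueDiffOn ℝ J) {t : ℝ} (ht : t ∈ J) {β : Tensor2 n M}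
    (hβ : ∀ x u v, HasDerivWithinAt (fun t => B t x u v) (β x u v) J t) : Smooth2 β :=
  fun X Y hX hY => (SmoothFamily0.smoothFn_derivWithin (hBs X Y hX hY) hJ ht).congr fun x =>
    ((hβ x (X x) (Y x)).derivWithin (hJ t ht)).symm

/-- The flow equation at time zero for metrics `c(t) φ_t^* g`: the time derivative of the metric is
`-2λ g - 2 L_X g`, which turns the flow equation into the soliton equation. -/
theorem solitonEq_of_flow {g : Tensor2 n M} (hg : IsRiemannian g) (hJ : UniqueDiffOn ℝ J)
    (hJi : J ⊆ closure (interior J)) (h0 : (0 : ℝ) ∈ J) {c : ℝ → ℝ} (hc : ContDiffOn ℝ ∞ c J)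
    (hcpos : ∀ t ∈ J, 0 < c t) (hc0 : c 0 = 1) {φ : ℝ → Diffeomorph (𝓡 n) (𝓡 n) M M ∞}
    (hφ : ContMDiffOn (𝓘(ℝ, ℝ).prod (𝓡 n)) (𝓡 n) ∞ (fun p : ℝ × M => φ p.1 p.2) (J ×ˢ Set.univ))
    (hid : ∀ x, φ 0 x = x) {X : VectorField n M} (hX : SmoothVF X)
    (hvel : ∀ x, HasMFDerivWithinAt 𝓘(ℝ, ℝ) (𝓡 n) (fun s => φ s x) J 0
      (ContinuousLinearMap.toSpanSingleton ℝ ((-2 : ℝ) • X (φ 0 x))))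
    {B : ℝ → Tensor2 n M} (hBs : SmoothFamily2 J B) (hB : ∀ t ∈ J, IsAlternating2 (B t))
    (hB0 : B 0 = 0) {θ : ℝ → Tensor1 n M} (hθ : SmoothFamily1 J θ) {lam : ℝ}
    (hlam : HasDerivWithinAt c (-2 * lam) J 0) {β : Tensor2 n M}
    (hβ : ∀ x u v, HasDerivWithinAt (fun t => B t x u v) (β x u v) J 0)
    {H : Tensor3 n M} (hH : Smooth3 H) (hHalt : IsAlternating3 H)
    (hflow : SolvesGenRicciFlow H J (fun t => genMetric (fun x => c t • pullback (φ t) g x) (B t))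
      (fun t => divOp (fun x => c t • pullback (φ t) g x) fun x => (0, θ t x))) :
    SolitonEq g lam X H (θ 0) β := by
  intro x u v
  have hgs : SmoothFamily2 J fun t x => c t • pullback (φ t) g x := by
    intro Y Z hY hZ
    have h1 : SmoothFamily0 n J fun t (_ : M) => c t :=
      (contMDiffOn_iff_contDiffOn.2 hc).comp contMDiffOn_fst fun p hp => hp.1
    exact h1.mul (G := fun t y => pullback (φ t) g y (Y y) (Z y))
      (Smooth2.smoothFamily2_pullback (Φ := fun t => φ t) hφ hg.smooth Y Z hY hZ)
  have hgr : ∀ t ∈ J, IsRiemannian fun x => c t • pullback (φ t) g x := fun t ht =>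
    (hg.pullback (φ t)).const_smul (hcpos t ht)
  have hg0 : (fun x => c 0 • pullback (φ 0) g x) = g := by
    rw [pullback_id hid, hc0]
    exact funext fun x => one_smul ℝ (g x)
  have h1 := SolvesGenRicciFlow.derivWithin_eq hJ hgs hgr hBs hB hflow hJi hH hHalt hθ h0 x u v
  have h2 : HasDerivWithinAt (fun s => (c s • pullback (φ s) g x) u v - B s x u v)
      (-2 * lam * g x u v + -2 * lieDeriv X g x u v - β x u v) J 0 := by
    have h3 := hasDerivWithinAt_pullback (Φ := fun t => φ t)
      (Y := fun y => (-2 : ℝ) • X y) hφ hJ h0 hid hvel hJi hg.smooth x u v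
    rw [lieDeriv_const_smul hX] at h3
    refine ((hlam.mul h3).sub (hβ x u v)).congr_deriv ?_
    simp only [hc0, pullback_id hid, one_mul]
  rw [h2.derivWithin (hJ 0 h0), hB0, twist_zero] at h1
  simp only [hg0] at h1
  linarith

end SelfSimilar

end

end GenRicci

end

theorem mainTheorem1 {n : ℕ} {M : Type*} [TopologicalSpace M]
    [ChartedSpace (EuclideanSpace ℝ (Fin n)) M] [IsManifold (𝓡 n) ∞ M]
    [T2Space M] [SecondCountableTopology M]
    (H₀ : GenRicci.Tensor3 n M) (hHsmooth : GenRicci.Smooth3 H₀)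
    (hHalt : GenRicci.IsAlternating3 H₀) (hHclosed : GenRicci.IsClosed3 H₀)
    (g₀ : Bundle.ContMDiffRiemannianMetric (𝓡 n) ∞ (EuclideanSpace ℝ (Fin n))
      (TangentSpace (𝓡 n) : M → Type _)) :
    -- a self-similar solution satisfies the soliton equation at time zero
    (∀ (J : Set ℝ), J.OrdConnected → (interior J).Nonempty → (0 : ℝ) ∈ J →
      ∀ (c : ℝ → ℝ) (φ : ℝ → Diffeomorph (𝓡 n) (𝓡 n) M M ∞)
        (Y : ℝ → GenRicci.VectorField n M)
        (B : ℝ → GenRicci.Tensor2 n M) (θ : ℝ → GenRicci.Tensor1 n M)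
        (lam : ℝ) (X : GenRicci.VectorField n M) (β : GenRicci.Tensor2 n M),
      ContDiffOn ℝ ∞ c J → (∀ t ∈ J, 0 < c t) → c 0 = 1 →
      ContMDiffOn (𝓘(ℝ, ℝ).prod (𝓡 n)) (𝓡 n) ∞
        (fun p : ℝ × M => φ p.1 p.2) (J ×ˢ Set.univ) →
      (∀ x, φ 0 x = x) →
      (∀ t ∈ J, ∀ x, HasMFDerivWithinAt 𝓘(ℝ, ℝ) (𝓡 n) (fun s => φ s x) J t
        (ContinuousLinearMap.toSpanSingleton ℝ (Y t (φ t x)))) →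
      GenRicci.SmoothFamily2 J B → (∀ t ∈ J, GenRicci.IsAlternating2 (B t)) → B 0 = 0 →
      GenRicci.SmoothFamily1 J θ →
      HasDerivWithinAt c (-2 * lam) J 0 →
      (∀ x, Y 0 x = (-2 : ℝ) • X x) →
      (∀ x u v, HasDerivWithinAt (fun t => B t x u v) (β x u v) J 0) →
      GenRicci.SolvesGenRicciFlow H₀ J
        (fun t => GenRicci.genMetric
          (fun x => c t • GenRicci.pullback (φ t) g₀.inner x) (B t))
        (fun t => GenRicci.divOp
          (fun x => c t • GenRicci.pullback (φ t) g₀.inner x) (fun x => (0, θ t x))) →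
      GenRicci.SmoothVF X ∧ GenRicci.Smooth2 β ∧ GenRicci.IsAlternating2 β ∧
      GenRicci.SolitonEq g₀.inner lam X H₀ (θ 0) β ∧
      GenRicci.SplitSolitonEq g₀.inner lam X H₀ (θ 0) β) ∧
    -- the soliton equation is equivalent to the split system
    (∀ (lam : ℝ) (X : GenRicci.VectorField n M) (θ₀ : GenRicci.Tensor1 n M)
        (β : GenRicci.Tensor2 n M),
      GenRicci.SmoothVF X → GenRicci.Smooth1 θ₀ → GenRicci.Smooth2 β →
      GenRicci.IsAlternating2 β →
      (GenRicci.SolitonEq g₀.inner lam X H₀ θ₀ β ↔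
        GenRicci.SplitSolitonEq g₀.inner lam X H₀ θ₀ β)) := by
  have hg := GenRicci.isRiemannian_inner g₀
  refine ⟨?_, fun lam X θ₀ β hX hθ _ hβ => hg.solitonEq_iff hHalt lam hX hθ hβ⟩
  intro J hJc hJne h0 c φ Y B θ lam X β hc hcpos hc0 hφ hid hY hBs hB hB0 hθ hlam hYX hβ hflow
  have hconv : Convex ℝ J := hJc.convex
  have hJ : UniqueDiffOn ℝ J := uniqueDiffOn_convex hconv hJne
  have hJi : J ⊆ closure (interior J) := by
    rw [hconv.closure_interior_eq_closure_of_nonempty_interior hJne]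
    exact subset_closure
  have hYX' : Y 0 = fun y => (-2 : ℝ) • X y := funext hYX
  have hX : GenRicci.SmoothVF X := by
    have h := GenRicci.SmoothVF.const_smul (-1 / 2)
      (GenRicci.smoothVF_velocity (Φ := fun t => φ t) (Y := Y 0) hφ hJ h0 hid (hY 0 h0))
    rw [hYX'] at h
    have h2 : (fun y => (-1 / 2 : ℝ) • (-2 : ℝ) • X y) = X := by
      funext y
      module
    rwa [h2] at h
  have hβs := hBs.smooth2_of_hasDerivWithinAt hJ h0 hβ
  have hβa : GenRicci.IsAlternating2 β := fun x u => by
    have h : HasDerivWithinAt (fun t => B t x u u) 0 J 0 :=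
      (hasDerivWithinAt_const (0 : ℝ) J (0 : ℝ)).congr_of_mem (fun t ht => hB t ht x u) h0
    exact (hJ 0 h0).eq_deriv _ (hβ x u u) h
  have hsol := GenRicci.solitonEq_of_flow hg hJ hJi h0 hc hcpos hc0 hφ hid hX
    (fun x => hYX (φ 0 x) ▸ hY 0 h0 x) hBs hB hB0 hθ
    hlam hβ hHsmooth hHalt hflow
  exact ⟨hX, hβs, hβa, hsol, (hg.solitonEq_iff hHalt lam hX (hθ.slice h0) hβa).1 hsol⟩
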